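/- Let $\zeta<1$, $\alpha>-1$, $\mu>-1$ be real, $\omega\in\mathbb C$ and $n\in\{0,1,2,\dots\}$. For $t>0$ consider on $(0,\infty)$ the weight $$w(x)=w(x;t)=(1-\zeta\,\theta(x-t))\,(x-t)^{\alpha}x^{\mu}e^{-x},$$ where $\theta$ is the Heaviside function and, for $x<t$, $(x-t)^\alpha$ means $\omega\,|x-t|^{\alpha}$ (so $\omega=(-1)^\alpha$ for integer $\alpha$, $\omega=1$ for $|x-t|^\alpha$, $\omega=e^{\pm i\pi\alpha}$ for the standard branches). Let $U\subseteq(0,\infty)$ be open and suppose that for every $t\in U$ there are polynomials $p_0,\dots,p_{n+1}$, $\deg p_i=i$, with $\int_0^\infty p_ip_jw\,dx=\delta_{ij}$; let $a_m,b_m$ be the coefficients (functions of $t$) in $a_{m+1}p_{m+1}=(x-b_m)p_m-a_mp_{m-1}$ for $0\le m\le n$, with $p_{-1}=0$, $a_0=0$. Put $$\theta_n=b_n-2n-1-\alpha-\mu-t,\qquad \kappa_n=\Big(n+\frac{\mu}{2}\Big)t+a_n^2-\sum_{i=0}^{n-1}b_i ,$$ $$q=\frac{\theta_n+t}{\theta_n},\qquad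 p=\frac{\theta_n\big(t(n+\alpha+\mu/2)-\kappa_n\big)}{t(\theta_n+t)} .$$ Let $v_1+v_2+v_3+v_4=0$, $v_3-v_4=-\mu$, $v_3-v_1=n+\alpha$, $v_3-v_2=n$ (so $v_2-v_1=\alpha$), and let $H=H(t,q,p)$ be the Okamoto Hamiltonian $$tH=q(q-1)^2p^2-\big((v_2-v_1)(q-1)^2-2(v_1+v_2)q(q-1)+tq\big)p+(v_3-v_1)(v_4-v_1)(q-1).$$ (i) At every $t\in U$ with $\theta_n(t)\ne0$ and $\theta_n(t)+t\neq0$, the functions $q,p$ satisfy the Hamilton equations $q'=\partial H/\partial p$, $p'=-\partial H/\partial q$; moreover $q\ne 0,1$, $\theta_n=t/(q-1)$, $\kappa_n=t(n+\alpha+\mu/2-pq)$, and $q$ satisfies the fifth Painlevé equation $$q''=\Big(\frac1{2q}+\frac1{q-1}\Big)(q')^2-\frac{q'}{t}+\frac{(q-1)^2}{t^2}\Big(\alpha_1q+\frac{\alpha_2}{q}\Big)+\frac{\alpha_3q}{t}+\frac{\alpha_4q(q+1)}{q-1}$$ with $\alpha_1=\frac12(v_3-v_4)^2=\frac{\mu^2}{2}$,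 $\alpha_2=-\frac12(v_2-v_1)^2=-\frac{\alpha^2}{2}$, $\alpha_3=2v_1+2v_2-1=-(2n+\alpha+1+\mu)$, $\alpha_4=-\frac12$. (ii) Suppose in addition that $\alpha+\mu>0$, $\alpha+\mu\notin\mathbb Z$ and that $U$ contains an interval $(0,\varepsilon)$. Put $$L=\Big(\frac{\omega}{1-\zeta}-\frac{\sin\pi\mu}{\sin\pi(\alpha+\mu)}\Big)\frac{\Gamma(\alpha+1)\Gamma(\mu+1)\Gamma(\alpha+\mu+n+1)}{n!\,\Gamma(\alpha+\mu+1)^3}.$$ Then, as $t\to0^+$, $$\theta_n=\Big\{-\frac{\mu}{\alpha+\mu}t+\frac{\alpha\mu(2n+1+\alpha+\mu)}{((\alpha+\mu)^2-1)(\alpha+\mu)^2}t^2+O(t^3)\Big\}-L\,t^{1+\alpha+\mu}+O(t^{2+\alpha+\mu}),$$ $$\kappa_n=\Big\{\frac{\mu(2n+\alpha+\mu)}{2(\alpha+\mu)}t-\frac{2n\alpha\mu(n+\alpha+\mu)}{((\alpha+\mu)^2-1)(\alpha+\mu)^2}t^2+O(t^3)\Big\}+nL\,t^{1+\alpha+\mu}+O(t^{2+\alpha+\mu}),$$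 where each brace stands for a function analytic at $t=0$ with the displayed initial terms. These expansions determine the solution: if $(0,T)\subseteq U$, $\theta_n$ and $\theta_n+t$ have no zero on $(0,T)$, and $(\tilde q,\tilde p)$ is any solution of the same Hamilton equations on $(0,T)$ for which $\tilde\theta=t/(\tilde q-1)$ and $\tilde\kappa=t(n+\alpha+\mu/2-\tilde p\tilde q)$ have these expansions (with the same displayed coefficients), then $\tilde q=q$ and $\tilde p=p$ on $(0,T)$. -/

import Mathlib

open Set Filter Topology Asymptotics MeasureTheory Polynomial

noncomputable section

/-- The Heaviside function: `1` for `y > 0` and `0` otherwise. -/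
def heaviside (y : ℝ) : ℝ := if 0 < y then 1 else 0

/-- The power `y ^ α` on the real line. For `y < 0` it is `ω * |y| ^ α`, where the constant `ω`
fixes the meaning of a power of a negative number: `ω = (-1) ^ α` is the literal power for an
integer `α`, `ω = 1` gives `|y| ^ α`, and `ω = exp (± i π α)` gives the two standard branches. -/
def branchPow (ω : ℂ) (α y : ℝ) : ℂ :=
  if 0 ≤ y then ((y ^ α : ℝ) : ℂ) else ω * (((-y) ^ α : ℝ) : ℂ)

/-- The deformed Laguerre weight `(1 - ζ θ(x - t)) (x - t) ^ α x ^ μ e ^ (-x)` on `x > 0`. -/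
def deformedLaguerreWeight (ζ α μ : ℝ) (ω : ℂ) (t x : ℝ) : ℂ :=
  ((1 - ζ * heaviside (x - t) : ℝ) : ℂ) * branchPow ω α (x - t)
    * ((x ^ μ * Real.exp (-x) : ℝ) : ℂ)

/-- `p 0, …, p N` are orthonormal polynomials, with `p i` of degree `i`, for the bilinear form
`⟨f, g⟩ = ∫₀^∞ f g w`, and `a`, `b` are the coefficients of their three term recurrence
`a (m+1) p (m+1) = (x - b m) p m - a m p (m-1)`. The convention `p (-1) = 0` is
expressed by `a 0 = 0` (so that the last term disappears for `m = 0`). -/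
structure IsOrthonormalWithRecurrence (w : ℝ → ℂ) (N : ℕ) (p : ℕ → ℂ[X]) (a b : ℕ → ℂ) :
    Prop where
  degree_eq : ∀ i ≤ N, (p i).degree = (i : WithBot ℕ)
  orthonormal : ∀ i ≤ N, ∀ j ≤ N,
    ∫ x in Ioi (0 : ℝ), (p i).eval (x : ℂ) * (p j).eval (x : ℂ) * w x = if i = j then 1 else 0
  a_zero : a 0 = 0
  recurrence : ∀ m < N,
    C (a (m + 1)) * p (m + 1) = (X - C (b m)) * p m - C (a m) * p (m - 1)

/-- `θ_n = b_n - 2n - 1 - α - μ - t`. -/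
def thetaCoeff (α μ : ℝ) (n : ℕ) (b : ℝ → ℕ → ℂ) (t : ℝ) : ℂ :=
  b t n - 2 * n - 1 - α - μ - t

/-- `κ_n = (n + μ/2) t + a_n² - ∑_{i<n} b_i`. -/
def kappaCoeff (μ : ℝ) (n : ℕ) (a b : ℝ → ℕ → ℂ) (t : ℝ) : ℂ :=
  (n + μ / 2) * t + a t n ^ 2 - ∑ i ∈ Finset.range n, b t i

/-- `q = (θ_n + t) / θ_n`. -/
def qCoord (α μ : ℝ) (n : ℕ) (b : ℝ → ℕ → ℂ) (t : ℝ) : ℂ :=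
  (thetaCoeff α μ n b t + t) / thetaCoeff α μ n b t

/-- `p = θ_n ((n + α + μ/2) t - κ_n) / (t (θ_n + t))`. -/
def pCoord (α μ : ℝ) (n : ℕ) (a b : ℝ → ℕ → ℂ) (t : ℝ) : ℂ :=
  thetaCoeff α μ n b t * ((n + α + μ / 2) * t - kappaCoeff μ n a b t)
    / (t * (thetaCoeff α μ n b t + t))

/-- Okamoto's Hamiltonian `H` for the fifth Painlevé equation. -/
def okamotoHamiltonian (v₁ v₂ v₃ v₄ : ℂ) (t : ℝ) (q p : ℂ) : ℂ :=
  (q * (q - 1) ^ 2 * p ^ 2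
    - ((v₂ - v₁) * (q - 1) ^ 2 - 2 * (v₁ + v₂) * q * (q - 1) + t * q) * p
    + (v₃ - v₁) * (v₄ - v₁) * (q - 1)) / t

/-- The Hamilton equations `q' = ∂H/∂p`, `p' = -∂H/∂q` hold at the time `t`. -/
def HamiltonEquationsAt (H : ℝ → ℂ → ℂ → ℂ) (q p : ℝ → ℂ) (t : ℝ) : Prop :=
  HasDerivAt q (deriv (fun y => H t (q t) y) (p t)) t ∧
  HasDerivAt p (-deriv (fun x => H t x (p t)) (q t)) t

/-- `y` is twice differentiable at `t` and satisfies the fifth Painlevé equation there. -/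
def PainleveVAt (α₁ α₂ α₃ α₄ : ℂ) (y : ℝ → ℂ) (t : ℝ) : Prop :=
  ∃ y' : ℝ → ℂ, (∀ᶠ s in 𝓝 t, HasDerivAt y (y' s) s) ∧
    HasDerivAt y'
      ((1 / (2 * y t) + 1 / (y t - 1)) * y' t ^ 2 - y' t / t
        + (y t - 1) ^ 2 / t ^ 2 * (α₁ * y t + α₂ / y t)
        + α₃ * y t / t + α₄ * y t * (y t + 1) / (y t - 1)) t

/-- The expansion
`f(t) = {c₁ t + c₂ t² + O(t³)} + {c t^(1+s) + O(t^(2+s))}` as `t → 0⁺`: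
the first brace is a function analytic at `0`, the second is the non-analytic component. -/
def HasSmallTimeExpansion (f : ℝ → ℂ) (s : ℝ) (c₁ c₂ c : ℂ) : Prop :=
  ∃ A : ℝ → ℂ, AnalyticAt ℝ A 0 ∧
    (fun t : ℝ => A t - (c₁ * t + c₂ * t ^ 2)) =O[𝓝 0] (fun t : ℝ => t ^ 3) ∧
    (fun t : ℝ => f t - A t - c * ((t ^ (1 + s) : ℝ) : ℂ))
      =O[𝓝[>] 0] (fun t : ℝ => t ^ (2 + s))

/-- The coefficient `L` of `t^(1+α+μ)` in `-θ_n`. -/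
def nonanalyticCoeff (ζ α μ : ℝ) (ω : ℂ) (n : ℕ) : ℂ :=
  (ω / (1 - ζ) - ((Real.sin (Real.pi * μ) / Real.sin (Real.pi * (α + μ)) : ℝ) : ℂ))
    * ((Real.Gamma (α + 1) * Real.Gamma (μ + 1) * Real.Gamma (α + μ + n + 1)
        / (n.factorial * Real.Gamma (α + μ + 1) ^ 3) : ℝ) : ℂ)

/-- The prescribed small `t` expansions of the pair `(θ_n, κ_n)`. -/
def SmallTimeExpansions (ζ α μ : ℝ) (ω : ℂ) (n : ℕ) (θ κ : ℝ → ℂ) : Prop :=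
  HasSmallTimeExpansion θ (α + μ)
    (-μ / (α + μ))
    (α * μ * (2 * n + 1 + α + μ) / (((α + μ) ^ 2 - 1) * (α + μ) ^ 2))
    (-nonanalyticCoeff ζ α μ ω n) ∧
  HasSmallTimeExpansion κ (α + μ)
    (μ * (2 * n + α + μ) / (2 * (α + μ)))
    (-(2 * n * α * μ * (n + α + μ)) / (((α + μ) ^ 2 - 1) * (α + μ) ^ 2))
    (n * nonanalyticCoeff ζ α μ ω n)

end

/-! Two linear relations for the moments `M_k` carry everything. Rescaling `x = t y` and
differentiating gives the flow `t M_k' = (1+α+μ+k) M_k - M_{k+1}`; integration by parts gives the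
Pearson recursion, i.e. the integral of the derivative of `x (x-t) x^k w` is zero. As long as the
norms of the monic orthogonal polynomials `π_n` do not vanish, the flow yields Toda-type equations
for `a_n²` and `b_n`. The Pearson relation paired with `π_n²` yields `κ_n + κ_{n+1} = -b_n θ_n`, and
differentiating this identity yields a companion formula for `b_n (κ_{n+1} - κ_n)`. Multiplied
together, these telescope in `n` to two bilinear relations between `κ_n`, `θ_n`, `θ_{n-1}` and
`a_n²` (`MomentFlowAt.quadratic_relations`). They eliminate `a_n²` and `θ_{n-1}` from the derivative
of `κ_n`, so `(θ_n, κ_n)` obeys a closed system; in the coordinates `(q, p)` it is Okamoto's, and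
the fifth Painlevé equation follows by a rational identity.

For small `t`, put `s = α + μ`. The integral over `x > t` solves Kummer's equation, and the
connection formula (`outer_decomposition`) writes `M_k` as an analytic `N_k` plus `t^(1+s+k)` times
a differentiable function, so only `M_0` has a term of exact order `t^(1+s)`. The `N_k` obey the
same two relations and at `t = 0` are, up to a factor, the moments of the Laguerre weight `x^s
e^(-x)`. Hence no norm vanishes near `0`, and each recurrence quantity is analytic plus `B t^(1+s) +
O(t^(2+s))`. The coefficient `B` is explicit for `b_0` and is propagated in `n` by comparing
`t^(1+s)` terms in the differential equations (`nonanalytic_relations`,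
`opDiag_hasNonanalyticTerm`); the Taylor coefficients of the analytic parts come from
`ReducedSystemAt.taylor`.

For uniqueness, the difference of two solutions, in the variables `θ/t` and `κ/t`, solves a linear
system with a regular singular point at `0` and leading exponents `±s`. The common expansion makes
the difference analytic up to `O(t^(1+s))`. As `s` is not an integer, no integer power can lead, so
the difference is `O(t^(1+s))`, beyond the exponent `s`, and a contraction makes it vanish near `0`.
Local uniqueness for differential equations extends the equality to `(0, T)`. -/

noncomputable section

/-! ### Orthogonal polynomials of a moment functional. -/

/-- The linear functional on polynomials with moments `M k`. -/
def momentFunctional (M : ℕ → ℂ) : ℂ[X] →ₗ[ℂ] ℂ :=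
  Polynomial.lsum fun k => M k • LinearMap.id

lemma momentFunctional_monomial (M : ℕ → ℂ) (k : ℕ) (c : ℂ) :
    momentFunctional M (monomial k c) = M k * c := by
  simp [momentFunctional]

lemma momentFunctional_C_mul (M : ℕ → ℂ) (c : ℂ) (f : ℂ[X]) :
    momentFunctional M (C c * f) = c * momentFunctional M f := by
  rw [← smul_eq_C_mul, map_smul, smul_eq_mul]

lemma momentFunctional_eq_sum (M : ℕ → ℂ) (f : ℂ[X]) {N : ℕ} (h : f.natDegree < N) :
    momentFunctional M f = ∑ k ∈ Finset.range N, f.coeff k * M k := by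
  conv_lhs => rw [f.as_sum_range' N h]
  simp [momentFunctional_monomial, mul_comm]

/-- The monic orthogonal polynomials of a moment functional, by the three term recurrence. -/
def monicOP (M : ℕ → ℂ) : ℕ → ℂ[X]
  | 0 => 1
  | 1 => X - C (momentFunctional M (X * 1 ^ 2) / momentFunctional M (1 ^ 2))
  | (n + 2) => (X - C (momentFunctional M (X * monicOP M (n + 1) ^ 2) /
        momentFunctional M (monicOP M (n + 1) ^ 2))) * monicOP M (n + 1)
      - C (momentFunctional M (monicOP M (n + 1) ^ 2) /
        momentFunctional M (monicOP M n ^ 2)) * monicOP M n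

/-- The squared norm of the `n`-th monic orthogonal polynomial. -/
def opNorm (M : ℕ → ℂ) (n : ℕ) : ℂ := momentFunctional M (monicOP M n ^ 2)

/-- The diagonal recurrence coefficient. -/
def opDiag (M : ℕ → ℂ) (n : ℕ) : ℂ := momentFunctional M (X * monicOP M n ^ 2) / opNorm M n

/-- The squared off-diagonal recurrence coefficient. -/
def opOff (M : ℕ → ℂ) : ℕ → ℂ
  | 0 => 0
  | (n + 1) => opNorm M (n + 1) / opNorm M n

/-- The sum of the first `n` diagonal recurrence coefficients. -/
def opSum (M : ℕ → ℂ) (n : ℕ) : ℂ := ∑ i ∈ Finset.range n, opDiag M i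

lemma opSum_succ (M : ℕ → ℂ) (n : ℕ) : opSum M (n + 1) = opSum M n + opDiag M n := by
  simp [opSum, Finset.sum_range_succ]

variable {M : ℕ → ℂ}

lemma monicOP_zero : monicOP M 0 = 1 := by rw [monicOP]

/-- At `n = 0` the truncated index `n - 1` is harmless because `opOff M 0 = 0`. The same convention
is used throughout. -/
lemma monicOP_succ (n : ℕ) :
    monicOP M (n + 1)
      = (X - C (opDiag M n)) * monicOP M n - C (opOff M n) * monicOP M (n - 1) := by
  cases n with
  | zero => simp [monicOP, opDiag, opNorm, opOff]
  | succ n => rw [monicOP]; rfl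

lemma X_mul_monicOP (n : ℕ) :
    X * monicOP M n
      = monicOP M (n + 1) + C (opDiag M n) * monicOP M n + C (opOff M n) * monicOP M (n - 1) := by
  rw [monicOP_succ]; ring

lemma monicOP_monic_natDegree (n : ℕ) : (monicOP M n).Monic ∧ (monicOP M n).natDegree = n := by
  induction n using Nat.strong_induction_on with
  | _ n ih =>
    cases n with
    | zero => simp [monicOP_zero]
    | succ n =>
      obtain ⟨h1, h2⟩ := ih n (Nat.lt_succ_self n)
      have hm : ((X - C (opDiag M n)) * monicOP M n).Monic := (monic_X_sub_C _).mul h1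
      have hd : ((X - C (opDiag M n)) * monicOP M n).natDegree = n + 1 := by
        rw [(monic_X_sub_C _).natDegree_mul h1, natDegree_X_sub_C, h2]; ring
      have hlt : (C (opOff M n) * monicOP M (n - 1)).degree
          < ((X - C (opDiag M n)) * monicOP M n).degree := by
        have : (C (opOff M n) * monicOP M (n - 1)).natDegree ≤ n := by
          refine (natDegree_C_mul_le _ _).trans ?_
          rw [(ih (n - 1) (by omega)).2]; omega
        rw [degree_eq_natDegree hm.ne_zero, hd]
        exact lt_of_le_of_lt degree_le_natDegree (by exact_mod_cast Nat.lt_succ_of_le this)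
      rw [monicOP_succ]
      exact ⟨hm.sub_of_left hlt, by
        rw [natDegree_eq_of_degree_eq (degree_sub_eq_left_of_degree_lt hlt), hd]⟩

lemma monicOP_monic (n : ℕ) : (monicOP M n).Monic := (monicOP_monic_natDegree n).1

lemma natDegree_monicOP (n : ℕ) : (monicOP M n).natDegree = n := (monicOP_monic_natDegree n).2

lemma coeff_monicOP_self (n : ℕ) : (monicOP M n).coeff n = 1 := by
  have := (monicOP_monic (M := M) n).coeff_natDegree
  rwa [natDegree_monicOP] at this

lemma coeff_monicOP_of_lt {n k : ℕ} (h : n < k) : (monicOP M n).coeff k = 0 :=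
  coeff_eq_zero_of_natDegree_lt (by rwa [natDegree_monicOP])

/-- Each step of the recurrence lowers the subleading coefficient by one diagonal coefficient.
Through this coefficient the sum of the `b_i` in `κ_n` enters the orthogonality computations. -/
lemma coeff_monicOP_succ (n : ℕ) : (monicOP M (n + 1)).coeff n = -opSum M (n + 1) := by
  induction n with
  | zero => simp [monicOP_succ, monicOP_zero, opSum, opOff]
  | succ n ih =>
    rw [monicOP_succ, opSum_succ, sub_mul, coeff_sub, coeff_sub, coeff_X_mul, coeff_C_mul,
      coeff_C_mul, ih, coeff_monicOP_self, coeff_monicOP_of_lt (by omega)]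
    ring

lemma natDegree_sub_monicOP {f : ℂ[X]} {n : ℕ} (hf : f.degree < ((n + 1 : ℕ) : WithBot ℕ)) :
    (f - C (f.coeff n) * monicOP M n).degree < n := by
  rw [degree_lt_iff_coeff_zero] at hf ⊢
  intro k hk
  rw [coeff_sub, coeff_C_mul]
  rcases hk.eq_or_lt with rfl | hk
  · rw [coeff_monicOP_self]; ring
  · rw [coeff_monicOP_of_lt hk, hf k hk]; ring

/-- Orthogonality to all polynomials of smaller degree. -/
lemma monicOP_orthogonal (n : ℕ) (hn : ∀ j < n, opNorm M j ≠ 0) (f : ℂ[X]) (hf : f.degree < n) :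
    momentFunctional M (monicOP M n * f) = 0 := by
  induction n using Nat.strong_induction_on generalizing f with
  | _ n ih =>
    cases n with
    | zero =>
      have : f = 0 := by
        rw [← degree_eq_bot]
        simpa [Nat.WithBot.lt_zero_iff] using hf
      simp [this]
    | succ n =>
      -- Test polynomials of degree below `n` come first, by moving the factor `X` of the recurrence
      -- onto `g`; the remaining direction `π_n` is treated in `e2`.
      have key : ∀ g : ℂ[X], g.degree < n → momentFunctional M (monicOP M (n + 1) * g) = 0 := by
        intro g hg
        cases n with
        | zero =>
          have : g = 0 := by
            rw [← degree_eq_bot]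
            simpa [Nat.WithBot.lt_zero_iff] using hg
          simp [this]
        | succ n =>
          have hX : (X * g).degree < ((n + 1 + 1 : ℕ) : WithBot ℕ) := by
            rw [degree_lt_iff_coeff_zero] at hg ⊢
            intro k hk
            obtain ⟨k, rfl⟩ : ∃ l, k = l + 1 := ⟨k - 1, by omega⟩
            rw [coeff_X_mul]; exact hg k (by omega)
          -- The top coefficients of `X * g` and `g` are split off. Both equal `g.coeff n`, and the
          -- choice of `opOff` as a quotient of norms makes their contributions cancel.
          have e1 : monicOP M (n + 1 + 1) * g
              = monicOP M (n + 1) * (X * g - C ((X * g).coeff (n + 1)) * monicOP M (n + 1))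
                + C ((X * g).coeff (n + 1)) * (monicOP M (n + 1)) ^ 2
                - C (opDiag M (n + 1)) * (monicOP M (n + 1) * g)
                - C (opOff M (n + 1)) * (monicOP M n * (g - C (g.coeff n) * monicOP M n))
                - C (opOff M (n + 1)) * (C (g.coeff n) * monicOP M n ^ 2) := by
            rw [monicOP_succ (n + 1), Nat.add_sub_cancel]; ring
          rw [e1]
          simp only [map_sub, map_add, momentFunctional_C_mul]
          rw [ih (n + 1) (by omega) (fun j hj => hn j (by omega)) _ (natDegree_sub_monicOP hX),
            ih (n + 1) (by omega) (fun j hj => hn j (by omega)) _ hg,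
            ih n (by omega) (fun j hj => hn j (by omega)) _ (natDegree_sub_monicOP hg), coeff_X_mul]
          have h0 := hn n (by omega)
          change 0 + g.coeff n * opNorm M (n + 1) - _ - _
            - (opNorm M (n + 1) / opNorm M n) * (g.coeff n * opNorm M n) = 0
          field_simp; ring
      -- This pairing vanishes by the choice of `opDiag`.
      have e2 : momentFunctional M (monicOP M (n + 1) * monicOP M n) = 0 := by
        have e3 : monicOP M (n + 1) * monicOP M n = X * monicOP M n ^ 2
            - C (opDiag M n) * monicOP M n ^ 2
            - C (opOff M n) * (monicOP M n * monicOP M (n - 1)) := by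
          rw [monicOP_succ]; ring
        rw [e3]
        simp only [map_sub, momentFunctional_C_mul]
        have h0 := hn n (by omega)
        have e4 : opOff M n * momentFunctional M (monicOP M n * monicOP M (n - 1)) = 0 := by
          cases n with
          | zero => simp [opOff]
          | succ n =>
            rw [ih (n + 1) (by omega) (fun j hj => hn j (by omega)) _ ?_, mul_zero]
            rw [degree_eq_natDegree (monicOP_monic _).ne_zero, natDegree_monicOP]
            exact_mod_cast Nat.lt_succ_self n
        rw [e4, opDiag]
        change _ - _ / _ * opNorm M n - 0 = 0
        field_simp; ring
      have e5 : monicOP M (n + 1) * f = monicOP M (n + 1) * (f - C (f.coeff n) * monicOP M n)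
          + C (f.coeff n) * (monicOP M (n + 1) * monicOP M n) := by ring
      rw [e5, map_add, momentFunctional_C_mul, e2, key _ (natDegree_sub_monicOP hf)]
      simp

lemma monicOP_mul_of_degree_lt {n : ℕ} (hn : ∀ j < n, opNorm M j ≠ 0) {f : ℂ[X]}
    (hf : f.degree < ((n + 1 : ℕ) : WithBot ℕ)) :
    momentFunctional M (monicOP M n * f) = f.coeff n * opNorm M n := by
  have e : monicOP M n * f = monicOP M n * (f - C (f.coeff n) * monicOP M n)
      + C (f.coeff n) * monicOP M n ^ 2 := by ring
  rw [e, map_add, momentFunctional_C_mul, monicOP_orthogonal n hn _ (natDegree_sub_monicOP hf),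
    zero_add, opNorm]

lemma momentFunctional_X_mul_sq {n : ℕ} (hn : opNorm M n ≠ 0) :
    momentFunctional M (X * monicOP M n ^ 2) = opDiag M n * opNorm M n := by
  rw [opDiag]; field_simp

lemma degree_monicOP_lt {n k : ℕ} (h : n < k) : (monicOP M n).degree < k := by
  rw [degree_eq_natDegree (monicOP_monic _).ne_zero, natDegree_monicOP]
  exact_mod_cast h

lemma momentFunctional_succ_mul (n : ℕ) (hn : ∀ j ≤ n, opNorm M j ≠ 0) :
    momentFunctional M (monicOP M (n + 1) * monicOP M n) = 0 :=
  monicOP_orthogonal _ (fun j hj => hn j (by omega)) _ (degree_monicOP_lt (by omega))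

/-- No nonvanishing is needed: if the previous norm is zero, the quotient `opOff` is zero by the
convention on division. -/
lemma opOff_mul_self (n : ℕ) : opOff M n * opOff M n * opNorm M (n - 1) = opOff M n * opNorm M n := by
  cases n with
  | zero => simp [opOff]
  | succ n =>
    by_cases h : opNorm M n = 0
    · simp [opOff, h]
    · simp only [opOff, Nat.add_sub_cancel]; field_simp

lemma opOff_succ_mul (n : ℕ) (hn : opNorm M n ≠ 0) :
    opOff M (n + 1) * opNorm M n = opNorm M (n + 1) := by
  simp only [opOff]; field_simp

lemma opOff_mul_cross (n : ℕ) (hn : ∀ j < n, opNorm M j ≠ 0) :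
    opOff M n * momentFunctional M (monicOP M n * monicOP M (n - 1)) = 0 := by
  cases n with
  | zero => simp [opOff]
  | succ n => rw [Nat.add_sub_cancel, momentFunctional_succ_mul n (fun j hj => hn j (by omega)),
      mul_zero]

/-- Square the three term recurrence: only the three diagonal terms survive, the cross terms vanish
by orthogonality. -/
lemma momentFunctional_X_sq_mul_sq {n : ℕ} (hn : ∀ j ≤ n, opNorm M j ≠ 0) :
    momentFunctional M (X ^ 2 * monicOP M n ^ 2)
      = (opOff M (n + 1) + opDiag M n ^ 2 + opOff M n) * opNorm M n := by
  have e : X ^ 2 * monicOP M n ^ 2 = monicOP M (n + 1) ^ 2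
      + C (opDiag M n) * (C (opDiag M n) * monicOP M n ^ 2)
      + C (opOff M n * opOff M n) * monicOP M (n - 1) ^ 2
      + C (2 * opDiag M n) * (monicOP M (n + 1) * monicOP M n)
      + C (2 * opDiag M n) * (C (opOff M n) * (monicOP M n * monicOP M (n - 1)))
      + C 2 * (C (opOff M n) * (monicOP M (n + 1) * monicOP M (n - 1))) := by
    have := X_mul_monicOP (M := M) n
    calc X ^ 2 * monicOP M n ^ 2 = (X * monicOP M n) ^ 2 := by ring
      _ = _ := by rw [this]; simp only [C_mul, C_ofNat]; ring
  have e2 : momentFunctional M (monicOP M (n + 1) * monicOP M (n - 1)) = 0 :=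
    monicOP_orthogonal _ (fun j hj => hn j (by omega)) _ (degree_monicOP_lt (by omega))
  rw [e]
  simp only [map_add, momentFunctional_C_mul]
  rw [e2, momentFunctional_succ_mul n hn, opOff_mul_cross n (fun j hj => hn j (by omega))]
  change opNorm M (n + 1) + _ * (_ * opNorm M n) + _ * opNorm M (n - 1) + _ + _ + _ = _
  rw [opOff_mul_self, ← opOff_succ_mul n (hn n le_rfl)]
  ring

/-! ### The Euler operator and the Laguerre-Freud relation. -/

/-- The remainder of `x π_n'` after subtraction of its leading part `n π_n`. -/
def eulerRest (M : ℕ → ℂ) (n : ℕ) : ℂ[X] :=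
  X * derivative (monicOP M n) - C (n : ℂ) * monicOP M n

lemma coeff_X_mul_derivative (f : ℂ[X]) (k : ℕ) : (X * derivative f).coeff k = k * f.coeff k := by
  cases k with
  | zero => simp
  | succ k => rw [coeff_X_mul, coeff_derivative]; push_cast; ring

lemma coeff_eulerRest (n k : ℕ) :
    (eulerRest M n).coeff k = ((k : ℂ) - n) * (monicOP M n).coeff k := by
  rw [eulerRest, coeff_sub, coeff_X_mul_derivative, coeff_C_mul]; ring

lemma degree_eulerRest (n : ℕ) : (eulerRest M n).degree < n := by
  rw [degree_lt_iff_coeff_zero]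
  intro k hk
  rw [coeff_eulerRest]
  rcases hk.eq_or_lt with rfl | hk
  · simp
  · rw [coeff_monicOP_of_lt hk, mul_zero]

lemma degree_X_mul_eulerRest (n : ℕ) : (X * eulerRest M n).degree < ((n + 1 : ℕ) : WithBot ℕ) := by
  have h := degree_eulerRest (M := M) n
  rw [degree_lt_iff_coeff_zero] at h ⊢
  intro k hk
  obtain ⟨k, rfl⟩ : ∃ l, k = l + 1 := ⟨k - 1, by omega⟩
  rw [coeff_X_mul]; exact h k (by omega)

lemma coeff_X_mul_eulerRest (n : ℕ) : (X * eulerRest M n).coeff n = opSum M n := by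
  cases n with
  | zero => simp [opSum]
  | succ n => rw [coeff_X_mul, coeff_eulerRest, coeff_monicOP_succ]; push_cast; ring

/-- The functional `f ↦ L((σ - x) f + x f')`. -/
def scaledFunctional (M : ℕ → ℂ) (σ : ℂ) (f : ℂ[X]) : ℂ :=
  momentFunctional M ((C σ - X) * f + X * derivative f)

/-- In `x π_n' = n π_n + eulerRest` the remainder has lower degree and drops out. Along the moment
flow this functional is `t d/dt` of the moment functional, and for a Laguerre weight it is zero, so
this evaluation and the next serve both situations. -/
lemma scaledFunctional_sq (σ : ℂ) (n : ℕ) (hn : ∀ j ≤ n, opNorm M j ≠ 0) :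
    scaledFunctional M σ (monicOP M n ^ 2) = (σ + 2 * n - opDiag M n) * opNorm M n := by
  have e : (C σ - X) * monicOP M n ^ 2 + X * derivative (monicOP M n ^ 2)
      = C σ * monicOP M n ^ 2 - X * monicOP M n ^ 2
        + C (2 * n : ℂ) * monicOP M n ^ 2 + C 2 * (monicOP M n * eulerRest M n) := by
    rw [sq (monicOP M n), derivative_mul, eulerRest]; simp only [C_mul, C_ofNat]; simp; ring
  rw [scaledFunctional, e]
  simp only [LinearMap.map_add, LinearMap.map_sub, momentFunctional_C_mul]
  rw [monicOP_orthogonal n (fun j hj => hn j hj.le) _ (degree_eulerRest n),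
    momentFunctional_X_mul_sq (hn n le_rfl), opNorm]
  ring

/-- The remainder of `π_{n+1}` paired with `π_n` contributes minus the subleading coefficient, hence
the sum of the `b_i`; the factor `x` contributes the norm of `π_{n+1}`. -/
lemma scaledFunctional_succ_mul (σ : ℂ) (n : ℕ) (hn : ∀ j ≤ n, opNorm M j ≠ 0) :
    scaledFunctional M σ (monicOP M (n + 1) * monicOP M n)
      = (opSum M (n + 1) - opOff M (n + 1)) * opNorm M n := by
  have e : (C σ - X) * (monicOP M (n + 1) * monicOP M n)
        + X * derivative (monicOP M (n + 1) * monicOP M n)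
      = C (σ + (2 * n + 1)) * (monicOP M (n + 1) * monicOP M n)
        - monicOP M (n + 1) * (X * monicOP M n)
        + monicOP M (n + 1) * eulerRest M n + monicOP M n * eulerRest M (n + 1) := by
    rw [derivative_mul, eulerRest, eulerRest]
    simp only [C_add, C_mul, C_ofNat]; push_cast; simp; ring
  have hn' : ∀ j < n + 1, opNorm M j ≠ 0 := fun j hj => hn j (by omega)
  have hX : (X * monicOP M n).coeff (n + 1) = 1 := by rw [coeff_X_mul, coeff_monicOP_self]
  have hXd : (X * monicOP M n).degree < ((n + 1 + 1 : ℕ) : WithBot ℕ) := by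
    rw [degree_lt_iff_coeff_zero]
    intro k hk
    obtain ⟨k, rfl⟩ : ∃ l, k = l + 1 := ⟨k - 1, by omega⟩
    rw [coeff_X_mul]; exact coeff_monicOP_of_lt (by omega)
  rw [scaledFunctional, e]
  simp only [LinearMap.map_add, LinearMap.map_sub, momentFunctional_C_mul]
  rw [momentFunctional_succ_mul n hn, monicOP_mul_of_degree_lt hn' hXd, hX,
    monicOP_orthogonal (n + 1) hn' _ ((degree_eulerRest n).trans (by exact_mod_cast n.lt_succ_self)),
    monicOP_mul_of_degree_lt (fun j hj => hn j hj.le) (degree_eulerRest (n + 1)),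
    coeff_eulerRest, coeff_monicOP_succ, ← opOff_succ_mul n (hn n le_rfl)]
  push_cast; ring

/-- The moments satisfy the Pearson relation of the weight `(x - t) ^ α x ^ μ e ^ (-x)`. -/
def PearsonRelation (α μ t : ℂ) (M : ℕ → ℂ) : Prop :=
  ∀ k : ℕ, M (k + 2) = (k + 2 + α + μ + t) * M (k + 1) - (k + 1 + μ) * t * M k

/-- For a genuine weight `w` the argument of the functional, times `w`, is the derivative of `x (x -
t) f w`, and the factor `x (x - t)` removes the boundary terms at `0` and `t`. Here only the
recursion for the moments is used, monomial by monomial. -/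
lemma PearsonRelation.functional_eq_zero {α μ t : ℂ} (h : PearsonRelation α μ t M) (f : ℂ[X]) :
    momentFunctional M (X * (X - C t) * derivative f
      + (C (2 + α + μ + t) * X - C ((1 + μ) * t) - X ^ 2) * f) = 0 := by
  induction f using Polynomial.induction_on' with
  | add p q hp hq =>
    have := congrArg₂ (· + ·) hp hq
    simp only [← LinearMap.map_add, add_zero] at this
    rw [← this, derivative_add]; congr 1; ring
  | monomial k c =>
    have e : X * (X - C t) * derivative (monomial k c)
        + (C (2 + α + μ + t) * X - C ((1 + μ) * t) - X ^ 2) * monomial k c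
        = monomial (k + 1) (c * (k + 2 + α + μ + t)) - monomial k (c * ((k + 1 + μ) * t))
          - monomial (k + 2) c := by
      simp only [← C_mul_X_pow_eq_monomial, derivative_C_mul_X_pow]
      cases k with
      | zero => simp; ring
      | succ k => simp only [Nat.add_sub_cancel, C_add, C_mul]; push_cast; simp; ring
    rw [e]
    simp only [map_sub, momentFunctional_monomial]
    rw [h k]; ring

/-- The Laguerre-Freud relation obtained from `f = π_n ^ 2`. -/
lemma PearsonRelation.laguerreFreud {α μ t : ℂ} (h : PearsonRelation α μ t M) (n : ℕ)
    (hn : ∀ j ≤ n, opNorm M j ≠ 0) :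
    2 * (opSum M n + n * opDiag M n - n * t) + (2 + α + μ + t) * opDiag M n - (1 + μ) * t
      - opOff M (n + 1) - opDiag M n ^ 2 - opOff M n = 0 := by
  have h0 := h.functional_eq_zero (monicOP M n ^ 2)
  have e : X * (X - C t) * derivative (monicOP M n ^ 2)
      + (C (2 + α + μ + t) * X - C ((1 + μ) * t) - X ^ 2) * monicOP M n ^ 2
      = C (2 * n + (2 + α + μ + t)) * (X * monicOP M n ^ 2)
        - C (2 * n * t + (1 + μ) * t) * monicOP M n ^ 2
        + C 2 * (monicOP M n * (X * eulerRest M n)) - C (2 * t) * (monicOP M n * eulerRest M n)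
        - X ^ 2 * monicOP M n ^ 2 := by
    rw [sq (monicOP M n), derivative_mul, eulerRest]
    simp only [C_mul, C_add, C_ofNat]; simp; ring
  rw [e] at h0
  simp only [LinearMap.map_add, LinearMap.map_sub, momentFunctional_C_mul] at h0
  rw [monicOP_orthogonal n (fun j hj => hn j hj.le) _ (degree_eulerRest n),
    momentFunctional_X_mul_sq (hn n le_rfl), momentFunctional_X_sq_mul_sq hn,
    monicOP_mul_of_degree_lt (fun j hj => hn j hj.le) (degree_X_mul_eulerRest n),
    coeff_X_mul_eulerRest] at h0
  change _ - _ * opNorm M n + _ - _ - _ = 0 at h0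
  refine mul_right_cancel₀ (hn n le_rfl) ?_
  rw [zero_mul, ← h0]; ring


/-! ### Comparison of orthonormal and monic orthogonal polynomials. -/

variable {M : ℕ → ℂ}

/-- Pairing a nonzero `g` with the monic orthogonal polynomial of the same degree would detect its
leading coefficient. -/
lemma eq_zero_of_orthogonal {n : ℕ} {g : ℂ[X]} (hg : g.degree < n)
    (hn : ∀ j < n, opNorm M j ≠ 0) (h : ∀ j < n, momentFunctional M (monicOP M j * g) = 0) :
    g = 0 := by
  by_contra h0
  have hd : g.natDegree < n := by
    rw [degree_eq_natDegree h0] at hg; exact_mod_cast hg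
  have h1 := h _ hd
  rw [monicOP_mul_of_degree_lt (fun j hj => hn j (hj.trans hd))
    (lt_of_le_of_lt degree_le_natDegree (by exact_mod_cast Nat.lt_succ_self _))] at h1
  rcases mul_eq_zero.1 h1 with h2 | h2
  · exact h0 (leadingCoeff_eq_zero.1 h2)
  · exact hn _ hd h2

/-- Orthonormal polynomials are multiples of the monic orthogonal polynomials. -/
lemma orthonormal_eq_monicOP {N : ℕ} {p : ℕ → ℂ[X]}
    (hdeg : ∀ i ≤ N, (p i).degree = (i : WithBot ℕ))
    (hort : ∀ i ≤ N, ∀ j ≤ N, momentFunctional M (p i * p j) = if i = j then 1 else 0)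
    (i : ℕ) (hi : i ≤ N) :
    ((p i).coeff i) ^ 2 * opNorm M i = 1 ∧ p i = C ((p i).coeff i) * monicOP M i := by
  induction i using Nat.strong_induction_on with
  | _ i ih =>
    -- The normalisation of `p j` excludes a zero norm; the induction must deliver this, since
    -- `monicOP_orthogonal` assumes it.
    have hne : ∀ j < i, opNorm M j ≠ 0 := fun j hj h0 => by
      have := (ih j hj (by omega)).1
      rw [h0, mul_zero] at this
      exact zero_ne_one this
    have hlt : (p i).degree < ((i + 1 : ℕ) : WithBot ℕ) := by
      rw [hdeg i hi]; exact_mod_cast Nat.lt_succ_self i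
    have hg := natDegree_sub_monicOP (M := M) hlt
    have h0 : p i - C ((p i).coeff i) * monicOP M i = 0 := by
      refine eq_zero_of_orthogonal hg hne fun j hj => ?_
      have hj' := ih j hj (by omega)
      have hc : (p j).coeff j ≠ 0 := by
        intro h; rw [h] at hj'; simp at hj'
      have e : C ((p j).coeff j) * (monicOP M j * (p i - C ((p i).coeff i) * monicOP M i))
          = p i * p j - C ((p j).coeff j * (p i).coeff i) * (monicOP M i * monicOP M j) := by
        rw [C_mul]; linear_combination (-(p i)) * hj'.2
      have := congrArg (momentFunctional M) e
      rw [momentFunctional_C_mul, map_sub, hort i hi j (by omega), momentFunctional_C_mul,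
        monicOP_orthogonal i hne _ (degree_monicOP_lt hj), if_neg (by omega)] at this
      simpa [hc] using this
    have h1 := sub_eq_zero.1 h0
    refine ⟨?_, h1⟩
    have h2 := hort i hi i hi
    have e : p i * p i = C ((p i).coeff i ^ 2) * monicOP M i ^ 2 := by
      nth_rewrite 1 2 [h1]; rw [C_pow]; ring
    rwa [e, momentFunctional_C_mul, if_pos rfl] at h2

lemma opNorm_ne_zero_of_orthonormal {N : ℕ} {p : ℕ → ℂ[X]}
    (hdeg : ∀ i ≤ N, (p i).degree = (i : WithBot ℕ))
    (hort : ∀ i ≤ N, ∀ j ≤ N, momentFunctional M (p i * p j) = if i = j then 1 else 0)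
    (i : ℕ) (hi : i ≤ N) : opNorm M i ≠ 0 := fun h => by
  have := (orthonormal_eq_monicOP hdeg hort i hi).1
  rw [h, mul_zero] at this
  exact zero_ne_one this

/-- Pairing the recurrence with `p m` isolates the diagonal coefficient. -/
lemma recurrence_diag_eq {N : ℕ} {p : ℕ → ℂ[X]} {a b : ℕ → ℂ}
    (hdeg : ∀ i ≤ N, (p i).degree = (i : WithBot ℕ))
    (hort : ∀ i ≤ N, ∀ j ≤ N, momentFunctional M (p i * p j) = if i = j then 1 else 0)
    (ha : a 0 = 0)
    (hrec : ∀ m < N, C (a (m + 1)) * p (m + 1) = (X - C (b m)) * p m - C (a m) * p (m - 1))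
    (m : ℕ) (hm : m < N) : b m = opDiag M m := by
  obtain ⟨h1, h2⟩ := orthonormal_eq_monicOP hdeg hort m hm.le
  have e : C (a (m + 1)) * (p (m + 1) * p m)
      = C ((p m).coeff m ^ 2) * (X * monicOP M m ^ 2) - C (b m) * (p m * p m)
        - C (a m) * (p (m - 1) * p m) := by
    have e1 : C ((p m).coeff m ^ 2) * (X * monicOP M m ^ 2) = X * (p m * p m) := by
      nth_rewrite 2 3 [h2]; rw [C_pow]; ring
    rw [e1, ← mul_assoc, hrec m hm]; ring
  have h3 := congrArg (momentFunctional M) e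
  have h4 : a m * momentFunctional M (p (m - 1) * p m) = 0 := by
    cases m with
    | zero => simp [ha]
    | succ m => rw [hort _ (by omega) _ (by omega), if_neg (by omega), mul_zero]
  have hne := opNorm_ne_zero_of_orthonormal hdeg hort m hm.le
  rw [map_sub, map_sub, momentFunctional_C_mul, momentFunctional_C_mul, momentFunctional_C_mul,
    momentFunctional_C_mul, h4, hort _ (by omega) _ (by omega), hort _ (by omega) _ (by omega),
    if_neg (by omega), if_pos rfl, momentFunctional_X_mul_sq hne] at h3
  linear_combination h3 + opDiag M m * h1

/-- Leading coefficients in the recurrence give `a (m+1)` as a quotient of leading coefficients of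
`p m` and `p (m+1)`. These are fixed by the norms only up to sign, so only the square is a function
of the moments. -/
lemma recurrence_off_sq_eq {N : ℕ} {p : ℕ → ℂ[X]} {a b : ℕ → ℂ}
    (hdeg : ∀ i ≤ N, (p i).degree = (i : WithBot ℕ))
    (hort : ∀ i ≤ N, ∀ j ≤ N, momentFunctional M (p i * p j) = if i = j then 1 else 0)
    (ha : a 0 = 0)
    (hrec : ∀ m < N, C (a (m + 1)) * p (m + 1) = (X - C (b m)) * p m - C (a m) * p (m - 1))
    (m : ℕ) (hm : m ≤ N) : a m ^ 2 = opOff M m := by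
  cases m with
  | zero => simp [ha, opOff]
  | succ m =>
    obtain ⟨h1, h2⟩ := orthonormal_eq_monicOP hdeg hort m (by omega)
    obtain ⟨k1, k2⟩ := orthonormal_eq_monicOP hdeg hort (m + 1) hm
    have hc : a (m + 1) * (p (m + 1)).coeff (m + 1) = (p m).coeff m := by
      have h3 := congrArg (fun f => coeff f (m + 1)) (hrec m (by omega))
      have h4 : (p m).coeff (m + 1) = 0 := coeff_eq_zero_of_degree_lt (by
        rw [hdeg m (by omega)]; exact_mod_cast Nat.lt_succ_self m)
      have h5 : a m * (p (m - 1)).coeff (m + 1) = 0 := by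
        rw [coeff_eq_zero_of_degree_lt (p := p (m - 1)), mul_zero]
        rw [hdeg (m - 1) (by omega)]; exact_mod_cast (by omega : m - 1 < m + 1)
      simpa [sub_mul, coeff_X_mul, h4, h5] using h3
    have hne := opNorm_ne_zero_of_orthonormal hdeg hort m (by omega)
    rw [opOff, eq_div_iff hne]
    rw [← hc] at h1
    linear_combination opNorm M (m + 1) * h1 - a (m + 1) ^ 2 * opNorm M m * k1

/-! ### Regularity of the recurrence quantities as functions of the moments. -/

/-- A class of complex functions that contains the constants and is closed under the ring
operations. -/
structure IsFunctionRing {T : Type*} (Q : (T → ℂ) → Prop) : Prop where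
  add : ∀ f g, Q f → Q g → Q (fun t => f t + g t)
  mul : ∀ f g, Q f → Q g → Q (fun t => f t * g t)
  const : ∀ c : ℂ, Q (fun _ => c)

namespace IsFunctionRing

variable {T : Type*} {Q : (T → ℂ) → Prop} (hQ : IsFunctionRing Q)
include hQ

lemma sub {f g : T → ℂ} (hf : Q f) (hg : Q g) : Q (fun t => f t - g t) := by
  have := hQ.add _ _ hf (hQ.mul _ _ (hQ.const (-1)) hg)
  convert this using 2; ring

lemma sum {ι : Type*} (S : Finset ι) {f : ι → T → ℂ} (hf : ∀ i ∈ S, Q (f i)) :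
    Q (fun t => ∑ i ∈ S, f i t) := by
  classical
  induction S using Finset.induction_on with
  | empty => simpa using hQ.const 0
  | insert i S hi ih =>
    have := hQ.add _ _ (hf i (by simp)) (ih fun j hj => hf j (by simp [hj]))
    convert this using 2
    rw [Finset.sum_insert hi]

lemma coeff_mul {F G : T → ℂ[X]} (hF : ∀ k, Q (fun t => (F t).coeff k))
    (hG : ∀ k, Q (fun t => (G t).coeff k)) (k : ℕ) : Q (fun t => (F t * G t).coeff k) := by
  simp only [Polynomial.coeff_mul]
  exact hQ.sum _ fun i _ => hQ.mul _ _ (hF _) (hG _)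

lemma functional {M : T → ℕ → ℂ} (hM : ∀ k, Q (fun t => M t k)) {F : T → ℂ[X]} (N : ℕ)
    (hN : ∀ t, (F t).natDegree < N) (hF : ∀ k, Q (fun t => (F t).coeff k)) :
    Q (fun t => momentFunctional (M t) (F t)) := by
  simp only [fun t => momentFunctional_eq_sum (M t) (F t) (hN t)]
  exact hQ.sum _ fun i _ => hQ.mul _ _ (hF _) (hM _)

lemma opNorm_mem {M : T → ℕ → ℂ} (hM : ∀ k, Q (fun t => M t k)) {n : ℕ}
    (hF : ∀ k, Q (fun t => (monicOP (M t) n).coeff k)) : Q (fun t => opNorm (M t) n) := by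
  refine hQ.functional hM (n + n + 1) (fun t => ?_) ?_
  · rw [sq, (monicOP_monic n).natDegree_mul (monicOP_monic n), natDegree_monicOP]; omega
  · simp only [sq]; exact hQ.coeff_mul hF hF

lemma opDiag_mem {M : T → ℕ → ℂ} (hM : ∀ k, Q (fun t => M t k)) {n : ℕ}
    (hF : ∀ k, Q (fun t => (monicOP (M t) n).coeff k)) (hi : Q (fun t => (opNorm (M t) n)⁻¹)) :
    Q (fun t => opDiag (M t) n) := by
  simp only [opDiag, div_eq_mul_inv]
  refine hQ.mul _ _ (hQ.functional hM (n + n + 2) (fun t => ?_) ?_) hi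
  · have h2 : (monicOP (M t) n ^ 2).Monic := (monicOP_monic n).pow 2
    rw [monic_X.natDegree_mul h2, sq, (monicOP_monic n).natDegree_mul (monicOP_monic n),
      natDegree_monicOP, natDegree_X]; omega
  · intro k
    simp only [sq]
    refine hQ.coeff_mul (fun k => hQ.const _) (hQ.coeff_mul hF hF) k

/-- All coefficients are polynomials in the moments and the inverse norms. Thus one induction covers
differentiability, analyticity and the expansions at `0`; only inversion of the norms has to be
supplied in each case. -/
lemma monicOP_mem {M : T → ℕ → ℂ} (hM : ∀ k, Q (fun t => M t k)) (n : ℕ)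
    (hinv : ∀ j < n, Q (fun t => opNorm (M t) j) → Q (fun t => (opNorm (M t) j)⁻¹)) (k : ℕ) :
    Q (fun t => (monicOP (M t) n).coeff k) := by
  induction n using Nat.strong_induction_on generalizing k with
  | _ n ih =>
    cases n with
    | zero => simp only [monicOP_zero]; exact hQ.const _
    | succ n =>
      have ih' : ∀ m ≤ n, ∀ k, Q (fun t => (monicOP (M t) m).coeff k) := fun m hm k =>
        ih m (by omega) (fun j hj => hinv j (by omega)) k
      have hi : ∀ m ≤ n, Q (fun t => (opNorm (M t) m)⁻¹) := fun m hm =>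
        hinv m (by omega) (hQ.opNorm_mem hM (ih' m hm))
      simp only [monicOP_succ, coeff_sub, sub_mul, coeff_C_mul]
      refine hQ.sub (hQ.sub ?_ (hQ.mul _ _ (hQ.opDiag_mem hM (ih' n le_rfl) (hi n le_rfl)) (ih' n le_rfl k)))
        (hQ.mul _ _ ?_ (ih' _ (by omega) k))
      · exact hQ.coeff_mul (fun k => hQ.const _) (ih' n le_rfl) k
      · cases n with
        | zero => simp only [opOff]; exact hQ.const 0
        | succ n =>
          simp only [opOff, div_eq_mul_inv]
          exact hQ.mul _ _ (hQ.opNorm_mem hM (ih' _ le_rfl)) (hi n (by omega))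

end IsFunctionRing

/-- The class facts for all recurrence quantities up to level `n`. -/
lemma IsFunctionRing.recurrence_mem {T : Type*} {Q : (T → ℂ) → Prop} (hQ : IsFunctionRing Q)
    {M : T → ℕ → ℂ} (hM : ∀ k, Q (fun t => M t k)) (n : ℕ)
    (hinv : ∀ j ≤ n, Q (fun t => opNorm (M t) j) → Q (fun t => (opNorm (M t) j)⁻¹)) :
    Q (fun t => opDiag (M t) n) ∧ Q (fun t => opOff (M t) n) ∧ Q (fun t => opSum (M t) n) ∧
      Q (fun t => opNorm (M t) n) := by
  have hc : ∀ m ≤ n, ∀ k, Q (fun t => (monicOP (M t) m).coeff k) := fun m hm k =>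
    hQ.monicOP_mem hM m (fun j hj => hinv j (by omega)) k
  have hi : ∀ m ≤ n, Q (fun t => (opNorm (M t) m)⁻¹) := fun m hm =>
    hinv m hm (hQ.opNorm_mem hM (hc m hm))
  refine ⟨hQ.opDiag_mem hM (hc n le_rfl) (hi n le_rfl), ?_, ?_, hQ.opNorm_mem hM (hc n le_rfl)⟩
  · cases n with
    | zero => simp only [opOff]; exact hQ.const 0
    | succ n =>
      simp only [opOff, div_eq_mul_inv]
      exact hQ.mul _ _ (hQ.opNorm_mem hM (hc _ le_rfl)) (hi n (by omega))
  · exact hQ.sum _ fun i hi' => hQ.opDiag_mem hM (hc i (Finset.mem_range.1 hi').le)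
      (hi i (Finset.mem_range.1 hi').le)


/-! ### The flow in `t`: Toda-type equations. -/

/-- The moments satisfy `t M_k' = (σ + k) M_k - M_{k+1}` at the time `t`. -/
def MomentFlowAt (σ : ℂ) (M : ℝ → ℕ → ℂ) (t : ℝ) : Prop :=
  ∀ k : ℕ, HasDerivAt (fun x => M x k) (((σ + k) * M t k - M t (k + 1)) / t) t

/-- On the right stand `t` times the derivatives of the moments along the flow; this is what makes
`scaledFunctional` the derivative of the functional on a fixed polynomial. -/
lemma scaledFunctional_eq (M : ℕ → ℂ) (σ : ℂ) (f : ℂ[X]) :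
    scaledFunctional M σ f = momentFunctional (fun k => (σ + k) * M k - M (k + 1)) f := by
  induction f using Polynomial.induction_on' with
  | add p q hp hq =>
    rw [map_add, ← hp, ← hq]
    simp only [scaledFunctional]
    rw [← LinearMap.map_add, derivative_add]; congr 1; ring
  | monomial k c =>
    have e : (C σ - X) * monomial k c + X * derivative (monomial k c)
        = monomial k ((σ + k) * c) - monomial (k + 1) c := by
      simp only [← C_mul_X_pow_eq_monomial, derivative_C_mul_X_pow]
      cases k with
      | zero => simp; ring
      | succ k => simp only [Nat.add_sub_cancel, C_add, C_mul]; push_cast; simp; ring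
    rw [scaledFunctional, e]
    simp only [map_sub, momentFunctional_monomial]
    ring

lemma MomentFlowAt.hasDerivAt_functional {σ : ℂ} {M : ℝ → ℕ → ℂ} {t : ℝ} (hM : MomentFlowAt σ M t)
    {F : ℝ → ℂ[X]} {F' : ℂ[X]} (N : ℕ) (hN : ∀ x, (F x).natDegree < N)
    (hF : ∀ k, HasDerivAt (fun x => (F x).coeff k) (F'.coeff k) t) :
    HasDerivAt (fun x => momentFunctional (M x) (F x))
      (scaledFunctional (M t) σ (F t) / t + momentFunctional (M t) F') t := by
  -- Coefficients of `F x` beyond the bound vanish identically, hence so do their derivatives.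
  have hN' : F'.natDegree < N := by
    by_contra h
    have h1 : (fun x => (F x).coeff F'.natDegree) = fun _ => 0 := by
      ext x; exact coeff_eq_zero_of_natDegree_lt ((hN x).trans_le (not_lt.1 h))
    have h2 := hF F'.natDegree
    rw [h1] at h2
    have h3 := (hasDerivAt_const t (0 : ℂ)).unique h2
    rw [coeff_natDegree, eq_comm, leadingCoeff_eq_zero] at h3
    have := hN t
    simp [h3] at h; omega
  simp only [fun x => momentFunctional_eq_sum (M x) (F x) (hN x), scaledFunctional_eq,
    momentFunctional_eq_sum _ _ (hN t), momentFunctional_eq_sum _ _ hN', Finset.sum_div]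
  rw [← Finset.sum_add_distrib]
  refine HasDerivAt.fun_sum fun k _ => ?_
  refine HasDerivAt.congr_deriv ((hF k).mul (hM k)) ?_
  ring

lemma hasDerivAt_coeff_mul {F G : ℝ → ℂ[X]} {F' G' : ℂ[X]} {t : ℝ}
    (hF : ∀ k, HasDerivAt (fun x => (F x).coeff k) (F'.coeff k) t)
    (hG : ∀ k, HasDerivAt (fun x => (G x).coeff k) (G'.coeff k) t) (k : ℕ) :
    HasDerivAt (fun x => (F x * G x).coeff k) ((F' * G t + F t * G').coeff k) t := by
  simp only [coeff_mul, coeff_add]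
  rw [← Finset.sum_add_distrib]
  exact HasDerivAt.fun_sum fun i _ => (hF _).mul (hG _)

lemma isFunctionRing_differentiableAt (t : ℝ) :
    IsFunctionRing (fun f : ℝ → ℂ => DifferentiableAt ℝ f t) where
  add _ _ hf hg := hf.add hg
  mul _ _ hf hg := hf.mul hg
  const c := differentiableAt_const c

section

variable {σ : ℂ} {M : ℝ → ℕ → ℂ} {t : ℝ}

/-- The leading coefficient is constantly `1`, so the derivative has degree below `n` and is
orthogonal to `π_n`. This bound replaces any explicit formula for the derivative. -/
lemma MomentFlowAt.hasDerivAt_monicOP (hM : MomentFlowAt σ M t) (n : ℕ)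
    (hn : ∀ j < n, opNorm (M t) j ≠ 0) :
    ∃ F' : ℂ[X], F'.degree < n ∧
      ∀ k, HasDerivAt (fun x => (monicOP (M x) n).coeff k) (F'.coeff k) t := by
  have hd : ∀ k, DifferentiableAt ℝ (fun x => (monicOP (M x) n).coeff k) t :=
    (isFunctionRing_differentiableAt t).monicOP_mem (fun k => (hM k).differentiableAt) n
      fun j hj h => h.inv (hn j hj)
  refine ⟨∑ k ∈ Finset.range n, monomial k (deriv (fun x => (monicOP (M x) n).coeff k) t), ?_, ?_⟩
  · rw [degree_lt_iff_coeff_zero]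
    intro k hk
    simp [coeff_monomial, hk]
  · intro k
    by_cases hk : k < n
    · have : (∑ k ∈ Finset.range n, monomial k (deriv (fun x => (monicOP (M x) n).coeff k) t)).coeff k
          = deriv (fun x => (monicOP (M x) n).coeff k) t := by
        simp [coeff_monomial]; omega
      rw [this]; exact (hd k).hasDerivAt
    · have : (∑ k ∈ Finset.range n, monomial k (deriv (fun x => (monicOP (M x) n).coeff k) t)).coeff k
          = 0 := by
        simp [coeff_monomial]; omega
      rw [this]
      rcases (not_lt.1 hk).eq_or_lt with rfl | hk
      · simp only [coeff_monicOP_self]; exact hasDerivAt_const _ _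
      · simp only [coeff_monicOP_of_lt hk]; exact hasDerivAt_const _ _

lemma MomentFlowAt.hasDerivAt_opNorm (hM : MomentFlowAt σ M t) (n : ℕ)
    (hn : ∀ j ≤ n, opNorm (M t) j ≠ 0) :
    HasDerivAt (fun x => opNorm (M x) n)
      ((σ + 2 * n - opDiag (M t) n) * opNorm (M t) n / t) t := by
  obtain ⟨F', hd, hF⟩ := hM.hasDerivAt_monicOP n fun j hj => hn j hj.le
  have h := hM.hasDerivAt_functional (n + n + 1)
    (fun x => by rw [(monicOP_monic n).natDegree_mul (monicOP_monic n), natDegree_monicOP]; omega)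
    (hasDerivAt_coeff_mul hF hF)
  rw [← sq, scaledFunctional_sq σ n hn] at h
  simp only [opNorm, sq] at h ⊢
  refine HasDerivAt.congr_deriv (h) ?_
  rw [map_add, mul_comm F', monicOP_orthogonal n (fun j hj => hn j hj.le) _ hd]
  ring

/-- Differentiate the orthogonality of `π_{n+1}` and `π_n`: the derivative of `π_{n+1}`, paired with
`π_n`, gives minus the derivative of the sum times the norm, and `scaledFunctional_succ_mul` gives
the other term. -/
lemma MomentFlowAt.hasDerivAt_opSum (hM : MomentFlowAt σ M t) (n : ℕ)
    (hn : ∀ j < n, opNorm (M t) j ≠ 0) :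
    HasDerivAt (fun x => opSum (M x) n) ((opSum (M t) n - opOff (M t) n) / t) t := by
  cases n with
  | zero => simpa [opSum, opOff] using hasDerivAt_const t (0 : ℂ)
  | succ n =>
    have hn' : ∀ j ≤ n, opNorm (M t) j ≠ 0 := fun j hj => hn j (by omega)
    obtain ⟨F', hd, hF⟩ := hM.hasDerivAt_monicOP (n + 1) hn
    obtain ⟨G', hdG, hG⟩ := hM.hasDerivAt_monicOP n fun j hj => hn j (by omega)
    have h := hM.hasDerivAt_functional (n + 1 + n + 1)
      (fun x => by
        rw [(monicOP_monic (n + 1)).natDegree_mul (monicOP_monic n), natDegree_monicOP,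
          natDegree_monicOP]; omega)
      (hasDerivAt_coeff_mul hF hG)
    rw [scaledFunctional_succ_mul σ n hn', map_add, mul_comm F',
      monicOP_mul_of_degree_lt (fun j hj => hn j (by omega)) hd,
      monicOP_orthogonal (n + 1) hn _ (hdG.trans (by exact_mod_cast n.lt_succ_self))] at h
    -- Orthogonality is needed on a whole neighbourhood before it can be differentiated; the norms
    -- stay nonzero there by continuity.
    have hnear : ∀ᶠ x in 𝓝 t, ∀ j ∈ Finset.range (n + 1), opNorm (M x) j ≠ 0 := by
      refine (Finset.eventually_all _).2 fun j hj => ?_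
      have hj' : j < n + 1 := Finset.mem_range.1 hj
      exact (hM.hasDerivAt_opNorm j fun i hi => hn i (by omega)).continuousAt.eventually_ne
        (hn j hj')
    have hz : (fun x => momentFunctional (M x) (monicOP (M x) (n + 1) * monicOP (M x) n))
        =ᶠ[𝓝 t] fun _ => 0 := by
      filter_upwards [hnear] with x hx
      exact momentFunctional_succ_mul n fun j hj => hx j (Finset.mem_range.2 (by omega))
    have h0 := (hasDerivAt_const t (0 : ℂ)).unique (h.congr_of_eventuallyEq hz.symm)
    have h1 := (hF n).neg
    have e : (fun x => -(monicOP (M x) (n + 1)).coeff n) = fun x => opSum (M x) (n + 1) := by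
      ext x; rw [coeff_monicOP_succ, neg_neg]
    rw [show (-fun x => (monicOP (M x) (n + 1)).coeff n)
      = fun x => -(monicOP (M x) (n + 1)).coeff n from rfl, e] at h1
    refine HasDerivAt.congr_deriv (h1) ?_
    refine mul_right_cancel₀ (hn n (by omega)) ?_
    linear_combination h0

lemma MomentFlowAt.hasDerivAt_opOff (hM : MomentFlowAt σ M t) (n : ℕ)
    (hn : ∀ j ≤ n, opNorm (M t) j ≠ 0) :
    HasDerivAt (fun x => opOff (M x) n)
      (opOff (M t) n * (2 - opDiag (M t) n + opDiag (M t) (n - 1)) / t) t := by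
  cases n with
  | zero => simpa [opOff] using hasDerivAt_const t (0 : ℂ)
  | succ n =>
    have h0 := hn n (by omega)
    refine HasDerivAt.congr_deriv ((hM.hasDerivAt_opNorm (n + 1) hn).div
      (hM.hasDerivAt_opNorm n fun j hj => hn j (by omega)) h0) ?_
    simp only [opOff, Nat.add_sub_cancel]
    push_cast
    field_simp
    ring

/-- The diagonal coefficient is the difference of consecutive sums, whose derivatives are known. -/
lemma MomentFlowAt.hasDerivAt_opDiag (hM : MomentFlowAt σ M t) (n : ℕ)
    (hn : ∀ j ≤ n, opNorm (M t) j ≠ 0) :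
    HasDerivAt (fun x => opDiag (M x) n)
      ((opDiag (M t) n - opOff (M t) (n + 1) + opOff (M t) n) / t) t := by
  have h := (hM.hasDerivAt_opSum (n + 1) fun j hj => hn j (by omega)).sub
    (hM.hasDerivAt_opSum n fun j hj => hn j hj.le)
  have e : (fun x => opDiag (M x) n) = (fun x => opSum (M x) (n + 1)) - fun x => opSum (M x) n := by
    ext x; simp [opSum_succ]
  rw [e]
  refine HasDerivAt.congr_deriv (h) ?_
  rw [opSum_succ]; ring

end

/-! ### Differential and bilinear relations for `θ_n` and `κ_n`. -/

/-- `θ_n` as a function of the moments. -/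
def opTheta (α μ : ℂ) (t : ℝ) (M : ℕ → ℂ) (n : ℕ) : ℂ :=
  opDiag M n - 2 * n - 1 - α - μ - t

/-- `κ_n` as a function of the moments. -/
def opKappa (μ : ℂ) (t : ℝ) (M : ℕ → ℂ) (n : ℕ) : ℂ :=
  (n + μ / 2) * t + opOff M n - opSum M n

lemma PearsonRelation.kappa_add_kappa_succ {α μ : ℂ} {t : ℝ} {M : ℕ → ℂ}
    (hP : PearsonRelation α μ t M) (n : ℕ) (hn : ∀ j ≤ n, opNorm M j ≠ 0) :
    opKappa μ t M n + opKappa μ t M (n + 1) = -(opDiag M n * opTheta α μ t M n) := by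
  have := hP.laguerreFreud n hn
  simp only [opKappa, opTheta, opSum_succ]
  push_cast
  linear_combination -this

section

variable {α μ : ℂ} {M : ℝ → ℕ → ℂ} {t : ℝ}

/-- The Toda equation for `b_n` contains `a_{n+1}²`; the Laguerre-Freud relation trades it for
quantities of level `n`. -/
lemma MomentFlowAt.hasDerivAt_opTheta (ht : t ≠ 0) (hM : MomentFlowAt (1 + α + μ) M t)
    (hP : PearsonRelation α μ t (M t)) (n : ℕ) (hn : ∀ j ≤ n, opNorm (M t) j ≠ 0) :
    HasDerivAt (fun x => opTheta α μ x (M x) n)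
      (((1 + 2 * n + α + μ) * opTheta α μ t (M t) n + 2 * opKappa μ t (M t) n
        + opTheta α μ t (M t) n * (opTheta α μ t (M t) n + t)) / t) t := by
  have h := ((((hM.hasDerivAt_opDiag n hn).sub_const (2 * (n : ℂ))).sub_const 1).sub_const
    α).sub_const μ
  have h2 := h.sub (Complex.ofRealCLM.hasDerivAt (x := t))
  refine HasDerivAt.congr_deriv (h2) ?_
  have hlf := hP.laguerreFreud n hn
  have ht' : (t : ℂ) ≠ 0 := by exact_mod_cast ht
  simp only [Complex.ofRealCLM_apply, opTheta, opKappa, Complex.ofReal_one]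
  field_simp
  linear_combination hlf

lemma MomentFlowAt.hasDerivAt_opKappa (ht : t ≠ 0) (hM : MomentFlowAt (1 + α + μ) M t)
    (n : ℕ) (hn : ∀ j ≤ n, opNorm (M t) j ≠ 0) :
    HasDerivAt (fun x => opKappa μ x (M x) n)
      ((opKappa μ t (M t) n + opOff (M t) n *
        (opTheta α μ t (M t) (n - 1) - opTheta α μ t (M t) n)) / t) t := by
  have h := (((Complex.ofRealCLM.hasDerivAt (x := t)).const_mul ((n : ℂ) + μ / 2)).add
    (hM.hasDerivAt_opOff n hn)).sub (hM.hasDerivAt_opSum n fun j hj => hn j hj.le)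
  refine HasDerivAt.congr_deriv (h) ?_
  have ht' : (t : ℂ) ≠ 0 := by exact_mod_cast ht
  simp only [Complex.ofRealCLM_apply, opTheta, opKappa, Complex.ofReal_one]
  cases n with
  | zero => simp [opOff]; field_simp
  | succ n => simp only [Nat.add_sub_cancel]; push_cast; field_simp; ring

/-- The identity `κ_n + κ_{n+1} = -b_n θ_n` holds near `t`, so both sides have the same derivative;
inserting the differential equations produces a second, independent relation. -/
lemma MomentFlowAt.kappa_succ_sub_kappa (ht : t ≠ 0)
    (hM : ∀ᶠ x in 𝓝 t, MomentFlowAt (1 + α + μ) M x)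
    (hP : ∀ᶠ x in 𝓝 t, PearsonRelation α μ (x : ℝ) (M x)) (n : ℕ)
    (hn : ∀ j ≤ n + 1, opNorm (M t) j ≠ 0) :
    opDiag (M t) n * (opKappa μ t (M t) (n + 1) - opKappa μ t (M t) n)
      = opOff (M t) n * opTheta α μ t (M t) (n - 1)
        - opOff (M t) (n + 1) * opTheta α μ t (M t) (n + 1) := by
  have hMt := hM.self_of_nhds
  have hnear : ∀ᶠ x in 𝓝 t, ∀ j ∈ Finset.range (n + 1), opNorm (M x) j ≠ 0 := by
    refine (Finset.eventually_all _).2 fun j hj => ?_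
    have hj' : j < n + 1 := Finset.mem_range.1 hj
    exact (hMt.hasDerivAt_opNorm j fun i hi => hn i (by omega)).continuousAt.eventually_ne
      (hn j hj'.le)
  have hn' : ∀ j ≤ n, opNorm (M t) j ≠ 0 := fun j hj => hn j (by omega)
  have e : (fun x => opKappa μ x (M x) n + opKappa μ x (M x) (n + 1))
      =ᶠ[𝓝 t] fun x => -(opDiag (M x) n * opTheta α μ x (M x) n) := by
    filter_upwards [hnear, hP] with x hx hPx
    exact hPx.kappa_add_kappa_succ n fun j hj => hx j (Finset.mem_range.2 (by omega))
  have hθ := hMt.hasDerivAt_opTheta ht hP.self_of_nhds n hn'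
  have h1 := ((hMt.hasDerivAt_opKappa ht n hn').add (hMt.hasDerivAt_opKappa ht (n + 1) hn))
  have h2 := ((hMt.hasDerivAt_opDiag n hn').mul hθ).neg
  have h3 := h1.unique (h2.congr_of_eventuallyEq e)
  have hlf := hP.self_of_nhds.laguerreFreud n hn'
  have ht' : (t : ℂ) ≠ 0 := by exact_mod_cast ht
  have h4 := congrArg (fun z => z * (t : ℂ)) h3
  simp only [neg_mul, add_mul, div_mul_cancel₀ _ ht'] at h4
  have h5 : ∀ A B C D : ℂ, (A / t * B + C * (D / t)) * t = A * B + C * D := by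
    intro A B C D; field_simp
  simp only [← add_mul, h5, Nat.add_sub_cancel] at h4
  have h6 := hP.self_of_nhds.kappa_add_kappa_succ n hn'
  simp only [opKappa, opTheta, opSum_succ] at h4 h6 ⊢
  push_cast at h4 h6 ⊢
  linear_combination -h4 + h6 - (opDiag (M t) n) * hlf

/-- The bilinear relations between `κ_n`, `θ_n` and `θ_{n-1}`. -/
lemma MomentFlowAt.quadratic_relations (ht : t ≠ 0)
    (hM : ∀ᶠ x in 𝓝 t, MomentFlowAt (1 + α + μ) M x)
    (hP : ∀ᶠ x in 𝓝 t, PearsonRelation α μ (x : ℝ) (M x)) (n : ℕ)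
    (hn : ∀ j ≤ n, opNorm (M t) j ≠ 0) :
    opKappa μ t (M t) n ^ 2 - μ ^ 2 * t ^ 2 / 4
        = opOff (M t) n * opTheta α μ t (M t) n * opTheta α μ t (M t) (n - 1) ∧
      ((n + α + μ / 2) * t - opKappa μ t (M t) n) * ((n + μ / 2) * t - opKappa μ t (M t) n)
        = opOff (M t) n * (opTheta α μ t (M t) n + t) * (opTheta α μ t (M t) (n - 1) + t) := by
  -- Both identities telescope: the increment of `κ_n²` is the product of the formulas for sum and
  -- difference (`h4`, `h3`), and the second identity is the same computation with `θ` shifted by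
  -- `t`. At level `0`, `κ_0 = μ t / 2` and `a_0 = 0`.
  induction n with
  | zero => simp [opKappa, opOff, opSum]; ring
  | succ n ih =>
    obtain ⟨h1, h2⟩ := ih fun j hj => hn j (by omega)
    have h3 := MomentFlowAt.kappa_succ_sub_kappa ht hM hP n hn
    have h4 := hP.self_of_nhds.kappa_add_kappa_succ n fun j hj => hn j (by omega)
    simp only [Nat.add_sub_cancel]
    set k := opKappa μ t (M t) n
    set k' := opKappa μ t (M t) (n + 1) with hk'
    have hd : k' - k = t + opOff (M t) (n + 1) - opOff (M t) n - opDiag (M t) n := by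
      simp only [k, hk', opKappa, opSum_succ]; push_cast; ring
    have hθ : opDiag (M t) n = opTheta α μ t (M t) n + (2 * n + 1 + α + μ + t) := by
      simp only [opTheta]; ring
    push_cast
    constructor
    · linear_combination h1 + (k' - k) * h4 - opTheta α μ t (M t) n * h3
    · linear_combination h2 + (k' - k - t) * h4 + (k' - k - t) * t * hθ
        - (opTheta α μ t (M t) n + t) * h3 + (opTheta α μ t (M t) n + t) * t * hd

end

/-! ### Hamilton equations and the fifth Painlevé equation. -/

/-- The right hand side of `q' = ∂H/∂p`. -/
def qField (α m : ℂ) (t : ℝ) (q p : ℂ) : ℂ :=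
  (2 * q * (q - 1) ^ 2 * p - (α * (q - 1) ^ 2 + m * q * (q - 1) + t * q)) / t

/-- The right hand side of `p' = -∂H/∂q`. -/
def pField (α m c : ℂ) (t : ℝ) (q p : ℂ) : ℂ :=
  -(((q - 1) ^ 2 + 2 * q * (q - 1)) * p ^ 2 - (2 * α * (q - 1) + m * (2 * q - 1) + t) * p + c) / t

/-- The `v_i` enter the vector field only through `v₂ - v₁`, `v₁ + v₂` and the product `(v₃ - v₁)(v₄
- v₁)`. The explicit fields are used from here on. -/
lemma hamiltonEquationsAt_iff {α μ n v₁ v₂ v₃ v₄ : ℂ} (hv : v₁ + v₂ + v₃ + v₄ = 0)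
    (h34 : v₃ - v₄ = -μ) (h31 : v₃ - v₁ = n + α) (h32 : v₃ - v₂ = n) (q p : ℝ → ℂ) (t : ℝ) :
    HamiltonEquationsAt (okamotoHamiltonian v₁ v₂ v₃ v₄) q p t ↔
      HasDerivAt q (qField α (2 * n + α + μ) t (q t) (p t)) t ∧
      HasDerivAt p (pField α (2 * n + α + μ) ((n + α) * (n + α + μ)) t (q t) (p t)) t := by
  have e1 : v₂ - v₁ = α := by linear_combination h31 - h32
  have e2 : -2 * (v₁ + v₂) = 2 * n + α + μ := by
    linear_combination -hv + h31 + h32 - h34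
  have e3 : v₄ - v₁ = n + α + μ := by linear_combination h31 - h34
  have hd1 : deriv (fun y => okamotoHamiltonian v₁ v₂ v₃ v₄ t (q t) y) (p t)
      = qField α (2 * n + α + μ) t (q t) (p t) := by
    have h := ((((hasDerivAt_pow 2 (p t)).const_mul (q t * (q t - 1) ^ 2)).sub
      ((hasDerivAt_id (p t)).const_mul ((v₂ - v₁) * (q t - 1) ^ 2 - 2 * (v₁ + v₂) * q t * (q t - 1)
        + t * q t))).add_const ((v₃ - v₁) * (v₄ - v₁) * (q t - 1))).div_const (t : ℂ)
    refine (HasDerivAt.congr_deriv h ?_).deriv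
    rw [qField, e1, ← e2]; push_cast; ring
  have hd2 : -deriv (fun x => okamotoHamiltonian v₁ v₂ v₃ v₄ t x (p t)) (q t)
      = pField α (2 * n + α + μ) ((n + α) * (n + α + μ)) t (q t) (p t) := by
    have hq := hasDerivAt_id (q t)
    have hq1 := hq.sub_const 1
    have h := (((hq.mul (hq1.pow 2)).mul_const (p t ^ 2)).sub
      (((((hq1.pow 2).const_mul (v₂ - v₁)).sub (((hq.const_mul (2 * (v₁ + v₂)))).mul hq1)).add
        (hq.const_mul (t : ℂ))).mul_const (p t))).add (hq1.const_mul ((v₃ - v₁) * (v₄ - v₁)))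
        |>.div_const (t : ℂ)
    rw [neg_eq_iff_eq_neg]
    refine (HasDerivAt.congr_deriv h ?_).deriv
    rw [pField, e1, ← e2, e3, h31]; push_cast; simp; ring
  rw [HamiltonEquationsAt, hd1, hd2]

/-- Solutions of the Hamilton equations solve the fifth Painlevé equation. -/
lemma painleveVAt_of_hamilton {α μ n : ℂ} {q p : ℝ → ℂ} {t : ℝ} (ht : t ≠ 0)
    (h : ∀ᶠ s in 𝓝 t, HasDerivAt q (qField α (2 * n + α + μ) s (q s) (p s)) s ∧
      HasDerivAt p (pField α (2 * n + α + μ) ((n + α) * (n + α + μ)) s (q s) (p s)) s)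
    (hq0 : q t ≠ 0) (hq1 : q t ≠ 1) :
    PainleveVAt (μ ^ 2 / 2) (-α ^ 2 / 2) (-(2 * n + α + 1 + μ)) (-1 / 2) q t := by
  have ht' : (t : ℂ) ≠ 0 := by exact_mod_cast ht
  refine ⟨fun s => qField α (2 * n + α + μ) s (q s) (p s), h.mono fun s hs => hs.1, ?_⟩
  obtain ⟨hq, hp⟩ := h.self_of_nhds
  have hq1' := hq.sub_const 1
  have hid := Complex.ofRealCLM.hasDerivAt (x := t)
  have hd := (((((hq.const_mul 2).mul (hq1'.pow 2)).mul hp).sub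
    ((((hq1'.pow 2).const_mul α).add ((hq.const_mul (2 * n + α + μ)).mul hq1')).add
      (hid.mul hq))).div hid (by simpa using ht'))
  refine HasDerivAt.congr_deriv hd ?_
  have hq1'' : q t - 1 ≠ 0 := sub_ne_zero.2 hq1
  simp only [Pi.mul_apply, Pi.pow_apply, Pi.add_apply, Pi.sub_apply, Complex.ofRealCLM_apply, qField, pField,
    Complex.ofReal_one]
  -- There is no need to solve for `p`: with `q'` replaced by `qField`, the equation is an identity
  -- between rational functions of `t`, `q` and `p`.
  generalize q t = x at *
  generalize p t = y at *
  field_simp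
  ring

section

variable {α μ n : ℂ} {θ κ : ℝ → ℂ} {t : ℝ} {D E : ℂ}

lemma hasDerivAt_q_of_theta (ht : t ≠ 0) (h0 : θ t ≠ 0) (h1 : θ t + t ≠ 0)
    (hθ : HasDerivAt θ (((1 + 2 * n + α + μ) * θ t + 2 * κ t + θ t * (θ t + t)) / t) t) :
    HasDerivAt (fun s => (θ s + s) / θ s) (qField α (2 * n + α + μ) t ((θ t + t) / θ t)
      (θ t * ((n + α + μ / 2) * t - κ t) / (t * (θ t + t)))) t := by
  have ht' : (t : ℂ) ≠ 0 := by exact_mod_cast ht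
  have hid := Complex.ofRealCLM.hasDerivAt (x := t)
  refine HasDerivAt.congr_deriv ((hθ.add hid).div hθ h0) ?_
  simp only [Pi.add_apply, Complex.ofRealCLM_apply, qField, Complex.ofReal_one]
  generalize θ t = x at *
  generalize κ t = y at *
  field_simp
  ring

/-- In the application `D = a_n²` and `E = θ_{n-1}`. The relations `hr` and `hr'` determine `D * E`
and then `D`, the only combinations occurring in the derivative of `κ`; a rational identity in `θ`,
`κ`, `t` is left. -/
lemma hasDerivAt_p_of_theta_kappa (ht : t ≠ 0) (h0 : θ t ≠ 0) (h1 : θ t + t ≠ 0)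
    (hθ : HasDerivAt θ (((1 + 2 * n + α + μ) * θ t + 2 * κ t + θ t * (θ t + t)) / t) t)
    (hκ : HasDerivAt κ ((κ t + D * (E - θ t)) / t) t)
    (hr : κ t ^ 2 - μ ^ 2 * t ^ 2 / 4 = D * θ t * E)
    (hr' : ((n + α + μ / 2) * t - κ t) * ((n + μ / 2) * t - κ t) = D * (θ t + t) * (E + t)) :
    HasDerivAt (fun s => θ s * ((n + α + μ / 2) * s - κ s) / (s * (θ s + s)))
      (pField α (2 * n + α + μ) ((n + α) * (n + α + μ)) t ((θ t + t) / θ t)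
        (θ t * ((n + α + μ / 2) * t - κ t) / (t * (θ t + t)))) t := by
  have ht' : (t : ℂ) ≠ 0 := by exact_mod_cast ht
  have hid := Complex.ofRealCLM.hasDerivAt (x := t)
  refine HasDerivAt.congr_deriv ((hθ.mul ((hid.const_mul (n + α + μ / 2)).sub hκ)).div
    (hid.mul (hθ.add hid)) (mul_ne_zero (by simpa using ht') (by simpa using h1))) ?_
  simp only [Pi.mul_apply, Pi.sub_apply, Complex.ofRealCLM_apply, pField, Complex.ofReal_one]
  generalize θ t = x at *
  generalize κ t = y at *
  have hDE : D * E = (y ^ 2 - μ ^ 2 * t ^ 2 / 4) / x := by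
    field_simp; linear_combination (-4) * hr
  have hD : D = (((n + α + μ / 2) * t - y) * ((n + μ / 2) * t - y) / (x + t)
      - (y ^ 2 - μ ^ 2 * t ^ 2 / 4) / x) / t := by
    rw [← hDE, hr']; field_simp; ring
  rw [mul_sub D E x, hDE, hD]
  field_simp
  ring

end


/-! ### Moments of the deformed Laguerre weight. -/

lemma exists_rpow_le_exp (ν : ℝ) {b : ℝ} (hb : 0 < b) :
    ∃ C : ℝ, 0 ≤ C ∧ ∀ x : ℝ, 1 ≤ x → x ^ ν ≤ C * Real.exp (b * x) := by
  obtain ⟨N, hN⟩ := exists_nat_ge ν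
  refine ⟨N.factorial / b ^ N, by positivity, fun x hx => ?_⟩
  have h1 : x ^ ν ≤ x ^ N := by
    rw [← Real.rpow_natCast]; exact Real.rpow_le_rpow_of_exponent_le hx hN
  have h2 := Real.pow_div_factorial_le_exp (b * x) (by positivity) N
  rw [mul_pow, div_le_iff₀ (by positivity)] at h2
  rw [div_mul_eq_mul_div, le_div_iff₀ (by positivity)]
  nlinarith [pow_pos hb N]

/-- Differentiation of a Laplace transform. -/
lemma hasDerivAt_laplace {ν : Measure ℝ} {g φ : ℝ → ℝ} (hφm : Measurable φ) (hgm : Measurable g)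
    (hφ : ∀ᵐ y ∂ν, 0 ≤ φ y) {t₁ t : ℝ} (ht : t₁ < t)
    (hi : Integrable (fun y => g y * Real.exp (-(t * φ y))) ν)
    (hi' : Integrable (fun y => g y * φ y * Real.exp (-(t₁ * φ y))) ν) :
    HasDerivAt (fun x => ∫ y, g y * Real.exp (-(x * φ y)) ∂ν)
      (-∫ y, g y * φ y * Real.exp (-(t * φ y)) ∂ν) t := by
  have h := hasDerivAt_integral_of_dominated_loc_of_deriv_le (μ := ν) (x₀ := t) (s := Ioi t₁)
    (F := fun x y => g y * Real.exp (-(x * φ y)))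
    (F' := fun x y => -(g y * φ y * Real.exp (-(x * φ y))))
    (bound := fun y => ‖g y * φ y * Real.exp (-(t₁ * φ y))‖) (Ioi_mem_nhds ht)
    (Eventually.of_forall fun x => by fun_prop) hi (by fun_prop) ?_ hi'.norm ?_
  · rw [← integral_neg]; exact h.2
  · filter_upwards [hφ] with y hy x hx
    rw [norm_neg, norm_mul, norm_mul (g y * φ y)]
    refine mul_le_mul_of_nonneg_left ?_ (norm_nonneg _)
    rw [Real.norm_eq_abs, Real.norm_eq_abs, Real.abs_exp, Real.abs_exp, Real.exp_le_exp]
    have : t₁ ≤ x := le_of_lt hx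
    nlinarith
  · refine Eventually.of_forall fun y x _ => ?_
    have h1 : HasDerivAt (fun x => -(x * φ y)) (-(1 * φ y)) x :=
      ((hasDerivAt_id x).mul_const (φ y)).neg
    refine HasDerivAt.congr_deriv (h1.exp.const_mul (g y)) ?_
    ring

/-- `∫₀^∞ z ^ α (1 + z) ^ μ e ^ (-t (1 + z)) dz`. -/
def outerIntegral (α μ t : ℝ) : ℝ :=
  ∫ z in Ioi (0 : ℝ), z ^ α * (1 + z) ^ μ * Real.exp (-(t * (1 + z)))

/-- `∫₀^1 (1 - y) ^ α y ^ μ e ^ (-t y) dy`. -/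
def innerIntegral (α μ t : ℝ) : ℝ :=
  ∫ y in Ioo (0 : ℝ) 1, (1 - y) ^ α * y ^ μ * Real.exp (-(t * y))

lemma integrable_outer {α : ℝ} (hα : -1 < α) (μ : ℝ) {t : ℝ} (ht : 0 < t) :
    IntegrableOn (fun z => z ^ α * (1 + z) ^ μ * Real.exp (-(t * (1 + z)))) (Ioi 0) := by
  -- Half of the exponential absorbs the factor `(1 + z) ^ μ`, the other half provides
  -- integrability.
  obtain ⟨C, hC0, hC⟩ := exists_rpow_le_exp μ (half_pos ht)
  have h1 := (integrableOn_rpow_mul_exp_neg_mul_rpow hα zero_lt_one (half_pos ht)).const_mul C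
  refine Integrable.mono' h1 (by fun_prop) ?_
  rw [ae_restrict_iff' measurableSet_Ioi]
  refine Eventually.of_forall fun z (hz : 0 < z) => ?_
  have hza : 0 ≤ z ^ α := by positivity
  have h2 := hC (1 + z) (by linarith)
  rw [Real.norm_of_nonneg (by positivity), Real.rpow_one]
  calc z ^ α * (1 + z) ^ μ * Real.exp (-(t * (1 + z)))
      ≤ z ^ α * (C * Real.exp (t / 2 * (1 + z))) * Real.exp (-(t * (1 + z))) := by gcongr
    _ = C * z ^ α * Real.exp (t / 2 * (1 + z) + -(t * (1 + z))) := by rw [Real.exp_add]; ring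
    _ ≤ C * z ^ α * Real.exp (-(t / 2) * z) := by
        refine mul_le_mul_of_nonneg_left (Real.exp_le_exp.2 ?_) (by positivity)
        nlinarith
    _ = _ := by ring

lemma integrable_inner_zero {α μ : ℝ} (hα : -1 < α) (hμ : -1 < μ) :
    IntegrableOn (fun y : ℝ => (1 - y) ^ α * y ^ μ) (Ioo 0 1) := by
  have h := Complex.betaIntegral_convergent (u := ((μ + 1 : ℝ) : ℂ)) (v := ((α + 1 : ℝ) : ℂ))
    (by simp; linarith) (by simp; linarith)
  rw [intervalIntegrable_iff_integrableOn_Ioo_of_le zero_le_one] at h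
  refine IntegrableOn.congr_fun (Integrable.norm h) (fun y hy => ?_) measurableSet_Ioo
  have h1 : (1 : ℂ) - y = ((1 - y : ℝ) : ℂ) := by push_cast; ring
  simp only [norm_mul, h1]
  rw [Complex.norm_cpow_eq_rpow_re_of_pos hy.1, Complex.norm_cpow_eq_rpow_re_of_pos (by linarith [hy.2])]
  simp [mul_comm]

lemma integrable_inner {α μ : ℝ} (hα : -1 < α) (hμ : -1 < μ) (t : ℝ) :
    IntegrableOn (fun y => (1 - y) ^ α * y ^ μ * Real.exp (-(t * y))) (Ioo 0 1) := by
  refine Integrable.mono' ((integrable_inner_zero hα hμ).mul_const (Real.exp |t|)) (by fun_prop) ?_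
  rw [ae_restrict_iff' measurableSet_Ioo]
  refine Eventually.of_forall fun y hy => ?_
  have h1 : 0 < 1 - y := by linarith [hy.2]
  have h2 := hy.1
  rw [Real.norm_of_nonneg (by positivity)]
  refine mul_le_mul_of_nonneg_left (Real.exp_le_exp.2 ?_) (by positivity)
  have := neg_abs_le t
  nlinarith [abs_nonneg t, hy.2]

lemma hasDerivAt_outer {α : ℝ} (hα : -1 < α) (μ : ℝ) {t : ℝ} (ht : 0 < t) :
    HasDerivAt (outerIntegral α μ) (-outerIntegral α (μ + 1) t) t := by
  have e : ∀ x : ℝ, EqOn (fun z : ℝ => z ^ α * (1 + z) ^ μ * (1 + z) * Real.exp (-(x * (1 + z))))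
      (fun z => z ^ α * (1 + z) ^ (μ + 1) * Real.exp (-(x * (1 + z)))) (Ioi 0) := by
    intro x z (hz : 0 < z)
    simp only [Real.rpow_add_one (by linarith : (1 + z) ≠ 0)]; ring
  have h := hasDerivAt_laplace (ν := volume.restrict (Ioi 0)) (g := fun z => z ^ α * (1 + z) ^ μ)
    (φ := fun z => 1 + z) (by fun_prop) (by fun_prop)
    (by rw [ae_restrict_iff' measurableSet_Ioi]
        exact Eventually.of_forall fun z (hz : 0 < z) => by linarith)
    (half_lt_self ht) (integrable_outer hα μ ht)
    (IntegrableOn.congr_fun (integrable_outer hα (μ + 1) (half_pos ht)) (e (t / 2)).symm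
      measurableSet_Ioi)
  rw [setIntegral_congr_fun measurableSet_Ioi (e t)] at h
  exact h

lemma hasDerivAt_inner {α μ : ℝ} (hα : -1 < α) (hμ : -1 < μ) (t : ℝ) :
    HasDerivAt (innerIntegral α μ) (-innerIntegral α (μ + 1) t) t := by
  have e : ∀ x : ℝ, EqOn (fun z : ℝ => (1 - z) ^ α * z ^ μ * z * Real.exp (-(x * z)))
      (fun z => (1 - z) ^ α * z ^ (μ + 1) * Real.exp (-(x * z))) (Ioo 0 1) := by
    intro x z hz
    simp only [Real.rpow_add_one hz.1.ne']; ring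
  have h := hasDerivAt_laplace (ν := volume.restrict (Ioo 0 1)) (g := fun z => (1 - z) ^ α * z ^ μ)
    (φ := fun z => z) (by fun_prop) (by fun_prop)
    (by rw [ae_restrict_iff' measurableSet_Ioo]
        exact Eventually.of_forall fun z hz => hz.1.le)
    (sub_one_lt t) (integrable_inner hα hμ t)
    (IntegrableOn.congr_fun (integrable_inner hα (by linarith) (t - 1)) (e (t - 1)).symm
      measurableSet_Ioo)
  rw [setIntegral_congr_fun measurableSet_Ioo (e t)] at h
  exact h

/-- Integrate the derivative of `z^(α+1) (1+z)^(μ+1) e^(-t(1+z))`, which vanishes at both ends, and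
write `z = (1+z) - 1`. This is the Pearson recursion in the rescaled variable. -/
lemma outerIntegral_relation {α : ℝ} (hα : -1 < α) (μ : ℝ) {t : ℝ} (ht : 0 < t) :
    t * outerIntegral α (μ + 2) t
      = (2 + α + μ + t) * outerIntegral α (μ + 1) t - (1 + μ) * outerIntegral α μ t := by
  have i0 := integrable_outer hα μ ht
  have i1 := integrable_outer hα (μ + 1) ht
  have i2 := integrable_outer hα (μ + 2) ht
  have hlim : Tendsto (fun z : ℝ => z ^ (α + 1) * (1 + z) ^ (μ + 1) * Real.exp (-(t * (1 + z))))
      atTop (𝓝 0) := by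
    have h1 := (tendsto_rpow_mul_exp_neg_mul_atTop_nhds_zero (α + 1 + (μ + 1)) t ht).comp
      (tendsto_atTop_add_const_left atTop (1 : ℝ) tendsto_id)
    refine squeeze_zero' ?_ ?_ h1
    · filter_upwards [eventually_gt_atTop 0] with z hz
      positivity
    · filter_upwards [eventually_gt_atTop 0] with z hz
      simp only [Function.comp, id]
      rw [Real.rpow_add (by linarith : 0 < 1 + z) (α + 1) (μ + 1), neg_mul]
      gcongr <;> linarith
  have key := integral_Ioi_of_hasDerivAt_of_tendsto (a := 0)
    (f := fun z : ℝ => z ^ (α + 1) * (1 + z) ^ (μ + 1) * Real.exp (-(t * (1 + z))))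
    (f' := fun z => (2 + α + μ + t) * (z ^ α * (1 + z) ^ (μ + 1) * Real.exp (-(t * (1 + z))))
      - (1 + μ) * (z ^ α * (1 + z) ^ μ * Real.exp (-(t * (1 + z))))
      - t * (z ^ α * (1 + z) ^ (μ + 2) * Real.exp (-(t * (1 + z))))) ?_ ?_
      (((i1.const_mul _).sub (i0.const_mul _)).sub (i2.const_mul _)) hlim
  · rw [integral_sub, integral_sub, integral_const_mul, integral_const_mul, integral_const_mul] at key
    · rw [Real.zero_rpow (by linarith)] at key
      unfold outerIntegral
      linarith
    · exact i1.const_mul _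
    · exact i0.const_mul _
    · exact (i1.const_mul _).sub (i0.const_mul _)
    · exact i2.const_mul _
  · refine ContinuousAt.continuousWithinAt ?_
    refine ContinuousAt.mul (ContinuousAt.mul ?_ ?_) (by fun_prop)
    · exact continuousAt_id.rpow_const (Or.inr (by linarith))
    · exact ContinuousAt.rpow_const (by fun_prop) (Or.inl (by norm_num))
  · intro z (hz : 0 < z)
    have h1z : 0 < 1 + z := by linarith
    have d1 := Real.hasDerivAt_rpow_const (x := z) (p := α + 1) (Or.inl hz.ne')
    have d0 : HasDerivAt (fun z : ℝ => 1 + z) 1 z := (hasDerivAt_id z).const_add 1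
    have d2 := d0.rpow_const (p := μ + 1) (Or.inl h1z.ne')
    have d3 := ((d0.const_mul t).neg).exp
    refine HasDerivAt.congr_deriv ((d1.mul d2).mul d3) ?_
    rw [show μ + 2 = μ + 1 + 1 by ring, Real.rpow_add_one h1z.ne' (μ + 1),
      Real.rpow_add_one h1z.ne' μ]
    simp only [Pi.mul_apply, Pi.neg_apply, add_sub_cancel_right, Real.rpow_add_one hz.ne' α,
      Real.rpow_add_one h1z.ne' μ]
    ring

lemma innerIntegral_relation {α μ : ℝ} (hα : -1 < α) (hμ : -1 < μ) (t : ℝ) :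
    t * innerIntegral α (μ + 2) t
      = (2 + α + μ + t) * innerIntegral α (μ + 1) t - (1 + μ) * innerIntegral α μ t := by
  have i0 := integrable_inner hα hμ t
  have i1 := integrable_inner hα (by linarith : -1 < μ + 1) t
  have i2 := integrable_inner hα (by linarith : -1 < μ + 2) t
  have key := intervalIntegral.integral_eq_sub_of_hasDerivAt_of_le (a := 0) (b := 1) zero_le_one
    (f := fun z : ℝ => -((1 - z) ^ (α + 1) * z ^ (μ + 1) * Real.exp (-(t * z))))
    (f' := fun z => (2 + α + μ + t) * ((1 - z) ^ α * z ^ (μ + 1) * Real.exp (-(t * z)))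
      - (1 + μ) * ((1 - z) ^ α * z ^ μ * Real.exp (-(t * z)))
      - t * ((1 - z) ^ α * z ^ (μ + 2) * Real.exp (-(t * z)))) ?_ ?_
      ((intervalIntegrable_iff_integrableOn_Ioo_of_le zero_le_one).2
        (((i1.const_mul _).sub (i0.const_mul _)).sub (i2.const_mul _)))
  · rw [intervalIntegral.integral_of_le zero_le_one, integral_Ioc_eq_integral_Ioo,
      integral_sub, integral_sub, integral_const_mul, integral_const_mul, integral_const_mul] at key
    · rw [sub_self, Real.zero_rpow (by linarith), Real.zero_rpow (by linarith)] at key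
      unfold innerIntegral
      linarith
    · exact i1.const_mul _
    · exact i0.const_mul _
    · exact (i1.const_mul _).sub (i0.const_mul _)
    · exact i2.const_mul _
  · refine Continuous.continuousOn ?_
    refine Continuous.neg (Continuous.mul (Continuous.mul ?_ ?_) (by fun_prop))
    · exact Continuous.rpow_const (by fun_prop) (fun _ => Or.inr (by linarith))
    · exact continuous_id.rpow_const (fun _ => Or.inr (by linarith))
  · intro z hz
    have h0z : 0 < z := hz.1
    have h1z : 0 < 1 - z := by linarith [hz.2]
    have d1 := Real.hasDerivAt_rpow_const (x := z) (p := μ + 1) (Or.inl h0z.ne')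
    have d0 : HasDerivAt (fun z : ℝ => 1 - z) (-1) z := (hasDerivAt_id z).const_sub 1
    have d2 := d0.rpow_const (p := α + 1) (Or.inl h1z.ne')
    have d3 := (((hasDerivAt_id z).const_mul t).neg).exp
    refine HasDerivAt.congr_deriv ((d2.mul d1).mul d3).neg ?_
    rw [show μ + 2 = μ + 1 + 1 by ring, Real.rpow_add_one h0z.ne' (μ + 1),
      Real.rpow_add_one h0z.ne' μ]
    simp only [Pi.mul_apply, Pi.neg_apply, add_sub_cancel_right, Real.rpow_add_one h1z.ne' α,
      Real.rpow_add_one h0z.ne' μ, id]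
    ring


/-- Rescaling fixes the singular point at `y = 1`, so that `t` survives only in the exponential and
in a power of `t`. Differentiating before rescaling would produce the exponent `α - 1`, which need
not be integrable. -/
lemma inner_change_of_variables {α μ : ℝ} (hα : -1 < α) (hμ : -1 < μ) {t : ℝ} (ht : 0 < t) :
    IntegrableOn (fun x : ℝ => (t - x) ^ α * x ^ μ * Real.exp (-x)) (Ioo 0 t) ∧
      ∫ x in Ioo 0 t, (t - x) ^ α * x ^ μ * Real.exp (-x)
        = t ^ (1 + α + μ) * innerIntegral α μ t := by
  have himg : (fun y : ℝ => t * y) '' Ioo 0 1 = Ioo 0 t := by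
    rw [image_mul_left_Ioo ht]; simp
  have hd : ∀ y ∈ Ioo (0 : ℝ) 1, HasDerivWithinAt (fun y : ℝ => t * y) ((fun _ => t) y) (Ioo 0 1) y :=
    fun y _ => by simpa using ((hasDerivAt_id y).const_mul t).hasDerivWithinAt
  have hinj : InjOn (fun y : ℝ => t * y) (Ioo 0 1) := fun a _ b _ h =>
    mul_left_cancel₀ ht.ne' h
  have e : EqOn (fun y : ℝ => t ^ (1 + α + μ) * ((1 - y) ^ α * y ^ μ * Real.exp (-(t * y))))
      (fun y => |t| • ((t - t * y) ^ α * (t * y) ^ μ * Real.exp (-(t * y)))) (Ioo 0 1) := by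
    intro y hy
    have h1 : 0 ≤ 1 - y := by linarith [hy.2]
    simp only [smul_eq_mul, abs_of_pos ht]
    rw [show t - t * y = t * (1 - y) by ring, Real.mul_rpow ht.le h1, Real.mul_rpow ht.le hy.1.le,
      Real.rpow_add ht, Real.rpow_add ht, Real.rpow_one]
    ring
  constructor
  · rw [← himg, integrableOn_image_iff_integrableOn_abs_deriv_smul measurableSet_Ioo hd hinj]
    exact IntegrableOn.congr_fun ((integrable_inner hα hμ t).const_mul _) e measurableSet_Ioo
  · rw [← himg, integral_image_eq_integral_abs_deriv_smul measurableSet_Ioo hd hinj,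
      ← setIntegral_congr_fun measurableSet_Ioo e, integral_const_mul, innerIntegral]

lemma outer_change_of_variables {α : ℝ} (hα : -1 < α) (μ : ℝ) {t : ℝ} (ht : 0 < t) :
    IntegrableOn (fun x : ℝ => (x - t) ^ α * x ^ μ * Real.exp (-x)) (Ioi t) ∧
      ∫ x in Ioi t, (x - t) ^ α * x ^ μ * Real.exp (-x)
        = t ^ (1 + α + μ) * outerIntegral α μ t := by
  have himg : (fun y : ℝ => t * (1 + y)) '' Ioi 0 = Ioi t := by
    ext x
    simp only [mem_image, mem_Ioi]
    constructor
    · rintro ⟨y, hy, rfl⟩; nlinarith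
    · intro hx
      refine ⟨x / t - 1, ?_, by field_simp; ring⟩
      rw [sub_pos, lt_div_iff₀ ht]; linarith
  have hd : ∀ y ∈ Ioi (0 : ℝ),
      HasDerivWithinAt (fun y : ℝ => t * (1 + y)) ((fun _ => t) y) (Ioi 0) y :=
    fun y _ => by simpa using (((hasDerivAt_id y).const_add 1).const_mul t).hasDerivWithinAt
  have hinj : InjOn (fun y : ℝ => t * (1 + y)) (Ioi 0) := fun a _ b _ h =>
    add_left_cancel (mul_left_cancel₀ ht.ne' h)
  have e : EqOn (fun y : ℝ => t ^ (1 + α + μ) * (y ^ α * (1 + y) ^ μ * Real.exp (-(t * (1 + y)))))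
      (fun y => |t| • ((t * (1 + y) - t) ^ α * (t * (1 + y)) ^ μ * Real.exp (-(t * (1 + y)))))
      (Ioi 0) := by
    intro y (hy : 0 < y)
    have h1 : 0 ≤ 1 + y := by linarith
    simp only [smul_eq_mul, abs_of_pos ht]
    rw [show t * (1 + y) - t = t * y by ring, Real.mul_rpow ht.le h1, Real.mul_rpow ht.le hy.le,
      Real.rpow_add ht, Real.rpow_add ht, Real.rpow_one]
    ring
  constructor
  · rw [← himg, integrableOn_image_iff_integrableOn_abs_deriv_smul measurableSet_Ioi hd hinj]
    exact IntegrableOn.congr_fun ((integrable_outer hα μ ht).const_mul _) e measurableSet_Ioi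
  · rw [← himg, integral_image_eq_integral_abs_deriv_smul measurableSet_Ioi hd hinj,
      ← setIntegral_congr_fun measurableSet_Ioi e, integral_const_mul, outerIntegral]

/-- The moments of the deformed Laguerre weight. -/
def laguerreMoment (ζ α μ : ℝ) (ω : ℂ) (t : ℝ) (k : ℕ) : ℂ :=
  ((t ^ (1 + α + μ + k) : ℝ) : ℂ)
    * (ω * (innerIntegral α (μ + k) t : ℝ) + (1 - ζ) * (outerIntegral α (μ + k) t : ℝ))

section

variable {ζ α μ : ℝ} {ω : ℂ} {t : ℝ}

lemma deformedLaguerre_moment (hα : -1 < α) (hμ : -1 < μ) (ht : 0 < t) (k : ℕ) :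
    IntegrableOn (fun x : ℝ => (x : ℂ) ^ k * deformedLaguerreWeight ζ α μ ω t x) (Ioi 0) ∧
      ∫ x in Ioi (0 : ℝ), (x : ℂ) ^ k * deformedLaguerreWeight ζ α μ ω t x
        = laguerreMoment ζ α μ ω t k := by
  have hk : (0 : ℝ) ≤ k := Nat.cast_nonneg k
  obtain ⟨i1, v1⟩ := inner_change_of_variables hα (by linarith : -1 < μ + k) ht
  obtain ⟨i2, v2⟩ := outer_change_of_variables hα (μ + k) ht
  have e1 : EqOn (fun x : ℝ => ω * (((t - x) ^ α * x ^ (μ + k) * Real.exp (-x) : ℝ) : ℂ))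
      (fun x : ℝ => (x : ℂ) ^ k * deformedLaguerreWeight ζ α μ ω t x) (Ioo 0 t) := by
    intro x hx
    have h1 : ¬ (0 < x - t) := by linarith [hx.2]
    have h2 : ¬ (0 ≤ x - t) := by linarith [hx.2]
    simp only [deformedLaguerreWeight, heaviside, branchPow, if_neg h1, if_neg h2, neg_sub,
      Real.rpow_add hx.1, Real.rpow_natCast]
    push_cast; ring
  have e2 : EqOn (fun x : ℝ => (1 - ζ : ℂ) * (((x - t) ^ α * x ^ (μ + k) * Real.exp (-x) : ℝ) : ℂ))
      (fun x : ℝ => (x : ℂ) ^ k * deformedLaguerreWeight ζ α μ ω t x) (Ioi t) := by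
    intro x (hx : t < x)
    have h1 : 0 < x - t := by linarith
    simp only [deformedLaguerreWeight, heaviside, branchPow, if_pos h1, if_pos h1.le,
      Real.rpow_add (ht.trans hx), Real.rpow_natCast]
    push_cast; ring
  have j1 := IntegrableOn.congr_fun ((Integrable.ofReal (𝕜 := ℂ) i1).const_mul ω) e1 measurableSet_Ioo
  have j2 := IntegrableOn.congr_fun ((Integrable.ofReal (𝕜 := ℂ) i2).const_mul (1 - ζ : ℂ)) e2
    measurableSet_Ioi
  -- The single point `x = t` is null, so the conventions for the Heaviside function and for powers
  -- of `0` there play no role.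
  have j1' := (integrableOn_Ioc_iff_integrableOn_Ioo enorm_ne_top).2 j1
  rw [← Ioc_union_Ioi_eq_Ioi ht.le]
  refine ⟨j1'.union j2, ?_⟩
  rw [setIntegral_union Ioc_disjoint_Ioi_same measurableSet_Ioi j1' j2, integral_Ioc_eq_integral_Ioo,
    ← setIntegral_congr_fun measurableSet_Ioo e1, ← setIntegral_congr_fun measurableSet_Ioi e2,
    integral_const_mul, integral_const_mul, integral_complex_ofReal, integral_complex_ofReal,
    v1, v2, laguerreMoment, show 1 + α + (μ + k) = 1 + α + μ + k by ring]
  push_cast; ring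

lemma deformedLaguerre_functional (hα : -1 < α) (hμ : -1 < μ) (ht : 0 < t) (f : ℂ[X]) :
    IntegrableOn (fun x : ℝ => f.eval (x : ℂ) * deformedLaguerreWeight ζ α μ ω t x) (Ioi 0) ∧
      ∫ x in Ioi (0 : ℝ), f.eval (x : ℂ) * deformedLaguerreWeight ζ α μ ω t x
        = momentFunctional (laguerreMoment ζ α μ ω t) f := by
  induction f using Polynomial.induction_on' with
  | add p q hp hq =>
    simp only [eval_add, add_mul, map_add]
    exact ⟨hp.1.add hq.1, by rw [integral_add hp.1 hq.1, hp.2, hq.2]⟩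
  | monomial k c =>
    obtain ⟨h1, h2⟩ := deformedLaguerre_moment (ζ := ζ) (ω := ω) hα hμ ht k
    simp only [eval_monomial, mul_assoc, momentFunctional_monomial]
    exact ⟨h1.const_mul c, by rw [integral_const_mul, h2, mul_comm]⟩

lemma momentFlowAt_laguerreMoment (hα : -1 < α) (hμ : -1 < μ) (ht : 0 < t) :
    MomentFlowAt (1 + α + μ) (laguerreMoment ζ α μ ω) t := by
  intro k
  have hk : (0 : ℝ) ≤ k := Nat.cast_nonneg k
  have d1 := (hasDerivAt_inner hα (by linarith : -1 < μ + k) t).ofReal_comp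
  have d2 := (hasDerivAt_outer hα (μ + k) ht).ofReal_comp
  have d3 := (Real.hasDerivAt_rpow_const (x := t) (p := 1 + α + μ + k) (Or.inl ht.ne')).ofReal_comp
  refine HasDerivAt.congr_deriv (d3.mul ((d1.const_mul ω).add (d2.const_mul (1 - ζ : ℂ)))) ?_
  have ht' : (t : ℂ) ≠ 0 := by exact_mod_cast ht.ne'
  have e1 : t ^ (1 + α + μ + k) = t ^ (1 + α + μ + k - 1) * t := by
    rw [Real.rpow_sub_one ht.ne']; field_simp
  have e2 : t ^ (1 + α + μ + k + 1) = t ^ (1 + α + μ + k - 1) * t * t := by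
    rw [← e1, ← Real.rpow_add_one ht.ne']
  simp only [laguerreMoment, Nat.cast_add, Nat.cast_one, ← add_assoc, e2, e1]
  push_cast
  field_simp
  ring

lemma pearsonRelation_laguerreMoment (hα : -1 < α) (hμ : -1 < μ) (ht : 0 < t) :
    PearsonRelation α μ t (laguerreMoment ζ α μ ω t) := by
  intro k
  have hk : (0 : ℝ) ≤ k := Nat.cast_nonneg k
  have r1 := innerIntegral_relation hα (by linarith : -1 < μ + k) t
  have r2 := outerIntegral_relation hα (μ + k) ht
  have r1' : (t : ℂ) * (innerIntegral α (μ + k + 2) t : ℝ)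
      = (2 + α + (μ + k) + t) * (innerIntegral α (μ + k + 1) t : ℝ)
        - (1 + (μ + k)) * (innerIntegral α (μ + k) t : ℝ) := by exact_mod_cast r1
  have r2' : (t : ℂ) * (outerIntegral α (μ + k + 2) t : ℝ)
      = (2 + α + (μ + k) + t) * (outerIntegral α (μ + k + 1) t : ℝ)
        - (1 + (μ + k)) * (outerIntegral α (μ + k) t : ℝ) := by exact_mod_cast r2
  have e1 : t ^ (1 + α + μ + k + 1) = t ^ (1 + α + μ + k) * t := by
    rw [← Real.rpow_add_one ht.ne']
  have e2 : t ^ (1 + α + μ + k + 2) = t ^ (1 + α + μ + k) * t * t := by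
    rw [← e1, ← Real.rpow_add_one ht.ne']; ring_nf
  simp only [laguerreMoment, Nat.cast_add, Nat.cast_one, Nat.cast_ofNat, ← add_assoc, e2, e1]
  push_cast
  linear_combination ((t ^ (1 + α + μ + k) : ℝ) : ℂ) * t * (ω * r1' + (1 - ζ) * r2')

end


/-! ### Kummer functions. -/

/-- The entire function `∑ g i (-z) ^ i / i!`. -/
def expGen (g : ℕ → ℂ) (z : ℂ) : ℂ := ∑' i : ℕ, g i * ((-z) ^ i / i.factorial)

lemma summable_expGen {g : ℕ → ℂ} {K C : ℝ} (hg : ∀ i, ‖g i‖ ≤ K * C ^ i) (z : ℂ) :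
    Summable fun i : ℕ => g i * ((-z) ^ i / i.factorial) := by
  refine Summable.of_norm_bounded ((Real.summable_pow_div_factorial (C * ‖z‖)).mul_left K) fun i => ?_
  rw [norm_mul, norm_div, norm_pow, norm_neg, Complex.norm_natCast, mul_pow]
  calc ‖g i‖ * (‖z‖ ^ i / i.factorial) ≤ (K * C ^ i) * (‖z‖ ^ i / i.factorial) :=
        mul_le_mul_of_nonneg_right (hg i) (by positivity)
    _ = _ := by ring

lemma hasDerivAt_expGen {g : ℕ → ℂ} {K C : ℝ} (hg : ∀ i, ‖g i‖ ≤ K * C ^ i) (z : ℂ) :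
    HasDerivAt (expGen g) (-expGen (fun i => g (i + 1)) z) z := by
  have hg' : ∀ i, ‖g (i + 1)‖ ≤ K * C * C ^ i := fun i => (hg _).trans_eq (by ring)
  have hs := summable_expGen hg'
  set R := ‖z‖ + 1
  have hR : (0 : ℝ) < R := by positivity
  have h := hasDerivAt_tsum_of_isPreconnected (𝕜 := ℂ) (t := Metric.ball (0 : ℂ) R)
    (g := fun (i : ℕ) z => g i * ((-z) ^ i / i.factorial))
    (g' := fun (i : ℕ) z => g i * ((i * (-z) ^ (i - 1) * (-1)) / i.factorial))
    (u := fun i => ‖g i‖ * ((i * R ^ (i - 1)) / i.factorial)) ?_ Metric.isOpen_ball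
    (convex_ball _ _).isPreconnected (fun i y _ => ?_) (fun i y hy => ?_)
    (Metric.mem_ball_self hR) (summable_expGen hg 0) (y := z) (by simp [R])
  · refine HasDerivAt.congr_deriv h ?_
    have hsum : Summable fun i : ℕ => g i * ((i * (-z) ^ (i - 1) * (-1)) / i.factorial) := by
      rw [← summable_nat_add_iff 1]
      refine (hs z).neg.congr fun i => ?_
      simp only [Nat.add_sub_cancel, Nat.factorial_succ]
      push_cast
      have : (i.factorial : ℂ) ≠ 0 := by exact_mod_cast i.factorial_ne_zero
      have h2 : (i + 1 : ℂ) ≠ 0 := by exact_mod_cast i.succ_ne_zero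
      field_simp
    rw [hsum.tsum_eq_zero_add, expGen, ← tsum_neg]
    simp only [Nat.cast_zero, zero_mul, zero_div, mul_zero, zero_add]
    refine tsum_congr fun i => ?_
    simp only [Nat.add_sub_cancel, Nat.factorial_succ]
    push_cast
    have : (i.factorial : ℂ) ≠ 0 := by exact_mod_cast i.factorial_ne_zero
    have h2 : (i + 1 : ℂ) ≠ 0 := by exact_mod_cast i.succ_ne_zero
    field_simp
  · rw [← summable_nat_add_iff 1]
    refine (hs (R : ℂ)).norm.congr fun i => ?_
    simp only [Nat.add_sub_cancel, Nat.factorial_succ, norm_mul, norm_div, norm_pow, norm_neg,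
      Complex.norm_real, Real.norm_of_nonneg hR.le, Complex.norm_natCast]
    push_cast
    field_simp
  · have h1 : HasDerivAt (fun z : ℂ => (-z) ^ i) (i * (-y) ^ (i - 1) * (-1)) y :=
      (hasDerivAt_neg y).pow i
    exact (h1.div_const _).const_mul _
  · simp only [norm_mul, norm_div, norm_pow, norm_neg, Complex.norm_natCast, norm_one, mul_one]
    have hy' : ‖y‖ ≤ R := by simpa using (Metric.mem_ball.1 hy).le
    gcongr

lemma expGen_zero (g : ℕ → ℂ) : expGen g 0 = g 0 := by
  rw [expGen, tsum_eq_single 0]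
  · simp
  · intro i hi; simp [hi]

/-- The ratios `(γ)_i / (β)_i` of Pochhammer symbols. -/
def kummerRatio (β γ : ℝ) (i : ℕ) : ℝ := ∏ l ∈ Finset.range i, (γ + l) / (β + l)

lemma kummerRatio_succ {β : ℝ} (hβ : 0 < β) (γ : ℝ) (i : ℕ) :
    kummerRatio β γ (i + 1) * (β + i) = kummerRatio β γ i * (γ + i) := by
  have : β + i ≠ 0 := by positivity
  rw [kummerRatio, Finset.prod_range_succ, ← kummerRatio]
  field_simp

lemma abs_kummerRatio_le {β : ℝ} (hβ : 0 < β) (γ : ℝ) (i : ℕ) :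
    |kummerRatio β γ i| ≤ (1 + |γ| / β) ^ i := by
  rw [kummerRatio, Finset.abs_prod]
  calc ∏ l ∈ Finset.range i, |(γ + l) / (β + l)| ≤ ∏ l ∈ Finset.range i, (1 + |γ| / β) := by
        refine Finset.prod_le_prod (fun _ _ => abs_nonneg _) fun l _ => ?_
        have hl : (0 : ℝ) ≤ l := Nat.cast_nonneg l
        rw [abs_div, abs_of_pos (by positivity : 0 < β + l), div_le_iff₀ (by positivity)]
        have h1 : |γ + l| ≤ |γ| + l := by
          simpa [abs_of_nonneg hl] using abs_add_le γ (l : ℝ)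
        have h2 : (1 + |γ| / β) * (β + l) = β + l + |γ| + |γ| / β * l := by field_simp; ring
        have h3 : 0 ≤ |γ| / β * l := by positivity
        linarith
    _ = _ := by simp

/-- The `j`-th derivative, up to the sign `(-1) ^ j`, of the Kummer function `₁F₁(γ; β; -z)`. -/
def kummer (β γ : ℝ) (j : ℕ) (z : ℂ) : ℂ := expGen (fun i => (kummerRatio β γ (i + j) : ℝ)) z

section

variable {β : ℝ} (hβ : 0 < β) (γ : ℝ) (j : ℕ)
include hβ

lemma norm_kummerRatio_add_le (i : ℕ) :
    ‖((kummerRatio β γ (i + j) : ℝ) : ℂ)‖ ≤ (1 + |γ| / β) ^ j * (1 + |γ| / β) ^ i := by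
  rw [Complex.norm_real, Real.norm_eq_abs, ← pow_add, add_comm j]
  exact abs_kummerRatio_le hβ γ _

lemma hasDerivAt_kummer (z : ℂ) : HasDerivAt (kummer β γ j) (-kummer β γ (j + 1) z) z := by
  have h := hasDerivAt_expGen (norm_kummerRatio_add_le hβ γ j) z
  simp only [show ∀ i, i + 1 + j = i + (j + 1) from fun i => by ring] at h
  exact h

omit hβ in
lemma kummer_at_zero : kummer β γ j 0 = kummerRatio β γ j := by
  rw [kummer, expGen_zero, zero_add]

/-- Kummer's equation differentiated `j` times. On coefficients it is `kummerRatio_succ`: the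
combination in `e` carries a factor `i`, which shifts the exponential series by one and yields the
factor `-z`. -/
lemma kummer_relation (z : ℂ) :
    z * kummer β γ (j + 2) z = (β + j + z) * kummer β γ (j + 1) z - (γ + j) * kummer β γ j z := by
  have s0 := summable_expGen (norm_kummerRatio_add_le hβ γ j) z
  have s1 := summable_expGen (norm_kummerRatio_add_le hβ γ (j + 1)) z
  have s2 := summable_expGen (norm_kummerRatio_add_le hβ γ (j + 2)) z
  have e : ∀ i : ℕ, (β + j : ℂ) * ((kummerRatio β γ (i + (j + 1)) : ℝ) * ((-z) ^ i / i.factorial))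
      - (γ + j) * ((kummerRatio β γ (i + j) : ℝ) * ((-z) ^ i / i.factorial))
      = i * ((kummerRatio β γ (i + j) : ℝ) - (kummerRatio β γ (i + (j + 1)) : ℝ))
        * ((-z) ^ i / i.factorial) := by
    intro i
    have h := kummerRatio_succ hβ γ (i + j)
    have h' : ((kummerRatio β γ (i + (j + 1)) : ℝ) : ℂ) * (β + (i + j))
        = (kummerRatio β γ (i + j) : ℝ) * (γ + (i + j)) := by
      rw [← add_assoc i j 1]; exact_mod_cast h
    linear_combination ((-z) ^ i / i.factorial) * h'
  have hs := (s1.mul_left (β + j : ℂ)).sub (s0.mul_left (γ + j : ℂ))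
  have h1 : (β + j) * kummer β γ (j + 1) z - (γ + j) * kummer β γ j z
      = -z * (kummer β γ (j + 1) z - kummer β γ (j + 2) z) := by
    simp only [kummer, expGen]
    rw [← tsum_mul_left, ← tsum_mul_left, ← (s1.mul_left (β + j : ℂ)).tsum_sub
      (s0.mul_left (γ + j : ℂ)), hs.tsum_eq_zero_add, ← s1.tsum_sub s2, ← tsum_mul_left, e 0]
    simp only [Nat.cast_zero, zero_mul, zero_add]
    refine tsum_congr fun i => ?_
    rw [e, Nat.factorial_succ, show i + 1 + j = i + (j + 1) by ring,
      show i + 1 + (j + 1) = i + (j + 2) by ring]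
    push_cast
    have : (i.factorial : ℂ) ≠ 0 := by exact_mod_cast i.factorial_ne_zero
    have h2 : (i + 1 : ℂ) ≠ 0 := by exact_mod_cast i.succ_ne_zero
    field_simp
    ring
  linear_combination -h1

lemma analyticAt_kummer (t : ℝ) : AnalyticAt ℝ (fun x : ℝ => kummer β γ j x) t := by
  have h : Differentiable ℂ (kummer β γ j) := fun z => (hasDerivAt_kummer hβ γ j z).differentiableAt
  have h1 : AnalyticAt ℝ (kummer β γ j) (t : ℂ) := (h.analyticAt (t : ℂ)).restrictScalars
  exact h1.comp_of_eq (Complex.ofRealCLM.analyticAt t) rfl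

lemma hasDerivAt_kummer_real (t : ℝ) :
    HasDerivAt (fun x : ℝ => kummer β γ j x) (-kummer β γ (j + 1) t) t :=
  (hasDerivAt_kummer hβ γ j (t : ℂ)).comp_ofReal

end

/-! ### Values and limits of the two integrals at `t = 0`. -/

lemma innerIntegral_zero {α μ : ℝ} (hα : -1 < α) (hμ : -1 < μ) :
    innerIntegral α μ 0 = Real.Gamma (α + 1) * Real.Gamma (μ + 1) / Real.Gamma (α + μ + 2) := by
  have h := Complex.betaIntegral_eq_Gamma_mul_div ((μ + 1 : ℝ) : ℂ) ((α + 1 : ℝ) : ℂ)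
    (by simp; linarith) (by simp; linarith)
  rw [Complex.betaIntegral, intervalIntegral.integral_of_le zero_le_one,
    integral_Ioc_eq_integral_Ioo, ← Complex.ofReal_add, Complex.Gamma_ofReal, Complex.Gamma_ofReal,
    Complex.Gamma_ofReal] at h
  have e : EqOn (fun y : ℝ => (((1 - y) ^ α * y ^ μ * Real.exp (-(0 * y)) : ℝ) : ℂ))
      (fun y : ℝ => (y : ℂ) ^ (((μ + 1 : ℝ) : ℂ) - 1) * (1 - (y : ℂ)) ^ (((α + 1 : ℝ) : ℂ) - 1))
      (Ioo 0 1) := by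
    intro y hy
    have h1 : (0 : ℝ) ≤ 1 - y := by linarith [hy.2]
    simp only
    rw [show ((μ + 1 : ℝ) : ℂ) - 1 = (μ : ℝ) by push_cast; ring,
      show ((α + 1 : ℝ) : ℂ) - 1 = (α : ℝ) by push_cast; ring,
      show (1 : ℂ) - y = ((1 - y : ℝ) : ℂ) by push_cast; ring, ← Complex.ofReal_cpow hy.1.le,
      ← Complex.ofReal_cpow h1]
    simp [mul_comm]
  rw [← setIntegral_congr_fun measurableSet_Ioo e, integral_complex_ofReal] at h
  rw [innerIntegral]
  have h2 : μ + 1 + (α + 1) = α + μ + 2 := by ring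
  rw [h2] at h
  rw [mul_comm (Real.Gamma (α + 1))]
  exact_mod_cast h

/-- The substitution `z = y / (1 - y)` turns the integral over the half line into a Beta integral.
-/
lemma outer_zero_eq {α μ : ℝ} :
    (IntegrableOn (fun z : ℝ => z ^ α * (1 + z) ^ μ) (Ioi 0) ↔
      IntegrableOn (fun y : ℝ => (1 - y) ^ (-2 - α - μ) * y ^ α) (Ioo 0 1)) ∧
    ∫ z in Ioi (0 : ℝ), z ^ α * (1 + z) ^ μ
      = ∫ y in Ioo (0 : ℝ) 1, (1 - y) ^ (-2 - α - μ) * y ^ α := by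
  have himg : (fun y : ℝ => y / (1 - y)) '' Ioo 0 1 = Ioi 0 := by
    ext x
    simp only [mem_image, mem_Ioi, mem_Ioo]
    constructor
    · rintro ⟨y, ⟨h0, h1⟩, rfl⟩; exact div_pos h0 (by linarith)
    · intro hx
      refine ⟨x / (1 + x), ⟨by positivity, by rw [div_lt_one (by positivity)]; linarith⟩, ?_⟩
      field_simp; ring
  have hd : ∀ y ∈ Ioo (0 : ℝ) 1, HasDerivWithinAt (fun y : ℝ => y / (1 - y))
      ((fun y => 1 / (1 - y) ^ 2) y) (Ioo 0 1) y := by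
    intro y hy
    have h1 : 1 - y ≠ 0 := by linarith [hy.2]
    have h := (hasDerivAt_id y).div ((hasDerivAt_id y).const_sub 1) h1
    refine HasDerivAt.hasDerivWithinAt (HasDerivAt.congr_deriv h ?_)
    simp
  have hinj : InjOn (fun y : ℝ => y / (1 - y)) (Ioo 0 1) := by
    intro a ha b hb h
    have h1 : 1 - a ≠ 0 := by linarith [ha.2]
    have h2 : 1 - b ≠ 0 := by linarith [hb.2]
    simp only at h
    rw [div_eq_div_iff h1 h2] at h
    linarith
  have e : EqOn (fun y : ℝ => |1 / (1 - y) ^ 2| • ((y / (1 - y)) ^ α * (1 + y / (1 - y)) ^ μ))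
      (fun y : ℝ => (1 - y) ^ (-2 - α - μ) * y ^ α) (Ioo 0 1) := by
    intro y hy
    have h1 : 0 < 1 - y := by linarith [hy.2]
    have h2 : 1 + y / (1 - y) = (1 - y)⁻¹ := by field_simp; ring
    simp only [smul_eq_mul]
    rw [h2, abs_of_pos (by positivity), Real.div_rpow hy.1.le h1.le, Real.inv_rpow h1.le,
      Real.rpow_sub h1, Real.rpow_sub h1, Real.rpow_neg h1.le, Real.rpow_two]
    field_simp
  rw [← himg, integrableOn_image_iff_integrableOn_abs_deriv_smul measurableSet_Ioo hd hinj,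
    integral_image_eq_integral_abs_deriv_smul measurableSet_Ioo hd hinj]
  exact ⟨integrableOn_congr_fun e measurableSet_Ioo, setIntegral_congr_fun measurableSet_Ioo e⟩

/-- The limit at `0` of `outerIntegral` when the integral converges there. -/
lemma tendsto_outer_zero {α μ : ℝ} (hα : -1 < α) (hs : α + μ < -1) :
    Tendsto (outerIntegral α μ) (𝓝[>] 0)
      (𝓝 (Real.Gamma (α + 1) * Real.Gamma (-1 - α - μ) / Real.Gamma (-μ))) := by
  obtain ⟨h1, h2⟩ := outer_zero_eq (α := α) (μ := μ)
  have hi := h1.2 (integrable_inner_zero (by linarith) hα)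
  have hv : ∫ z in Ioi (0 : ℝ), z ^ α * (1 + z) ^ μ
      = Real.Gamma (α + 1) * Real.Gamma (-1 - α - μ) / Real.Gamma (-μ) := by
    rw [h2]
    have := innerIntegral_zero (α := -2 - α - μ) (μ := α) (by linarith) hα
    rw [innerIntegral] at this
    simp only [zero_mul, neg_zero, Real.exp_zero, mul_one] at this
    rw [this, show -2 - α - μ + 1 = -1 - α - μ by ring, show -2 - α - μ + α + 2 = -μ by ring]
    ring
  rw [← hv]
  refine tendsto_integral_filter_of_dominated_convergence (fun z => z ^ α * (1 + z) ^ μ)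
    (Eventually.of_forall fun t => by fun_prop) ?_ hi ?_
  · filter_upwards [self_mem_nhdsWithin] with t (ht : 0 < t)
    rw [ae_restrict_iff' measurableSet_Ioi]
    refine Eventually.of_forall fun z (hz : 0 < z) => ?_
    rw [Real.norm_of_nonneg (by positivity)]
    refine mul_le_of_le_one_right (by positivity) (Real.exp_le_one_iff.2 ?_)
    have : 0 ≤ t * (1 + z) := by positivity
    linarith
  · refine Eventually.of_forall fun z => ?_
    have : Tendsto (fun t : ℝ => z ^ α * (1 + z) ^ μ * Real.exp (-(t * (1 + z)))) (𝓝 0)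
        (𝓝 (z ^ α * (1 + z) ^ μ * Real.exp (-(0 * (1 + z))))) :=
      Continuous.tendsto (by fun_prop) 0
    simpa using this.mono_left nhdsWithin_le_nhds

/-- The leading behaviour of `outerIntegral` at `0` when the integral diverges there. -/
lemma tendsto_rpow_mul_outer {α μ : ℝ} (hα : -1 < α) (hs : -1 < α + μ) :
    Tendsto (fun t => t ^ (1 + α + μ) * outerIntegral α μ t) (𝓝[>] 0)
      (𝓝 (Real.Gamma (α + μ + 1))) := by
  have e : ∀ t : ℝ, 0 < t → t ^ (1 + α + μ) * outerIntegral α μ t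
      = ∫ x in Ioi (0 : ℝ), x ^ α * (t + x) ^ μ * Real.exp (-(t + x)) := by
    intro t ht
    have h := integral_comp_mul_left_Ioi (fun x : ℝ => x ^ α * (t + x) ^ μ * Real.exp (-(t + x))) 0 ht
    rw [mul_zero] at h
    rw [eq_comm, inv_smul_eq_iff₀ ht.ne'] at h
    rw [h, outerIntegral, ← integral_const_mul, ← integral_smul]
    refine setIntegral_congr_fun measurableSet_Ioi fun z (hz : 0 < z) => ?_
    simp only [smul_eq_mul]
    rw [show t + t * z = t * (1 + z) by ring, Real.mul_rpow ht.le hz.le,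
      Real.mul_rpow ht.le (by linarith), Real.rpow_add ht, Real.rpow_add ht, Real.rpow_one]
    ring
  rw [Real.Gamma_eq_integral (by linarith)]
  -- For `0 < t < 1`, `(t + x) ^ μ` is at most `(1 + x) ^ μ` when `0 ≤ μ` and at most `x ^ μ` when
  -- `μ < 0`; the sum of the two majorants covers both cases.
  have i1 := (integrable_outer hα μ one_pos).const_mul (Real.exp 1)
  have i2 : IntegrableOn (fun x : ℝ => x ^ (α + μ) * Real.exp (-x)) (Ioi 0) := by
    simpa using integrableOn_rpow_mul_exp_neg_rpow (p := 1) hs one_pos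
  refine Tendsto.congr' (f₁ := fun t => ∫ x in Ioi (0 : ℝ), x ^ α * (t + x) ^ μ * Real.exp (-(t + x)))
    (by filter_upwards [self_mem_nhdsWithin] with t ht using (e t ht).symm) ?_
  refine tendsto_integral_filter_of_dominated_convergence _
    (Eventually.of_forall fun t => by fun_prop) ?_ (i1.add i2) ?_
  · filter_upwards [Ioo_mem_nhdsGT (zero_lt_one' ℝ)] with t ht
    rw [ae_restrict_iff' measurableSet_Ioi]
    refine Eventually.of_forall fun z (hz : 0 < z) => ?_
    have ht0 := ht.1
    rw [Real.norm_of_nonneg (by positivity)]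
    have hexp : Real.exp (-(t + z)) ≤ Real.exp (-z) := Real.exp_le_exp.2 (by linarith)
    have e1 : Real.exp 1 * (z ^ α * (1 + z) ^ μ * Real.exp (-(1 * (1 + z))))
        = z ^ α * (1 + z) ^ μ * Real.exp (-z) := by
      rw [show -z = 1 + -(1 * (1 + z)) by ring, Real.exp_add]; ring
    simp only [Pi.add_apply, e1]
    rcases le_or_gt 0 μ with hμ | hμ
    · have : (t + z) ^ μ ≤ (1 + z) ^ μ := by
        have := ht.2
        gcongr
      calc z ^ α * (t + z) ^ μ * Real.exp (-(t + z)) ≤ z ^ α * (1 + z) ^ μ * Real.exp (-z) := by gcongr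
        _ ≤ _ := le_add_of_nonneg_right (by positivity)
    · have : (t + z) ^ μ ≤ z ^ μ :=
        Real.rpow_le_rpow_of_nonpos hz (by linarith) hμ.le
      calc z ^ α * (t + z) ^ μ * Real.exp (-(t + z)) ≤ z ^ α * z ^ μ * Real.exp (-z) := by gcongr
        _ = z ^ (α + μ) * Real.exp (-z) := by rw [Real.rpow_add hz]
        _ ≤ _ := le_add_of_nonneg_left (by positivity)
  · rw [ae_restrict_iff' measurableSet_Ioi]
    refine Eventually.of_forall fun z (hz : 0 < z) => ?_
    have h1 : ContinuousAt (fun t : ℝ => z ^ α * (t + z) ^ μ * Real.exp (-(t + z))) 0 := by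
      refine ContinuousAt.mul (ContinuousAt.mul continuousAt_const ?_) (by fun_prop)
      exact ContinuousAt.rpow_const (by fun_prop) (Or.inl (by simpa using hz.ne'))
    have h2 : z ^ α * (0 + z) ^ μ * Real.exp (-(0 + z)) = Real.exp (-z) * z ^ (α + μ + 1 - 1) := by
      rw [zero_add, add_sub_cancel_right, Real.rpow_add hz]; ring
    rw [← h2]
    exact h1.tendsto.mono_left nhdsWithin_le_nhds


/-! ### The connection formula for the outer integral. -/

/-- Sequences of functions with `f j' = - f (j+1)` whose first member solves Kummer's equation
`t f'' + (β + t) f' + γ f = 0` on `(0, ∞)`. -/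
structure IsKummerFamily (β γ : ℝ) (f : ℕ → ℝ → ℂ) : Prop where
  hasDerivAt : ∀ j, ∀ t : ℝ, 0 < t → HasDerivAt (f j) (-f (j + 1) t) t
  relation : ∀ t : ℝ, 0 < t → (t : ℂ) * f 2 t = (β + t) * f 1 t - γ * f 0 t

lemma IsKummerFamily.sub_const_mul {β γ : ℝ} {f g : ℕ → ℝ → ℂ} (hf : IsKummerFamily β γ f)
    (hg : IsKummerFamily β γ g) (c : ℂ) : IsKummerFamily β γ (fun j t => f j t - c * g j t) where
  hasDerivAt j t ht := by
    refine HasDerivAt.congr_deriv ((hf.hasDerivAt j t ht).sub ((hg.hasDerivAt j t ht).const_mul c)) ?_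
    ring
  relation t ht := by linear_combination hf.relation t ht - c * hg.relation t ht

/-- Abel's formula for the Wronskian. -/
lemma IsKummerFamily.wronskian {β γ : ℝ} {f g : ℕ → ℝ → ℂ} (hf : IsKummerFamily β γ f)
    (hg : IsKummerFamily β γ g) : ∃ c : ℂ, ∀ t : ℝ, 0 < t →
      ((t ^ β * Real.exp t : ℝ) : ℂ) * (f 1 t * g 0 t - f 0 t * g 1 t) = c := by
  have hd : ∀ t ∈ Ioi (0 : ℝ), HasDerivAt (fun t : ℝ => ((t ^ β * Real.exp t : ℝ) : ℂ)
      * (f 1 t * g 0 t - f 0 t * g 1 t)) 0 t := by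
    intro t (ht : 0 < t)
    have h1 := (((Real.hasDerivAt_rpow_const (p := β) (Or.inl ht.ne')).mul
      (Real.hasDerivAt_exp t)).ofReal_comp)
    have h2 := ((hf.hasDerivAt 1 t ht).mul (hg.hasDerivAt 0 t ht)).sub
      ((hf.hasDerivAt 0 t ht).mul (hg.hasDerivAt 1 t ht))
    refine HasDerivAt.congr_deriv (h1.mul h2) ?_
    have e1 : t ^ β = t ^ (β - 1) * t := by rw [Real.rpow_sub_one ht.ne']; field_simp
    simp only [Pi.mul_apply, e1]
    push_cast
    linear_combination ((t ^ (β - 1) : ℝ) : ℂ) * Complex.exp t * (g 0 t * (-hf.relation t ht)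
      + f 0 t * hg.relation t ht)
  obtain ⟨c, hc⟩ := isOpen_Ioi.exists_is_const_of_deriv_eq_zero (isPreconnected_Ioi (a := (0 : ℝ)))
    (fun t ht => (hd t ht).differentiableAt.differentiableWithinAt) (fun t ht => (hd t ht).deriv)
  exact ⟨c, fun t ht => hc t ht⟩

lemma isKummerFamily_kummer {β : ℝ} (hβ : 0 < β) (γ : ℝ) :
    IsKummerFamily β γ (fun j t => kummer β γ j t) where
  hasDerivAt j t _ := hasDerivAt_kummer_real hβ γ j t
  relation t _ := by simpa using kummer_relation hβ γ 0 (t : ℂ)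

/-- `outerIntegral_relation` is Kummer's equation with `β = 2 + α + μ`, `γ = 1 + μ`; the solution is
essentially Tricomi's function. -/
lemma isKummerFamily_outer {α : ℝ} (hα : -1 < α) (μ : ℝ) :
    IsKummerFamily (2 + α + μ) (1 + μ) (fun j t => (outerIntegral α (μ + j) t : ℝ)) where
  hasDerivAt j t ht := by
    have := (hasDerivAt_outer hα (μ + j) ht).ofReal_comp
    rw [add_assoc] at this
    simpa using this
  relation t ht := by
    have := outerIntegral_relation hα μ ht
    simp only [Nat.cast_ofNat, Nat.cast_one, Nat.cast_zero, add_zero]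
    exact_mod_cast this

/-- The functions `B j` with `(t ^ (-1-s) B 0)^{(j)} = (-1) ^ j t ^ (-1-s-j) B j`. -/
def shiftedSeq (s : ℝ) (a : ℝ → ℂ) : ℕ → ℝ → ℂ
  | 0 => a
  | j + 1 => fun t => (1 + s + j) * shiftedSeq s a j t - t * deriv (shiftedSeq s a j) t

lemma analyticAt_shiftedSeq (s : ℝ) {a : ℝ → ℂ} (ha : ∀ t, AnalyticAt ℝ a t) (j : ℕ) (t : ℝ) :
    AnalyticAt ℝ (shiftedSeq s a j) t := by
  induction j generalizing t with
  | zero => exact ha t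
  | succ j ih =>
    exact (analyticAt_const.mul (ih t)).sub ((Complex.ofRealCLM.analyticAt t).mul (ih t).deriv)

lemma hasDerivAt_shiftedSeq (s : ℝ) {a : ℝ → ℂ} (ha : ∀ t, AnalyticAt ℝ a t) (j : ℕ) {t : ℝ}
    (ht : t ≠ 0) : HasDerivAt (shiftedSeq s a j)
      (((1 + s + j) * shiftedSeq s a j t - shiftedSeq s a (j + 1) t) / t) t := by
  refine HasDerivAt.congr_deriv (analyticAt_shiftedSeq s ha j t).differentiableAt.hasDerivAt ?_
  have ht' : (t : ℂ) ≠ 0 := by exact_mod_cast ht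
  rw [shiftedSeq]; field_simp; ring

lemma hasDerivAt_rpow_mul_shiftedSeq (s : ℝ) {a : ℝ → ℂ} (ha : ∀ t, AnalyticAt ℝ a t) (j : ℕ)
    {t : ℝ} (ht : 0 < t) :
    HasDerivAt (fun t : ℝ => ((t ^ (-1 - s - j) : ℝ) : ℂ) * shiftedSeq s a j t)
      (-(((t ^ (-1 - s - (j + 1 : ℕ)) : ℝ) : ℂ) * shiftedSeq s a (j + 1) t)) t := by
  have h1 := (Real.hasDerivAt_rpow_const (x := t) (p := -1 - s - j) (Or.inl ht.ne')).ofReal_comp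
  refine HasDerivAt.congr_deriv (h1.mul (hasDerivAt_shiftedSeq s ha j ht.ne')) ?_
  have ht' : (t : ℂ) ≠ 0 := by exact_mod_cast ht.ne'
  have e1 : t ^ (-1 - s - (j : ℝ)) = t ^ (-1 - s - (j : ℝ) - 1) * t := by
    rw [Real.rpow_sub_one ht.ne']; field_simp
  have e2 : -1 - s - ((j + 1 : ℕ) : ℝ) = -1 - s - (j : ℝ) - 1 := by push_cast; ring
  rw [e2, e1]
  push_cast
  field_simp
  ring

/-- The second Frobenius solution `t^(1-β) ₁F₁(γ-β+1; 2-β; -t)` for `β = 2 + α + μ`, `γ = 1 + μ`.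
The hypothesis keeps the lower parameter `-(α + μ)` positive, as `kummer_relation` requires. -/
lemma isKummerFamily_shifted {α μ : ℝ} (hs : α + μ < 0) :
    IsKummerFamily (2 + α + μ) (1 + μ) (fun j t => ((t ^ (-1 - (α + μ) - j) : ℝ) : ℂ)
      * shiftedSeq (α + μ) (fun t => kummer (-(α + μ)) (-α) 0 t) j t) := by
  have hβ : 0 < -(α + μ) := by linarith
  have ha := analyticAt_kummer hβ (-α) 0
  refine ⟨fun j t ht => hasDerivAt_rpow_mul_shiftedSeq (α + μ) ha j ht, fun t ht => ?_⟩
  have hk := fun j (t : ℝ) => hasDerivAt_kummer_real hβ (-α) j t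
  have b1 : ∀ t : ℝ, shiftedSeq (α + μ) (fun t : ℝ => kummer (-(α + μ)) (-α) 0 t) 1 t
      = (1 + (α + μ)) * kummer (-(α + μ)) (-α) 0 t + t * kummer (-(α + μ)) (-α) 1 t := by
    intro t
    simp only [shiftedSeq, (hk 0 t).deriv]; push_cast; ring
  have b2 : shiftedSeq (α + μ) (fun t : ℝ => kummer (-(α + μ)) (-α) 0 t) 2 t
      = (2 + (α + μ)) * ((1 + (α + μ)) * kummer (-(α + μ)) (-α) 0 t + t * kummer (-(α + μ)) (-α) 1 t)
        - t * (-(1 + (α + μ)) * kummer (-(α + μ)) (-α) 1 t + kummer (-(α + μ)) (-α) 1 t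
          - t * kummer (-(α + μ)) (-α) 2 t) := by
    have hd : HasDerivAt (shiftedSeq (α + μ) (fun t : ℝ => kummer (-(α + μ)) (-α) 0 t) 1)
        (-(1 + (α + μ)) * kummer (-(α + μ)) (-α) 1 t + kummer (-(α + μ)) (-α) 1 t
          - t * kummer (-(α + μ)) (-α) 2 t) t := by
      have h := ((hk 0 t).const_mul (1 + (α + μ) : ℂ)).add
        ((Complex.ofRealCLM.hasDerivAt (x := t)).mul (hk 1 t))
      have h' := h.congr_of_eventuallyEq (Eventually.of_forall b1)
      refine HasDerivAt.congr_deriv h' ?_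
      simp; ring
    have e : shiftedSeq (α + μ) (fun t : ℝ => kummer (-(α + μ)) (-α) 0 t) 2 t
      = (1 + ((α + μ : ℝ) : ℂ) + ((1 : ℕ) : ℂ))
          * shiftedSeq (α + μ) (fun t : ℝ => kummer (-(α + μ)) (-α) 0 t) 1 t
        - t * deriv (shiftedSeq (α + μ) (fun t : ℝ => kummer (-(α + μ)) (-α) 0 t) 1) t := rfl
    rw [e, hd.deriv, b1]; push_cast; ring
  have hr := kummer_relation hβ (-α) 0 (t : ℂ)
  have e1 : t ^ (-1 - (α + μ) - ((1 : ℕ) : ℝ)) = t ^ (-1 - (α + μ) - ((2 : ℕ) : ℝ)) * t := by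
    rw [← Real.rpow_add_one ht.ne']; push_cast; ring_nf
  have e0 : t ^ (-1 - (α + μ) - ((0 : ℕ) : ℝ)) = t ^ (-1 - (α + μ) - ((2 : ℕ) : ℝ)) * t * t := by
    rw [← Real.rpow_add_one ht.ne', ← Real.rpow_add_one ht.ne']; push_cast; ring_nf
  simp only [zero_add, Nat.cast_zero, add_zero] at hr
  rw [e1, e0]
  simp only [b1, b2]
  simp only [shiftedSeq]
  push_cast at hr ⊢
  linear_combination ((t ^ (-1 - (α + μ) - 2) : ℝ) : ℂ) * t * t * hr

/-- Decomposition of `outerIntegral` near `0` in the convergent case. -/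
lemma outer_decomposition_base {α μ : ℝ} (hα : -1 < α) (h1 : -2 < α + μ) (h2 : α + μ < -1) :
    ∃ ε > 0, ∃ c₂ : ℂ, ∀ j : ℕ, ∀ t ∈ Ioo (0 : ℝ) ε,
      ((outerIntegral α (μ + j) t : ℝ) : ℂ)
        = (Real.Gamma (α + 1) * Real.Gamma (-1 - α - μ) / Real.Gamma (-μ) : ℝ)
            * kummer (2 + α + μ) (1 + μ) j t
          + ((t ^ (-1 - (α + μ) - j) : ℝ) : ℂ)
            * (c₂ * shiftedSeq (α + μ) (fun t => kummer (-(α + μ)) (-α) 0 t) j t) := by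
  have hβ : 0 < 2 + α + μ := by linarith
  have hβ' : 0 < -(α + μ) := by linarith
  have hK := isKummerFamily_kummer hβ (1 + μ)
  have hJ := isKummerFamily_outer hα μ
  have hT := isKummerFamily_shifted (α := α) (μ := μ) (by linarith)
  set a : ℝ → ℂ := fun t => kummer (-(α + μ)) (-α) 0 t with ha
  have haA : ∀ t, AnalyticAt ℝ a t := analyticAt_kummer hβ' (-α) 0
  have ha0 : a 0 = 1 := by simp [ha, kummer_at_zero, kummerRatio]
  obtain ⟨C1, hC1⟩ := hJ.wronskian hK
  obtain ⟨C2, hC2⟩ := hT.wronskian hK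
  have hKc : ∀ j, ContinuousAt (fun t : ℝ => kummer (2 + α + μ) (1 + μ) j t) 0 := fun j =>
    (hasDerivAt_kummer_real hβ (1 + μ) j 0).continuousAt
  have hK0 : kummer (2 + α + μ) (1 + μ) 0 ((0 : ℝ) : ℂ) = 1 := by
    simp [kummer_at_zero, kummerRatio]
  -- the Wronskian constant of the two explicit solutions
  have hC2v : C2 = 1 + (α + μ) := by
    have hlim : Tendsto (fun t : ℝ => ((Real.exp t : ℝ) : ℂ)
        * (shiftedSeq (α + μ) a 1 t * kummer (2 + α + μ) (1 + μ) 0 t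
          - t * (shiftedSeq (α + μ) a 0 t * kummer (2 + α + μ) (1 + μ) 1 t))) (𝓝[>] 0)
        (𝓝 (((Real.exp 0 : ℝ) : ℂ) * (shiftedSeq (α + μ) a 1 0 * kummer (2 + α + μ) (1 + μ) 0 (0 : ℝ)
          - (0 : ℝ) * (shiftedSeq (α + μ) a 0 0 * kummer (2 + α + μ) (1 + μ) 1 (0 : ℝ))))) := by
      refine Tendsto.mono_left (ContinuousAt.tendsto ?_) nhdsWithin_le_nhds
      have c1 := (analyticAt_shiftedSeq (α + μ) haA 1 0).continuousAt
      have c0 := (analyticAt_shiftedSeq (α + μ) haA 0 0).continuousAt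
      exact (Complex.continuous_ofReal.comp Real.continuous_exp).continuousAt.mul
        ((c1.mul (hKc 0)).sub (Complex.continuous_ofReal.continuousAt.mul (c0.mul (hKc 1))))
    have hconst : Tendsto (fun t : ℝ => ((Real.exp t : ℝ) : ℂ)
        * (shiftedSeq (α + μ) a 1 t * kummer (2 + α + μ) (1 + μ) 0 t
          - t * (shiftedSeq (α + μ) a 0 t * kummer (2 + α + μ) (1 + μ) 1 t))) (𝓝[>] 0) (𝓝 C2) := by
      refine tendsto_const_nhds.congr' ?_
      filter_upwards [self_mem_nhdsWithin] with t (ht : 0 < t)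
      rw [← hC2 t ht]
      have e1 : t ^ (2 + α + μ) * t ^ (-1 - (α + μ) - ((1 : ℕ) : ℝ)) = 1 := by
        rw [← Real.rpow_add ht]; push_cast; ring_nf; exact Real.rpow_zero t
      have e0 : t ^ (2 + α + μ) * t ^ (-1 - (α + μ) - ((0 : ℕ) : ℝ)) = t := by
        rw [← Real.rpow_add ht]; push_cast; ring_nf; exact Real.rpow_one t
      have e1' : ((t ^ (2 + α + μ) : ℝ) : ℂ) * ((t ^ (-1 - (α + μ) - ((1 : ℕ) : ℝ)) : ℝ) : ℂ) = 1 := by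
        exact_mod_cast e1
      have e0' : ((t ^ (2 + α + μ) : ℝ) : ℂ) * ((t ^ (-1 - (α + μ) - ((0 : ℕ) : ℝ)) : ℝ) : ℂ) = t := by
        exact_mod_cast e0
      rw [Complex.ofReal_mul]
      linear_combination (((Real.exp t : ℝ) : ℂ)
        * (shiftedSeq (α + μ) a 1 t * kummer (2 + α + μ) (1 + μ) 0 t)) * e1'
        - ((Real.exp t : ℝ) : ℂ) * (shiftedSeq (α + μ) a 0 t * kummer (2 + α + μ) (1 + μ) 1 t) * e0'
    have := tendsto_nhds_unique hconst hlim
    rw [this, hK0]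
    simp [shiftedSeq, ha0]
  have hC2ne : C2 ≠ 0 := by
    rw [hC2v]
    have : (1 + (α + μ) : ℝ) ≠ 0 := by linarith
    exact_mod_cast this
  -- This multiple of the singular solution makes the Wronskian with the regular solution zero. What
  -- remains is proportional to the regular solution wherever that does not vanish, in particular
  -- near `0`.
  have hF := hJ.sub_const_mul hT (C1 / C2)
  set F : ℕ → ℝ → ℂ := fun j t => ((outerIntegral α (μ + j) t : ℝ) : ℂ)
    - C1 / C2 * (((t ^ (-1 - (α + μ) - j) : ℝ) : ℂ) * shiftedSeq (α + μ) a j t) with hFdef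
  have hW : ∀ t > 0, F 1 t * kummer (2 + α + μ) (1 + μ) 0 t
      - F 0 t * kummer (2 + α + μ) (1 + μ) 1 t = 0 := by
    intro t ht
    have hne : ((t ^ (2 + α + μ) * Real.exp t : ℝ) : ℂ) ≠ 0 := by
      exact_mod_cast (by positivity : t ^ (2 + α + μ) * Real.exp t ≠ 0)
    refine mul_left_cancel₀ hne ?_
    have k1 := hC1 t ht
    have k2 := hC2 t ht
    simp only [hFdef]
    have : C1 - C1 / C2 * C2 = 0 := by field_simp; ring
    linear_combination k1 - C1 / C2 * k2 + this
  obtain ⟨ε, hε, hball⟩ := Metric.eventually_nhds_iff.1 ((hKc 0).eventually_ne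
    (by rw [hK0]; exact one_ne_zero : kummer (2 + α + μ) (1 + μ) 0 ((0 : ℝ) : ℂ) ≠ 0))
  have hne : ∀ t ∈ Ioo 0 ε, kummer (2 + α + μ) (1 + μ) 0 t ≠ 0 := fun t ht =>
    hball (by rw [Real.dist_eq, sub_zero, abs_of_pos ht.1]; exact ht.2)
  have hd : ∀ t ∈ Ioo 0 ε, HasDerivAt (fun t => F 0 t / kummer (2 + α + μ) (1 + μ) 0 t) 0 t := by
    intro t ht
    refine HasDerivAt.congr_deriv ((hF.hasDerivAt 0 t ht.1).div (hK.hasDerivAt 0 t ht.1) (hne t ht)) ?_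
    have := hW t ht.1
    simp only [zero_add]
    rw [div_eq_zero_iff]; left
    linear_combination -this
  obtain ⟨c₁, hc₁⟩ := isOpen_Ioo.exists_is_const_of_deriv_eq_zero (isPreconnected_Ioo (a := 0) (b := ε))
    (fun t ht => (hd t ht).differentiableAt.differentiableWithinAt) (fun t ht => (hd t ht).deriv)
  have hF0 : ∀ t ∈ Ioo 0 ε, F 0 t = c₁ * kummer (2 + α + μ) (1 + μ) 0 t := fun t ht => by
    rw [← hc₁ t ht, div_mul_cancel₀ _ (hne t ht)]
  -- Differentiation passes the proportionality from the function to all members of the family.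
  have hFj : ∀ j, ∀ t ∈ Ioo 0 ε, F j t = c₁ * kummer (2 + α + μ) (1 + μ) j t := by
    intro j
    induction j with
    | zero => exact hF0
    | succ j ih =>
      intro t ht
      have e : F j =ᶠ[𝓝 t] fun t => c₁ * kummer (2 + α + μ) (1 + μ) j t := by
        filter_upwards [isOpen_Ioo.mem_nhds ht] with x hx using ih x hx
      have := (hF.hasDerivAt j t ht.1).unique
        (((hK.hasDerivAt j t ht.1).const_mul c₁).congr_of_eventuallyEq e)
      linear_combination -this
  -- The constant is read off at `0⁺`: as `α + μ < -1`, the singular solution tends to `0` there,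
  -- and the outer integral converges to a Beta value.
  have hc₁v : c₁ = (Real.Gamma (α + 1) * Real.Gamma (-1 - α - μ) / Real.Gamma (-μ) : ℝ) := by
    have l1 : Tendsto (F 0) (𝓝[>] 0) (𝓝 c₁) := by
      have : Tendsto (fun t : ℝ => c₁ * kummer (2 + α + μ) (1 + μ) 0 t) (𝓝[>] 0) (𝓝 (c₁ * 1)) := by
        rw [← hK0]
        exact ((hKc 0).tendsto.const_mul c₁).mono_left nhdsWithin_le_nhds
      rw [mul_one] at this
      refine this.congr' ?_
      filter_upwards [Ioo_mem_nhdsGT hε] with t ht using (hF0 t ht).symm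
    have l2 : Tendsto (F 0) (𝓝[>] 0)
        (𝓝 ((Real.Gamma (α + 1) * Real.Gamma (-1 - α - μ) / Real.Gamma (-μ) : ℝ) - C1 / C2 * ((0 : ℝ) * a 0))) := by
      refine Tendsto.sub ?_ (Tendsto.const_mul _ (Tendsto.mul ?_ ?_))
      · have := (Complex.continuous_ofReal.tendsto _).comp (tendsto_outer_zero hα h2)
        simpa [Function.comp_def] using this
      · refine (Complex.continuous_ofReal.tendsto _).comp ?_
        have hc : ContinuousAt (fun t : ℝ => t ^ (-1 - (α + μ) - ((0 : ℕ) : ℝ))) 0 :=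
          continuousAt_id.rpow_const (Or.inr (by simp; linarith))
        have := hc.tendsto.mono_left (nhdsWithin_le_nhds (s := Ioi 0))
        rwa [Real.zero_rpow (by simp; linarith)] at this
      · exact (haA 0).continuousAt.tendsto.mono_left nhdsWithin_le_nhds
    rw [tendsto_nhds_unique l1 l2]; simp
  refine ⟨ε, hε, C1 / C2, fun j t ht => ?_⟩
  have := hFj j t ht
  rw [← hc₁v]
  simp only [hFdef] at this
  linear_combination this


/-- In terms of `1/Γ` the functional equation has no exceptions, because `Real.Gamma` is `0` at its
poles. This matters since `μ` may be an integer. -/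
lemma inv_Gamma_eq_mul (x : ℝ) : (Real.Gamma x)⁻¹ = x * (Real.Gamma (x + 1))⁻¹ := by
  rcases eq_or_ne x 0 with rfl | hx
  · simp
  · rw [Real.Gamma_add_one hx]; field_simp

/-- The connection coefficient times a ratio of Pochhammer symbols. -/
lemma gamma_ratio_mul_kummerRatio {s μ : ℝ} (h : 0 < 2 + s) (hs : ∀ k : ℤ, s ≠ k) (k : ℕ) :
    Real.Gamma (-1 - s) / Real.Gamma (-μ) * kummerRatio (2 + s) (1 + μ) k
      = Real.Gamma (-1 - s - k) / Real.Gamma (-μ - k) := by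
  induction k with
  | zero => simp [kummerRatio]
  | succ k ih =>
    have hb : (2 + s + k : ℝ) ≠ 0 := by positivity
    have hr := kummerRatio_succ h (1 + μ) k
    have e1 : Real.Gamma (-1 - s - k) = (-2 - s - k) * Real.Gamma (-1 - s - (k + 1 : ℕ)) := by
      have hne : -1 - s - ((k + 1 : ℕ) : ℝ) ≠ 0 := fun h0 => hs (-(k + 2)) (by
        push_cast at h0 ⊢; linarith)
      rw [show -1 - s - (k : ℝ) = -1 - s - ((k + 1 : ℕ) : ℝ) + 1 by push_cast; ring,
        Real.Gamma_add_one hne]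
      push_cast; ring
    have e2 := inv_Gamma_eq_mul (-μ - (k + 1 : ℕ))
    have e3 : -μ - ((k + 1 : ℕ) : ℝ) + 1 = -μ - k := by push_cast; ring
    rw [e3] at e2
    refine mul_right_cancel₀ hb ?_
    rw [mul_assoc, hr, div_eq_mul_inv (Real.Gamma (-1 - s - ((k + 1 : ℕ) : ℝ))), e2]
    rw [div_eq_mul_inv _ (Real.Gamma (-μ - k)), e1] at ih
    push_cast at ih ⊢
    linear_combination (1 + μ + k) * ih

/-- Euler's reflection formula at `-μ` and at `-1 - (α + μ)`; it produces the quotient of sines in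
the constant `L`. -/
lemma gamma_ratio_eq_sin {α μ : ℝ} (hμ : -1 < μ) (h : 0 < 2 + α + μ) :
    Real.Gamma (α + 1) * (Real.Gamma (-1 - (α + μ)) / Real.Gamma (-μ))
      = -(Real.sin (Real.pi * μ) / Real.sin (Real.pi * (α + μ)))
        * (Real.Gamma (α + 1) * Real.Gamma (μ + 1) / Real.Gamma (α + μ + 2)) := by
  have g1 := Real.Gamma_mul_Gamma_one_sub (-μ)
  have g2 := Real.Gamma_mul_Gamma_one_sub (-1 - (α + μ))
  have p1 : Real.Gamma (μ + 1) ≠ 0 := (Real.Gamma_pos_of_pos (by linarith)).ne'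
  have p2 : Real.Gamma (α + μ + 2) ≠ 0 := (Real.Gamma_pos_of_pos (by linarith)).ne'
  have s1 : Real.sin (Real.pi * -μ) = -Real.sin (Real.pi * μ) := by
    rw [mul_neg, Real.sin_neg]
  have s2 : Real.sin (Real.pi * (-1 - (α + μ))) = Real.sin (Real.pi * (α + μ)) := by
    rw [show Real.pi * (-1 - (α + μ)) = -(Real.pi * (α + μ) + Real.pi) by ring, Real.sin_neg,
      Real.sin_add_pi, neg_neg]
  rw [s1, show 1 - -μ = μ + 1 by ring] at g1
  rw [s2, show 1 - (-1 - (α + μ)) = α + μ + 2 by ring] at g2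
  have i1 : (Real.Gamma (-μ))⁻¹ = -Real.sin (Real.pi * μ) / Real.pi * Real.Gamma (μ + 1) := by
    rw [← eq_div_iff p1] at g1
    rw [g1]
    have := Real.pi_ne_zero
    rw [div_div, inv_div]
    field_simp
  have i2 : Real.Gamma (-1 - (α + μ))
      = Real.pi / Real.sin (Real.pi * (α + μ)) / Real.Gamma (α + μ + 2) := (eq_div_iff p2).2 g2
  rw [div_eq_mul_inv _ (Real.Gamma (-μ)), i1, i2]
  have := Real.pi_ne_zero
  field_simp

/-- Near `t = 0`, `outerIntegral` is the sum of a regular part `E` and `t ^ (-1-s-k)` times an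
analytic function `A k`, `s = α + μ`, where the `A k` satisfy the same relations as the moments. -/
lemma outer_decomposition {α μ : ℝ} (hα : -1 < α) (hμ : -1 < μ) (hs : 0 < α + μ)
    (hsZ : ∀ k : ℤ, α + μ ≠ k) :
    ∃ ε > 0, ∃ E A : ℕ → ℝ → ℂ, (∀ k, AnalyticAt ℝ (E k) 0) ∧ (∀ k t, AnalyticAt ℝ (A k) t) ∧
      (∀ k : ℕ, ∀ t ∈ Ioo (0 : ℝ) ε, ((outerIntegral α (μ + k) t : ℝ) : ℂ)
        = E k t + ((t ^ (-1 - (α + μ) - k) : ℝ) : ℂ) * A k t) ∧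
      (∀ (k : ℕ) (t : ℝ), A (k + 1) t = (1 + α + μ + k) * A k t - t * deriv (A k) t) ∧
      (∀ t ∈ Ioo (0 : ℝ) ε, PearsonRelation α μ t (fun k => A k t)) ∧
      A 0 0 = Real.Gamma (α + μ + 1) ∧
      E 0 0 = (-(Real.sin (Real.pi * μ) / Real.sin (Real.pi * (α + μ)))
        * (Real.Gamma (α + 1) * Real.Gamma (μ + 1) / Real.Gamma (α + μ + 2)) : ℝ) := by
  -- Lowering `μ` by `K` puts `α + μ - K` strictly between `-2` and `-1`, where the integral
  -- converges at `t = 0`; strictness uses that `α + μ` is not an integer. The members `K + k` of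
  -- the lowered family are the integrals wanted.
  obtain ⟨K, hK1, hK2⟩ : ∃ K : ℕ, α + μ - K < -1 ∧ -2 < α + μ - K := by
    refine ⟨⌊α + μ⌋₊ + 2, ?_, ?_⟩
    · have := Nat.lt_floor_add_one (α + μ); push_cast; linarith
    · have h1 := Nat.floor_le hs.le
      have h2 : (⌊α + μ⌋₊ : ℝ) ≠ α + μ := fun h => hsZ ⌊α + μ⌋₊ (by push_cast; exact h.symm)
      have := lt_of_le_of_ne h1 h2
      push_cast; linarith
  obtain ⟨ε, hε, c₂, hdec⟩ := outer_decomposition_base (μ := μ - K) hα (by linarith) (by linarith)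
  set s₀ := α + (μ - K) with hs₀
  set a : ℝ → ℂ := fun t => kummer (-s₀) (-α) 0 t with ha
  have haA : ∀ t, AnalyticAt ℝ a t := analyticAt_kummer (by linarith) (-α) 0
  set c₁ : ℝ := Real.Gamma (α + 1) * Real.Gamma (-1 - α - (μ - K)) / Real.Gamma (-(μ - K)) with hc₁
  have hβ : 0 < 2 + α + (μ - K) := by linarith
  set E : ℕ → ℝ → ℂ := fun k t => c₁ * kummer (2 + α + (μ - K)) (1 + (μ - K)) (K + k) t with hE
  set A : ℕ → ℝ → ℂ := fun k t => c₂ * shiftedSeq s₀ a (K + k) t with hA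
  have hEA : ∀ k, AnalyticAt ℝ (E k) 0 := fun k =>
    analyticAt_const.mul (analyticAt_kummer hβ (1 + (μ - K)) (K + k) 0)
  have hAA : ∀ k t, AnalyticAt ℝ (A k) t := fun k t =>
    analyticAt_const.mul (analyticAt_shiftedSeq s₀ haA (K + k) t)
  have hsum : ∀ k : ℕ, ∀ t ∈ Ioo (0 : ℝ) ε, ((outerIntegral α (μ + k) t : ℝ) : ℂ)
        = E k t + ((t ^ (-1 - (α + μ) - k) : ℝ) : ℂ) * A k t := by
    intro k t ht
    have := hdec (K + k) t ht
    rw [show μ - K + ((K + k : ℕ) : ℝ) = μ + k by push_cast; ring,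
      show -1 - s₀ - ((K + k : ℕ) : ℝ) = -1 - (α + μ) - k by rw [hs₀]; push_cast; ring] at this
    exact this
  refine ⟨ε, hε, E, A, hEA, hAA, hsum, ?_, ?_, ?_, ?_⟩
  · intro k t
    have e : shiftedSeq s₀ a (K + (k + 1)) t = (1 + (s₀ : ℂ) + ((K + k : ℕ) : ℂ))
        * shiftedSeq s₀ a (K + k) t - t * deriv (shiftedSeq s₀ a (K + k)) t := rfl
    simp only [hA, e]
    rw [deriv_const_mul _ (analyticAt_shiftedSeq s₀ haA (K + k) t).differentiableAt, hs₀]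
    push_cast; ring
  -- The outer integral and its regular part satisfy the same linear relation, hence so does their
  -- difference, which becomes the Pearson recursion once the powers of `t` are removed.
  · intro t ht k
    have h0 := hsum k t ht
    have h1 := hsum (k + 1) t ht
    have h2 := hsum (k + 2) t ht
    have hJ := outerIntegral_relation hα (μ + k) ht.1
    rw [show μ + (k : ℝ) + 2 = μ + ((k + 2 : ℕ) : ℝ) by push_cast; ring,
      show μ + (k : ℝ) + 1 = μ + ((k + 1 : ℕ) : ℝ) by push_cast; ring] at hJ
    have hJ' := congrArg (fun x : ℝ => (x : ℂ)) hJ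
    have hR : (t : ℂ) * E (k + 2) t = (2 + α + μ + k + t) * E (k + 1) t - (1 + μ + k) * E k t := by
      have := kummer_relation hβ (1 + (μ - K)) (K + k) (t : ℂ)
      simp only [hE, ← add_assoc]
      push_cast at this ⊢
      linear_combination (c₁ : ℂ) * this
    have e1 : t ^ (-1 - (α + μ) - ((k + 1 : ℕ) : ℝ)) = t ^ (-1 - (α + μ) - ((k + 2 : ℕ) : ℝ)) * t := by
      rw [← Real.rpow_add_one ht.1.ne']; push_cast; ring_nf
    have e0 : t ^ (-1 - (α + μ) - (k : ℝ)) = t ^ (-1 - (α + μ) - ((k + 2 : ℕ) : ℝ)) * t * t := by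
      rw [← Real.rpow_add_one ht.1.ne', ← Real.rpow_add_one ht.1.ne']; push_cast; ring_nf
    rw [e0] at h0
    rw [e1] at h1
    set r := t ^ (-1 - (α + μ) - ((k + 2 : ℕ) : ℝ)) with hr
    have hne : ((r * t : ℝ) : ℂ) ≠ 0 := by
      have h3 := ht.1
      exact_mod_cast (by positivity : r * t ≠ 0)
    refine mul_left_cancel₀ hne ?_
    push_cast at h0 h1 h2 hJ' ⊢
    linear_combination hJ' - hR - t * h2 + (2 + α + μ + k + t) * h1 - (1 + μ + k) * h0
  -- After multiplication by `t^(1+α+μ)` the regular part disappears in the limit, and `A 0 0` is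
  -- the known leading coefficient of the divergent integral.
  · have l1 := (Complex.continuous_ofReal.tendsto _).comp
      (tendsto_rpow_mul_outer hα (by linarith : -1 < α + μ))
    have l2 : Tendsto (fun t : ℝ => ((t ^ (1 + α + μ) : ℝ) : ℂ) * E 0 t + A 0 t) (𝓝[>] 0)
        (𝓝 (((0 : ℝ) : ℂ) * E 0 0 + A 0 0)) := by
      refine ((Tendsto.mul ?_ ?_).add ?_)
      · refine (Complex.continuous_ofReal.tendsto _).comp ?_
        have hc : ContinuousAt (fun t : ℝ => t ^ (1 + α + μ)) 0 :=
          continuousAt_id.rpow_const (Or.inr (by linarith))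
        have := hc.tendsto.mono_left (nhdsWithin_le_nhds (s := Ioi 0))
        rwa [Real.zero_rpow (by linarith)] at this
      · exact (hEA 0).continuousAt.tendsto.mono_left nhdsWithin_le_nhds
      · exact (hAA 0 0).continuousAt.tendsto.mono_left nhdsWithin_le_nhds
    have l3 := l2.congr' (f₂ := Complex.ofReal ∘ fun t => t ^ (1 + α + μ) * outerIntegral α μ t) (by
      filter_upwards [Ioo_mem_nhdsGT hε] with t ht
      have := hsum 0 t ht
      simp only [Nat.cast_zero, add_zero, sub_zero] at this
      simp only [Function.comp, Complex.ofReal_mul, this]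
      have e : t ^ (1 + α + μ) * t ^ (-1 - (α + μ)) = 1 := by
        rw [← Real.rpow_add ht.1]; ring_nf; exact Real.rpow_zero t
      have e' : ((t ^ (1 + α + μ) : ℝ) : ℂ) * ((t ^ (-1 - (α + μ)) : ℝ) : ℂ) = 1 := by exact_mod_cast e
      linear_combination -A 0 t * e')
    have := tendsto_nhds_unique l3 l1
    simpa using this
  -- The regular part at index `K` is the connection coefficient times a ratio of Pochhammer
  -- symbols; the shift by `K` cancels against the lowering of `μ`.
  · rw [← gamma_ratio_eq_sin hμ (by linarith)]
    have := gamma_ratio_mul_kummerRatio (s := s₀) (μ := μ - K) (by linarith) (fun k h => by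
      refine hsZ (k + K) ?_
      rw [hs₀] at h; push_cast; linarith) K
    rw [show -1 - s₀ - (K : ℝ) = -1 - (α + μ) by rw [hs₀]; ring,
      show -(μ - K) - (K : ℝ) = -μ by ring] at this
    rw [← this]
    simp only [hE, add_zero, Complex.ofReal_zero, kummer_at_zero]
    rw [hc₁, show 2 + α + (μ - K) = 2 + s₀ by rw [hs₀]; ring,
      show -1 - α - (μ - K) = -1 - s₀ by rw [hs₀]; ring]
    push_cast; ring


/-! ### Orders of vanishing and nonanalytic terms at `0⁺`. -/

/-- `f` vanishes at `0⁺` at least to the order `a`. -/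
def VanishesToOrder (f : ℝ → ℂ) (a : ℝ) : Prop := f =O[𝓝[>] 0] fun t : ℝ => t ^ a

namespace VanishesToOrder

variable {f g : ℝ → ℂ} {a b : ℝ}

lemma mono (hf : VanishesToOrder f a) (h : b ≤ a) : VanishesToOrder f b := by
  refine hf.trans (IsBigO.of_bound 1 ?_)
  filter_upwards [Ioo_mem_nhdsGT (zero_lt_one (α := ℝ))] with t ht
  rw [one_mul, Real.norm_of_nonneg (Real.rpow_nonneg ht.1.le _),
    Real.norm_of_nonneg (Real.rpow_nonneg ht.1.le _)]
  exact Real.rpow_le_rpow_of_exponent_ge ht.1 ht.2.le h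

lemma add (hf : VanishesToOrder f a) (hg : VanishesToOrder g a) :
    VanishesToOrder (fun t => f t + g t) a := IsBigO.add hf hg

lemma sub (hf : VanishesToOrder f a) (hg : VanishesToOrder g a) :
    VanishesToOrder (fun t => f t - g t) a := IsBigO.sub hf hg

lemma const_mul (hf : VanishesToOrder f a) (c : ℂ) : VanishesToOrder (fun t => c * f t) a :=
  IsBigO.const_mul_left hf c

lemma congr' (hf : VanishesToOrder f a) (h : ∀ᶠ t in 𝓝[>] 0, f t = g t) : VanishesToOrder g a :=
  IsBigO.congr' hf h EventuallyEq.rfl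

lemma mul (hf : VanishesToOrder f a) (hg : VanishesToOrder g b) :
    VanishesToOrder (fun t => f t * g t) (a + b) := by
  refine (IsBigO.mul hf hg).congr' EventuallyEq.rfl ?_
  filter_upwards [self_mem_nhdsWithin] with t (ht : 0 < t)
  rw [Real.rpow_add ht]

lemma tendsto_zero (hf : VanishesToOrder f a) (ha : 0 < a) : Tendsto f (𝓝[>] 0) (𝓝 0) := by
  refine IsBigO.trans_tendsto hf ?_
  have hc : ContinuousAt (fun t : ℝ => t ^ a) 0 := continuousAt_id.rpow_const (Or.inr ha.le)
  have := hc.tendsto.mono_left (nhdsWithin_le_nhds (s := Ioi 0))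
  rwa [Real.zero_rpow ha.ne'] at this

end VanishesToOrder

lemma vanishesToOrder_zero (a : ℝ) : VanishesToOrder (fun _ => 0) a := isBigO_zero _ _

lemma vanishesToOrder_rpow (a : ℝ) : VanishesToOrder (fun t => ((t ^ a : ℝ) : ℂ)) a :=
  Complex.isBigO_ofReal_left.2 (isBigO_refl _ _)

lemma vanishesToOrder_id : VanishesToOrder (fun t => (t : ℂ)) 1 := by
  simpa using vanishesToOrder_rpow 1

lemma vanishesToOrder_pow (k : ℕ) : VanishesToOrder (fun t => (t : ℂ) ^ k) k := by
  simpa using vanishesToOrder_rpow k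

lemma vanishesToOrder_of_tendsto {f : ℝ → ℂ} {c : ℂ} (h : Tendsto f (𝓝[>] 0) (𝓝 c)) :
    VanishesToOrder f 0 := by
  simpa [VanishesToOrder] using h.isBigO_one ℝ

lemma vanishesToOrder_const (c : ℂ) : VanishesToOrder (fun _ => c) 0 :=
  vanishesToOrder_of_tendsto tendsto_const_nhds

lemma AnalyticAt.tendsto_right {g : ℝ → ℂ} (hg : AnalyticAt ℝ g 0) :
    Tendsto g (𝓝[>] 0) (𝓝 (g 0)) := hg.continuousAt.tendsto.mono_left nhdsWithin_le_nhds

lemma AnalyticAt.vanishesToOrder {g : ℝ → ℂ} (hg : AnalyticAt ℝ g 0) : VanishesToOrder g 0 :=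
  vanishesToOrder_of_tendsto hg.tendsto_right

lemma AnalyticAt.sub_zero_vanishesToOrder {g : ℝ → ℂ} (hg : AnalyticAt ℝ g 0) :
    VanishesToOrder (fun t => g t - g 0) 1 := by
  have := hg.differentiableAt.isBigO_sub
  simp only [sub_zero] at this
  simpa [VanishesToOrder] using this.mono nhdsWithin_le_nhds

/-- Hadamard's lemma. -/
lemma AnalyticAt.exists_eq_add_mul {g : ℝ → ℂ} (hg : AnalyticAt ℝ g 0) :
    ∃ u : ℝ → ℂ, AnalyticAt ℝ u 0 ∧ ∀ t, g t = g 0 + t * u t := by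
  obtain ⟨p, hp⟩ := hg
  refine ⟨dslope g 0, ⟨_, hp.has_fpower_series_dslope_fslope⟩, fun t => ?_⟩
  have := sub_smul_dslope g 0 t
  rw [sub_zero, Complex.real_smul] at this
  rw [this]; ring

lemma eq_zero_of_vanishesToOrder_rpow {B : ℂ} {r a : ℝ} (h : r < a)
    (hB : VanishesToOrder (fun t => B * ((t ^ r : ℝ) : ℂ)) a) : B = 0 := by
  have h1 := (hB.mul (vanishesToOrder_rpow (-r))).congr' (g := fun _ => B) (by
    filter_upwards [self_mem_nhdsWithin] with t (ht : 0 < t)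
    rw [mul_assoc, ← Complex.ofReal_mul, ← Real.rpow_add ht]; simp)
  exact tendsto_nhds_unique tendsto_const_nhds (h1.tendsto_zero (by linarith))

lemma tendsto_mul_rpow_neg {f : ℝ → ℂ} {B : ℂ} {r a : ℝ} (h : r < a)
    (hf : VanishesToOrder (fun t => f t - B * ((t ^ r : ℝ) : ℂ)) a) :
    Tendsto (fun t => f t * ((t ^ (-r) : ℝ) : ℂ)) (𝓝[>] 0) (𝓝 B) := by
  have h1 := ((hf.mul (vanishesToOrder_rpow (-r))).tendsto_zero (by linarith)).add_const B
  rw [zero_add] at h1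
  refine h1.congr' ?_
  filter_upwards [self_mem_nhdsWithin] with t (ht : 0 < t)
  rw [sub_mul, mul_assoc, ← Complex.ofReal_mul, ← Real.rpow_add ht]; simp

/-- If `φ` and `t φ'(t)` converge at `0⁺`, then the limit of the latter is `0`. -/
lemma limit_mul_deriv_eq_zero {φ φ' : ℝ → ℂ} {B C : ℂ} (h : Tendsto φ (𝓝[>] 0) (𝓝 B))
    (h' : Tendsto φ' (𝓝[>] 0) (𝓝 C)) (hd : ∀ᶠ t in 𝓝[>] 0, HasDerivAt φ (φ' t / t) t) : C = 0 := by
  have hlog : 0 < Real.log 2 := Real.log_pos one_lt_two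
  have hhalf : Tendsto (fun t : ℝ => t / 2) (𝓝[>] 0) (𝓝[>] 0) := by
    refine tendsto_nhdsWithin_iff.2 ⟨?_, by
      filter_upwards [self_mem_nhdsWithin] with t (ht : 0 < t) using half_pos ht⟩
    have : Tendsto (fun t : ℝ => t / 2) (𝓝 0) (𝓝 (0 / 2)) := (continuous_id.div_const 2).tendsto 0
    rw [zero_div] at this
    exact this.mono_left nhdsWithin_le_nhds
  have hlim : Tendsto (fun t => ‖φ t - φ (t / 2)‖) (𝓝[>] 0) (𝓝 0) := by
    simpa using (h.sub (h.comp hhalf)).norm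
  -- On `[t/2, t]` the function `φ - C log` varies little, and `φ t - φ (t/2)` is small as well; the
  -- logarithm alone would change by `C log 2`.
  have key : ∀ η > 0, ‖C‖ * Real.log 2 ≤ η := by
    intro η hη
    have e1 : ∀ᶠ t in 𝓝[>] 0, ‖φ' t - C‖ < η / 2 := by
      simpa [dist_eq_norm] using (Metric.tendsto_nhds.1 h' (η / 2) (half_pos hη))
    obtain ⟨ε, hε, hball⟩ := mem_nhdsGT_iff_exists_Ioo_subset.1 (inter_mem e1 hd)
    have hε0 : (0 : ℝ) < ε := hε
    obtain ⟨t, ht1, ht⟩ := ((hlim.eventually (gt_mem_nhds (half_pos hη))).and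
      (Ioo_mem_nhdsGT hε0)).exists
    have ht0 := ht.1
    have hsub : ∀ x ∈ Icc (t / 2) t, x ∈ Ioo 0 ε := fun x hx =>
      ⟨by linarith [hx.1], lt_of_le_of_lt hx.2 ht.2⟩
    have hm := (convex_Icc (t / 2) t).norm_image_sub_le_of_norm_hasDerivWithin_le
      (f := fun x => φ x - C * (Real.log x : ℝ)) (f' := fun x => (φ' x - C) / x) (C := η / t)
      (fun x hx => by
        have hx0 := (hsub x hx).1
        have := (Real.hasDerivAt_log hx0.ne').ofReal_comp
        refine (((hball (hsub x hx)).2.sub (this.const_mul C)).congr_deriv ?_).hasDerivWithinAt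
        push_cast; ring)
      (fun x hx => by
        have hx0 := (hsub x hx).1
        rw [norm_div, Complex.norm_real, Real.norm_of_nonneg hx0.le, div_le_div_iff₀ hx0 ht0]
        have a1 : ‖φ' x - C‖ < η / 2 := (hball (hsub x hx)).1
        have a2 := hx.1
        nlinarith)
      (left_mem_Icc.2 (by linarith)) (right_mem_Icc.2 (by linarith))
    have hm' : ‖(φ t - φ (t / 2)) - C * (Real.log 2 : ℝ)‖ ≤ η / 2 := by
      have e : (φ t - φ (t / 2)) - C * (Real.log 2 : ℝ)
          = φ t - C * (Real.log t : ℝ) - (φ (t / 2) - C * (Real.log (t / 2) : ℝ)) := by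
        rw [Real.log_div ht0.ne' two_ne_zero]; push_cast; ring
      rw [e]
      refine hm.trans_eq ?_
      rw [Real.norm_of_nonneg (by linarith)]; field_simp; ring
    have : ‖C * (Real.log 2 : ℝ)‖ ≤ ‖φ t - φ (t / 2)‖ + η / 2 := by
      calc ‖C * (Real.log 2 : ℝ)‖
          = ‖(φ t - φ (t / 2)) - ((φ t - φ (t / 2)) - C * (Real.log 2 : ℝ))‖ := by
            rw [sub_sub_cancel]
        _ ≤ _ := (norm_sub_le _ _).trans (by gcongr)
    rw [norm_mul, Complex.norm_real, Real.norm_of_nonneg hlog.le] at this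
    linarith
  have h0 : ‖C‖ * Real.log 2 ≤ 0 := le_of_forall_pos_le_add fun η hη => by simpa using key η hη
  have : ‖C‖ ≤ 0 := by
    by_contra hc
    exact absurd h0 (not_le.2 (mul_pos (not_le.1 hc) hlog))
  exact norm_le_zero_iff.1 this

/-- Termwise differentiation of a leading power. -/
lemma leading_coeff_of_hasDerivAt {f f' : ℝ → ℂ} {B C : ℂ} {r : ℝ}
    (hf : Tendsto (fun t => f t * ((t ^ (-r) : ℝ) : ℂ)) (𝓝[>] 0) (𝓝 B))
    (hf' : Tendsto (fun t => f' t * ((t ^ (-r) : ℝ) : ℂ)) (𝓝[>] 0) (𝓝 C))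
    (hd : ∀ᶠ t in 𝓝[>] 0, HasDerivAt f (f' t / t) t) : C = r * B := by
  -- The function `f t^(-r)` has Euler derivative `(f' - r f) t^(-r)`, whose limit must be `0`.
  refine sub_eq_zero.1 (limit_mul_deriv_eq_zero hf (hf'.sub (hf.const_mul (r : ℂ))) ?_)
  filter_upwards [hd, self_mem_nhdsWithin] with t h (ht : 0 < t)
  have h1 := (Real.hasDerivAt_rpow_const (x := t) (p := -r) (Or.inl ht.ne')).ofReal_comp
  refine (h.mul h1).congr_deriv ?_
  have ht' : (t : ℂ) ≠ 0 := by exact_mod_cast ht.ne'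
  have e : t ^ (-r) = t ^ (-r - 1) * t := by rw [← Real.rpow_add_one ht.ne']; ring_nf
  rw [e]
  push_cast
  field_simp
  ring

/-- `f = g + B t ^ (1+s) + O(t ^ (2+s))` with `g` analytic at `0`. -/
def HasNonanalyticTerm (s : ℝ) (f g : ℝ → ℂ) (B : ℂ) : Prop :=
  AnalyticAt ℝ g 0 ∧ VanishesToOrder (fun t => f t - g t - B * ((t ^ (1 + s) : ℝ) : ℂ)) (2 + s)

namespace HasNonanalyticTerm

variable {s : ℝ} {f g f₁ g₁ f₂ g₂ : ℝ → ℂ} {B B₁ B₂ : ℂ}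

lemma of_analyticAt (hf : AnalyticAt ℝ f 0) : HasNonanalyticTerm s f f 0 :=
  ⟨hf, by simpa using vanishesToOrder_zero (2 + s)⟩

lemma diff_order (h : HasNonanalyticTerm s f g B) : VanishesToOrder (fun t => f t - g t) (1 + s) := by
  refine ((h.2.mono (by linarith)).add ((vanishesToOrder_rpow (1 + s)).const_mul B)).congr' ?_
  exact Eventually.of_forall fun t => by ring

lemma tendsto (hs : 0 < s) (h : HasNonanalyticTerm s f g B) : Tendsto f (𝓝[>] 0) (𝓝 (g 0)) := by
  have := (h.diff_order.tendsto_zero (by linarith)).add h.1.tendsto_right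
  simpa using this

lemma add (h₁ : HasNonanalyticTerm s f₁ g₁ B₁) (h₂ : HasNonanalyticTerm s f₂ g₂ B₂) :
    HasNonanalyticTerm s (fun t => f₁ t + f₂ t) (fun t => g₁ t + g₂ t) (B₁ + B₂) :=
  ⟨h₁.1.add h₂.1, (h₁.2.add h₂.2).congr' (Eventually.of_forall fun t => by ring)⟩

/-- Products of two nonanalytic terms have order at least `2 + 2s`, so the coefficient of `t^(1+s)`
behaves like a derivation at the values `g 0`. -/
lemma mul (hs : 0 < s) (h₁ : HasNonanalyticTerm s f₁ g₁ B₁)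
    (h₂ : HasNonanalyticTerm s f₂ g₂ B₂) :
    HasNonanalyticTerm s (fun t => f₁ t * f₂ t) (fun t => g₁ t * g₂ t)
      (B₁ * g₂ 0 + B₂ * g₁ 0) := by
  refine ⟨h₁.1.mul h₂.1, ?_⟩
  have o := vanishesToOrder_rpow (1 + s)
  have a1 := h₁.2.mul (vanishesToOrder_of_tendsto (h₂.tendsto hs))
  have a2 := h₂.2.mul h₁.1.vanishesToOrder
  have a3 := ((o.const_mul B₁).mul (h₂.diff_order)).mono (show 2 + s ≤ 1 + s + (1 + s) by linarith)
  have a4 := (o.const_mul B₁).mul h₂.1.sub_zero_vanishesToOrder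
  have a5 := (o.const_mul B₂).mul h₁.1.sub_zero_vanishesToOrder
  rw [add_zero] at a1 a2
  rw [show 1 + s + 1 = 2 + s by ring] at a4 a5
  exact ((((a1.add a2).add a3).add a4).add a5).congr' (Eventually.of_forall fun t => by ring)

lemma inv (hs : 0 < s) (h : HasNonanalyticTerm s f g B) (h0 : g 0 ≠ 0) :
    HasNonanalyticTerm s (fun t => (f t)⁻¹) (fun t => (g t)⁻¹) (-B / g 0 ^ 2) := by
  refine ⟨h.1.inv h0, ?_⟩
  have hf := h.tendsto hs
  have hg := h.1.tendsto_right
  have i1 := vanishesToOrder_of_tendsto ((hf.mul hg).inv₀ (mul_ne_zero h0 h0))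
  have a1 := h.2.mul i1
  have b1 := (h.diff_order.mul h.1.vanishesToOrder).mono (show 1 ≤ 1 + s + 0 by linarith)
  have b2 := h.1.sub_zero_vanishesToOrder.mul (h.1.vanishesToOrder.add (vanishesToOrder_const (g 0)))
  rw [add_zero] at b2
  have a2 := (((vanishesToOrder_rpow (1 + s)).const_mul (B / g 0 ^ 2)).mul (b1.add b2)).mul i1
  rw [show 1 + s + 1 + 0 = 2 + s by ring] at a2
  rw [add_zero] at a1
  refine (a2.sub a1).congr' ?_
  filter_upwards [hf.eventually_ne h0, hg.eventually_ne h0] with t h1 h2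
  field_simp
  ring

/-- A function on `ℝ ⊕ ℝ` packs a function and its analytic part into one. Applied to the moments
`Sum.elim M N`, the ring argument shows that the recurrence quantities of `N` are the analytic parts
of those of `M`. -/
lemma isFunctionRing (hs : 0 < s) : IsFunctionRing (fun F : ℝ ⊕ ℝ → ℂ =>
    ∃ B, HasNonanalyticTerm s (fun t => F (.inl t)) (fun t => F (.inr t)) B) where
  add _ _ := fun ⟨_, hf⟩ ⟨_, hg⟩ => ⟨_, hf.add hg⟩
  mul _ _ := fun ⟨_, hf⟩ ⟨_, hg⟩ => ⟨_, hf.mul hs hg⟩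
  const _ := ⟨_, of_analyticAt analyticAt_const⟩

lemma unique (h₁ : HasNonanalyticTerm s f g B₁) (h₂ : HasNonanalyticTerm s f g B₂) : B₁ = B₂ := by
  have := (h₂.2.sub h₁.2).congr' (g := fun t => (B₁ - B₂) * ((t ^ (1 + s) : ℝ) : ℂ))
    (Eventually.of_forall fun t => by ring)
  exact sub_eq_zero.1 (eq_zero_of_vanishesToOrder_rpow (by linarith) this)

/-- The nonanalytic terms of `f` and of `f' = t df/dt`. -/
lemma of_hasDerivAt {f' g' : ℝ → ℂ} {C : ℂ} (h : HasNonanalyticTerm s f g B)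
    (h' : HasNonanalyticTerm s f' g' C) (hf : ∀ᶠ t in 𝓝[>] 0, HasDerivAt f (f' t / t) t)
    (hg : ∀ᶠ t in 𝓝[>] 0, HasDerivAt g (g' t / t) t) : C = (1 + s) * B := by
  have e := leading_coeff_of_hasDerivAt (f := fun t => f t - g t) (f' := fun t => f' t - g' t)
    (tendsto_mul_rpow_neg (by linarith) h.2) (tendsto_mul_rpow_neg (by linarith) h'.2) (by
      filter_upwards [hf, hg] with t h1 h2
      exact (h1.sub h2).congr_deriv (by ring))
  rw [e]; push_cast; ring

end HasNonanalyticTerm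


/-! ### Nonanalytic terms of the recurrence coefficients. -/

/-- The moments near `t = 0`: an analytic family and a term in `t ^ (1 + α + μ)`. -/
lemma exists_analytic_moments (ζ : ℝ) {α μ : ℝ} (ω : ℂ) (hα : -1 < α) (hμ : -1 < μ)
    (hs : 0 < α + μ) (hsZ : ∀ k : ℤ, α + μ ≠ k) :
    ∃ N : ℝ → ℕ → ℂ, (∀ k, AnalyticAt ℝ (fun t => N t k) 0) ∧
      (∀ k : ℕ, N 0 (k + 1) = (1 + α + μ + k) * N 0 k) ∧
      (∀ t : ℝ, 0 < t → MomentFlowAt (1 + α + μ) N t) ∧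
      (∀ᶠ t : ℝ in 𝓝[>] 0, PearsonRelation α μ t (N t)) ∧
      N 0 0 = (1 - ζ) * Real.Gamma (α + μ + 1) ∧
      (∀ k : ℕ, HasNonanalyticTerm (α + μ) (fun t => laguerreMoment ζ α μ ω t k) (fun t => N t k)
        (if k = 0 then (ω - (1 - ζ) * (Real.sin (Real.pi * μ) / Real.sin (Real.pi * (α + μ)) : ℝ))
          * (Real.Gamma (α + 1) * Real.Gamma (μ + 1) / Real.Gamma (α + μ + 2) : ℝ) else 0)) := by
  obtain ⟨ε, hε, E, A, hE, hA, hdec, hflow, hP, hA0, hE0⟩ := outer_decomposition hα hμ hs hsZ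
  refine ⟨fun t k => (1 - ζ) * A k t, fun k => analyticAt_const.mul (hA k 0), fun k => ?_,
    fun t ht k => ?_, ?_, by simp only [hA0], fun k => ⟨analyticAt_const.mul (hA k 0), ?_⟩⟩
  · simp only [hflow k 0]; push_cast; ring
  · refine ((hA k t).differentiableAt.hasDerivAt.const_mul (1 - ζ : ℂ)).congr_deriv ?_
    have ht' : (t : ℂ) ≠ 0 := by exact_mod_cast ht.ne'
    simp only [hflow k t]; field_simp; ring
  · filter_upwards [Ioo_mem_nhdsGT hε] with t ht k
    linear_combination (1 - ζ : ℂ) * hP t ht k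
  -- The whole nonanalytic contribution to the `k`-th moment is `t^(1+α+μ+k) G t` with `G`
  -- differentiable at `0`, so the order `1 + α + μ` is reached only for `k = 0`, with coefficient
  -- `G 0`.
  · set G : ℝ → ℂ := fun t => ω * (innerIntegral α (μ + k) t : ℝ) + (1 - ζ) * E k t with hG
    have hk : (0 : ℝ) ≤ k := Nat.cast_nonneg k
    have hdec' : ∀ᶠ t in 𝓝[>] 0, laguerreMoment ζ α μ ω t k - (1 - ζ) * A k t
        = ((t ^ (1 + α + μ + k) : ℝ) : ℂ) * G t := by
      filter_upwards [Ioo_mem_nhdsGT hε] with t ht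
      have e : t ^ (1 + α + μ + k) * t ^ (-1 - (α + μ) - k) = 1 := by
        rw [← Real.rpow_add ht.1]; ring_nf; exact Real.rpow_zero t
      have e' : ((t ^ (1 + α + μ + k) : ℝ) : ℂ) * ((t ^ (-1 - (α + μ) - k) : ℝ) : ℂ) = 1 := by
        exact_mod_cast e
      rw [laguerreMoment, hdec k t ht, hG]
      linear_combination (1 - ζ : ℂ) * A k t * e'
    have hGd : DifferentiableAt ℝ G 0 := by
      have d1 := (hasDerivAt_inner hα (by linarith : -1 < μ + k) 0).ofReal_comp
      exact (d1.differentiableAt.const_mul ω).add ((hE k).differentiableAt.const_mul _)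
    have hG1 : VanishesToOrder (fun t => G t - G 0) 1 := by
      have := hGd.isBigO_sub
      simp only [sub_zero] at this
      simpa [VanishesToOrder] using this.mono nhdsWithin_le_nhds
    rcases Nat.eq_zero_or_pos k with rfl | hkp
    · have hG0 : G 0 = (ω - (1 - ζ) * (Real.sin (Real.pi * μ) / Real.sin (Real.pi * (α + μ)) : ℝ))
          * (Real.Gamma (α + 1) * Real.Gamma (μ + 1) / Real.Gamma (α + μ + 2) : ℝ) := by
        simp only [hG, hE0]
        rw [Nat.cast_zero, add_zero, innerIntegral_zero hα hμ]
        push_cast; ring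
      rw [if_pos rfl, ← hG0]
      have := (vanishesToOrder_rpow (1 + (α + μ))).mul hG1
      rw [show 1 + (α + μ) + 1 = 2 + (α + μ) by ring] at this
      refine this.congr' ?_
      filter_upwards [hdec'] with t ht
      rw [ht, Nat.cast_zero, add_zero, add_assoc]; ring
    · rw [if_neg hkp.ne']
      have hk1 : (1 : ℝ) ≤ k := by exact_mod_cast hkp
      have := (vanishesToOrder_rpow (1 + α + μ + k)).mul
        (vanishesToOrder_of_tendsto (hGd.continuousAt.tendsto.mono_left
          (nhdsWithin_le_nhds (s := Ioi 0))))
      refine (this.mono (show 2 + (α + μ) ≤ 1 + α + μ + k + 0 by linarith)).congr' ?_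
      filter_upwards [hdec'] with t ht
      rw [ht]; ring

/-- Moments with `M (k+1) = (σ+k) M k` belong to a Laguerre weight. -/
lemma laguerre_recurrence {M : ℕ → ℂ} {σ : ℂ} (hM : ∀ k : ℕ, M (k + 1) = (σ + k) * M k)
    (h0 : M 0 ≠ 0) (hσ : ∀ k : ℕ, σ + k ≠ 0) (n : ℕ) :
    opNorm M n ≠ 0 ∧ opDiag M n = σ + 2 * n ∧ opOff M n = n * (n + σ - 1)
      ∧ opSum M n = n * (n + σ - 1) := by
  -- The recursion for the moments says that `scaledFunctional` is identically zero; its two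
  -- evaluations on products of orthogonal polynomials then give the coefficients.
  have hz : ∀ f, scaledFunctional M σ f = 0 := fun f => by
    rw [scaledFunctional_eq, show (fun k : ℕ => (σ + k) * M k - M (k + 1)) = fun _ => 0 from
      funext fun k => by rw [hM]; ring, momentFunctional_eq_sum _ f (Nat.lt_succ_self f.natDegree)]
    simp
  induction n using Nat.strong_induction_on with
  | _ n ih =>
    have key : ∀ m, (∀ j ≤ m, opNorm M j ≠ 0) → opDiag M m = σ + 2 * m := fun m hm => by
      have := scaledFunctional_sq σ m hm
      rw [hz, eq_comm, mul_eq_zero] at this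
      linear_combination -(this.resolve_right (hm m le_rfl))
    cases n with
    | zero =>
      have h : opNorm M 0 ≠ 0 := by
        simpa [opNorm, monicOP, momentFunctional_eq_sum M (1 : ℂ[X]) (N := 1) (by simp)] using h0
      exact ⟨h, key 0 fun j hj => by rwa [Nat.le_zero.1 hj], by simp [opOff], by simp [opSum]⟩
    | succ n =>
      have hn : ∀ j ≤ n, opNorm M j ≠ 0 := fun j hj => (ih j (by omega)).1
      have hS : opSum M (n + 1) = (n + 1 : ℕ) * ((n + 1 : ℕ) + σ - 1) := by
        rw [opSum_succ, (ih n (by omega)).2.2.2, (ih n (by omega)).2.1]; push_cast; ring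
      have hO : opOff M (n + 1) = (n + 1 : ℕ) * ((n + 1 : ℕ) + σ - 1) := by
        have := scaledFunctional_succ_mul σ n hn
        rw [hz, eq_comm, mul_eq_zero] at this
        rw [← hS]
        linear_combination -(this.resolve_right (hn n le_rfl))
      have hN : opNorm M (n + 1) ≠ 0 := by
        rw [← opOff_succ_mul n (hn n le_rfl), hO]
        refine mul_ne_zero (mul_ne_zero (by exact_mod_cast n.succ_ne_zero) ?_) (hn n le_rfl)
        have := hσ n
        push_cast
        intro h; apply this; linear_combination h
      refine ⟨hN, key _ fun j hj => ?_, hO, hS⟩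
      rcases Nat.lt_or_ge j (n + 1) with h | h
      · exact hn j (by omega)
      · rwa [le_antisymm hj h]

lemma isFunctionRing_analyticAt : IsFunctionRing (fun f : ℝ → ℂ => AnalyticAt ℝ f 0) where
  add _ _ hf hg := hf.add hg
  mul _ _ hf hg := hf.mul hg
  const _ := analyticAt_const

section

variable {s : ℝ} {N M : ℝ → ℕ → ℂ} {B : ℕ → ℂ} (hs : 0 < s)
  (hN : ∀ k : ℕ, N 0 (k + 1) = (1 + s + k) * N 0 k) (hN0 : N 0 0 ≠ 0)
  (hNM : ∀ k, HasNonanalyticTerm s (fun t => M t k) (fun t => N t k) (B k))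
include hs hN hN0

lemma laguerre_recurrence_at_zero (n : ℕ) : opNorm (N 0) n ≠ 0 ∧ opDiag (N 0) n = 1 + s + 2 * n
    ∧ opOff (N 0) n = n * (n + s) ∧ opSum (N 0) n = n * (n + s) := by
  have := laguerre_recurrence hN hN0 (fun k => by
    have : (1 + s + k : ℝ) ≠ 0 := by positivity
    exact_mod_cast this) n
  refine ⟨this.1, this.2.1, this.2.2.1.trans (by ring), this.2.2.2.trans (by ring)⟩

include hNM

lemma recurrence_hasNonanalyticTerm (n : ℕ) :
    (∃ C, HasNonanalyticTerm s (fun t => opDiag (M t) n) (fun t => opDiag (N t) n) C) ∧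
    (∃ C, HasNonanalyticTerm s (fun t => opOff (M t) n) (fun t => opOff (N t) n) C) ∧
    (∃ C, HasNonanalyticTerm s (fun t => opSum (M t) n) (fun t => opSum (N t) n) C) ∧
    (∃ C, HasNonanalyticTerm s (fun t => opNorm (M t) n) (fun t => opNorm (N t) n) C) :=
  (HasNonanalyticTerm.isFunctionRing hs).recurrence_mem
    (M := fun T : ℝ ⊕ ℝ => Sum.elim M N T) (fun k => ⟨_, hNM k⟩) n
    (fun j _ ⟨_, h⟩ => ⟨_, h.inv hs (laguerre_recurrence_at_zero hs hN hN0 j).1⟩)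

lemma eventually_opNorm_ne_zero (n : ℕ) :
    ∀ᶠ t in 𝓝[>] 0, ∀ j ≤ n, opNorm (M t) j ≠ 0 ∧ opNorm (N t) j ≠ 0 := by
  have : ∀ᶠ t in 𝓝[>] 0, ∀ j ∈ Finset.range (n + 1), opNorm (M t) j ≠ 0 ∧ opNorm (N t) j ≠ 0 := by
    refine (Finset.eventually_all _).2 fun j _ => ?_
    obtain ⟨C, hC⟩ := (recurrence_hasNonanalyticTerm hs hN hN0 hNM j).2.2.2
    have h0 := (laguerre_recurrence_at_zero hs hN hN0 j).1
    exact ((hC.tendsto hs).eventually_ne h0).and (hC.1.tendsto_right.eventually_ne h0)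
  exact this.mono fun t h j hj => h j (Finset.mem_range.2 (by omega))


omit hN in
-- `b_0 = M_1 / M_0`, and only the denominator has a nonanalytic term at this order.
lemma opDiag_zero_hasNonanalyticTerm (hB : B 1 = 0) (hN1 : N 0 1 = (1 + s) * N 0 0) :
    HasNonanalyticTerm s (fun t => opDiag (M t) 0) (fun t => opDiag (N t) 0)
      (-(1 + s) * B 0 / N 0 0) := by
  have e : ∀ M : ℕ → ℂ, opDiag M 0 = M 1 * (M 0)⁻¹ := fun M => by
    simp [opDiag, opNorm, monicOP, momentFunctional_eq_sum M (1 : ℂ[X]) (N := 1) (by simp),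
      momentFunctional_eq_sum M (X : ℂ[X]) (N := 2) (by simp),
      div_eq_mul_inv, coeff_X, coeff_one]
  simp only [e]
  have := (hNM 1).mul hs ((hNM 0).inv hs hN0)
  rw [hB, hN1] at this
  convert this using 1
  field_simp
  ring

end

section

variable {α μ : ℝ} {N M : ℝ → ℕ → ℂ} {B : ℕ → ℂ} (hs : 0 < α + μ)
  (hN : ∀ k : ℕ, N 0 (k + 1) = (1 + α + μ + k) * N 0 k) (hN0 : N 0 0 ≠ 0)
  (hNM : ∀ k, HasNonanalyticTerm (α + μ) (fun t => M t k) (fun t => N t k) (B k))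
  (hfN : ∀ t : ℝ, 0 < t → MomentFlowAt (1 + α + μ) N t)
  (hfM : ∀ t : ℝ, 0 < t → MomentFlowAt (1 + α + μ) M t)
  (hPN : ∀ᶠ t : ℝ in 𝓝[>] 0, PearsonRelation α μ t (N t))
  (hPM : ∀ᶠ t : ℝ in 𝓝[>] 0, PearsonRelation α μ t (M t))

lemma opTheta_hasNonanalyticTerm {n : ℕ} {b : ℂ} (hb : HasNonanalyticTerm (α + μ)
      (fun t => opDiag (M t) n) (fun t => opDiag (N t) n) b) :
    HasNonanalyticTerm (α + μ) (fun t => opTheta α μ t (M t) n) (fun t => opTheta α μ t (N t) n) b := by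
  have h1 : HasNonanalyticTerm (α + μ) (fun t : ℝ => -2 * n - 1 - α - μ - t)
      (fun t : ℝ => (-2 * n - 1 - α - μ - t : ℂ)) 0 :=
    .of_analyticAt (analyticAt_const.sub (Complex.ofRealCLM.analyticAt 0))
  have := hb.add h1
  rw [add_zero] at this
  simp only [opTheta]
  convert this using 3 <;> ring

include hs hN hN0

lemma opTheta_at_zero (n : ℕ) : opTheta α μ 0 (N 0) n = 0 := by
  have := (laguerre_recurrence_at_zero (s := α + μ) hs (by push_cast; simpa [add_assoc] using hN) hN0 n).2.1
  rw [opTheta, this]; push_cast; ring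

include hNM hfN hfM hPN hPM

/-- The ratio of the nonanalytic terms of `θ_n` and `κ_n`. -/
lemma nonanalytic_relations (n : ℕ) {b : ℂ} (hb : HasNonanalyticTerm (α + μ)
      (fun t => opDiag (M t) n) (fun t => opDiag (N t) n) b) :
    HasNonanalyticTerm (α + μ) (fun t => opKappa μ t (M t) n) (fun t => opKappa μ t (N t) n)
      (-n * b) ∧
    ∃ d, HasNonanalyticTerm (α + μ) (fun t => opSum (M t) n) (fun t => opSum (N t) n) d ∧
      (1 + α + μ) * d = n * b := by
  have hN' : ∀ k : ℕ, N 0 (k + 1) = (1 + (α + μ : ℝ) + k) * N 0 k := by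
    push_cast; simpa [add_assoc] using hN
  obtain ⟨-, ⟨a, ha⟩, ⟨d, hd⟩, -⟩ := recurrence_hasNonanalyticTerm hs hN' hN0 hNM n
  have hne := eventually_opNorm_ne_zero hs hN' hN0 hNM n
  have hpos : ∀ᶠ t : ℝ in 𝓝[>] 0, 0 < t := self_mem_nhdsWithin
  have hmul : ∀ {f g : ℝ → ℂ} {c : ℂ}, HasNonanalyticTerm (α + μ) f g c → ∀ e : ℂ,
      HasNonanalyticTerm (α + μ) (fun t => e * f t) (fun t => e * g t) (e * c) := fun h e => by
    have := (HasNonanalyticTerm.of_analyticAt (analyticAt_const (v := e))).mul hs h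
    simpa [mul_comm] using this
  have hid : HasNonanalyticTerm (α + μ) (fun t : ℝ => (t : ℂ)) (fun t : ℝ => (t : ℂ)) 0 :=
    .of_analyticAt (Complex.ofRealCLM.analyticAt 0)
  -- Coefficients of `t^(1+s)` in `t S' = S - a_n²`, where `S` is the sum of the `b_i`.
  have h1 : a - d = -(1 + α + μ) * d := by
    have := HasNonanalyticTerm.of_hasDerivAt hd (hd.add (hmul ha (-1)))
      (by filter_upwards [hne, hpos] with t h ht
          refine ((hfM t ht).hasDerivAt_opSum n fun j hj => (h j hj.le).1).congr_deriv (by ring))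
      (by filter_upwards [hne, hpos] with t h ht
          refine ((hfN t ht).hasDerivAt_opSum n fun j hj => (h j hj.le).2).congr_deriv (by ring))
    push_cast at this
    linear_combination -this
  have hκ : HasNonanalyticTerm (α + μ) (fun t => opKappa μ t (M t) n) (fun t => opKappa μ t (N t) n)
      (a - d) := by
    have := ((hmul hid ((n : ℂ) + μ / 2)).add ha).add (hmul hd (-1))
    simp only [opKappa]
    convert this using 3 <;> ring
  have hθ := opTheta_hasNonanalyticTerm hb
  -- Coefficients of `t^(1+s)` in the equation for `θ_n`; the quadratic term drops out because the
  -- analytic part of `θ_n` vanishes at `0`.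
  have h2 : 2 * (a - d) = -2 * n * b := by
    have h := ((hmul hθ (1 + 2 * n + α + μ)).add (hmul hκ 2)).add (hθ.mul hs (hθ.add hid))
    have := HasNonanalyticTerm.of_hasDerivAt hθ h
      (by filter_upwards [hne, hpos, hPM] with t h ht hp
          exact MomentFlowAt.hasDerivAt_opTheta ht.ne' (hfM t ht) hp n fun j hj => (h j hj).1)
      (by filter_upwards [hne, hpos, hPN] with t h ht hp
          exact MomentFlowAt.hasDerivAt_opTheta ht.ne' (hfN t ht) hp n fun j hj => (h j hj).2)
    rw [Complex.ofReal_zero, opTheta_at_zero hs hN hN0 n] at this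
    push_cast at this
    linear_combination this
  have h3 : a - d = -n * b := by linear_combination h2 / 2
  refine ⟨h3 ▸ hκ, d, hd, ?_⟩
  linear_combination h1 - h3

/-- The nonanalytic term of `b_n`. -/
lemma opDiag_hasNonanalyticTerm (hB : B 1 = 0) (n : ℕ) :
    HasNonanalyticTerm (α + μ) (fun t => opDiag (M t) n) (fun t => opDiag (N t) n)
      (-B 0 / N 0 0 * (Real.Gamma (α + μ + n + 1) * (1 + α + μ)
        / (n.factorial * Real.Gamma (α + μ + 1)) : ℝ)) := by
  have hN' : ∀ k : ℕ, N 0 (k + 1) = (1 + (α + μ : ℝ) + k) * N 0 k := by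
    push_cast; simpa [add_assoc] using hN
  have hΓ : Real.Gamma (α + μ + 1) ≠ 0 := (Real.Gamma_pos_of_pos (by linarith)).ne'
  induction n with
  | zero =>
    have := opDiag_zero_hasNonanalyticTerm hs hN0 hNM hB (by simpa using hN' 0)
    convert this using 1
    simp only [Nat.cast_zero, add_zero, Nat.factorial_zero, Nat.cast_one, one_mul]
    rw [mul_comm (Real.Gamma _), mul_div_cancel_right₀ _ hΓ]
    push_cast; ring
  | succ n ih =>
    obtain ⟨⟨b, hb⟩, -⟩ := recurrence_hasNonanalyticTerm hs hN' hN0 hNM (n + 1)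
    obtain ⟨-, d, hd, h1⟩ := nonanalytic_relations hs hN hN0 hNM hfN hfM hPN hPM n ih
    obtain ⟨-, d', hd', h2⟩ := nonanalytic_relations hs hN hN0 hNM hfN hfM hPN hPM (n + 1) hb
    -- The nonanalytic coefficients satisfy `(1+s) d_n = n β_n` and `d_{n+1} = d_n + β_n`, where
    -- `β_n` belongs to `b_n` and `d_n` to the sum. Hence `(n+1) β_{n+1} = (n+1+s) β_n`, the
    -- recursion of the Gamma quotient.
    have h3 := hd.add ih
    simp only [← opSum_succ] at h3
    have h4 := h3.unique hd'
    convert hb using 1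
    have hn : ((n : ℂ) + 1) ≠ 0 := by exact_mod_cast n.succ_ne_zero
    refine mul_left_cancel₀ hn ?_
    push_cast at h2
    rw [← h2, ← h4, mul_add (1 + (α : ℂ) + μ), h1]
    have hg : Real.Gamma (α + μ + (n + 1 : ℕ) + 1) = (α + μ + n + 1) * Real.Gamma (α + μ + n + 1) := by
      rw [← Real.Gamma_add_one (by positivity)]; push_cast; ring_nf
    rw [hg, Nat.factorial_succ]
    push_cast
    have hΓ' : (Real.Gamma (α + μ + 1) : ℂ) ≠ 0 := by exact_mod_cast hΓ
    have hf : (n.factorial : ℂ) ≠ 0 := by exact_mod_cast n.factorial_ne_zero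
    field_simp
    ring

end


/-! ### The reduced system and the Taylor coefficients. -/

/-- The differential system and the two first integrals satisfied by `u = θ/t`, `v = κ/t`,
`D = a_n²` and `r = a_n² θ_{n-1}/t`. -/
structure ReducedSystemAt (α μ : ℝ) (n : ℕ) (u v D r : ℝ → ℂ) (t : ℝ) : Prop where
  hasDerivAt_u : HasDerivAt u (((2 * n + α + μ) * u t + 2 * v t) / t + u t * (u t + 1)) t
  hasDerivAt_v : HasDerivAt v ((r t - D t * u t) / t) t
  hasDerivAt_D : HasDerivAt D (r t - D t * u t) t
  quad : v t ^ 2 - μ ^ 2 / 4 = u t * r t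
  quad' : (n + α + μ / 2 - v t) * (n + μ / 2 - v t) = (u t + 1) * (r t + D t)

lemma ReducedSystemAt.of_moments {α μ : ℝ} {n : ℕ} {t : ℝ} (ht : 0 < t) {M : ℝ → ℕ → ℂ}
    (hM : ∀ᶠ x in 𝓝 t, MomentFlowAt (1 + α + μ) M x)
    (hP : ∀ᶠ x in 𝓝 t, PearsonRelation α μ (x : ℝ) (M x))
    (hn : ∀ j ≤ n, opNorm (M t) j ≠ 0) :
    ReducedSystemAt α μ n (fun t => opTheta α μ t (M t) n / t) (fun t => opKappa μ t (M t) n / t)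
      (fun t => opOff (M t) n) (fun t => opOff (M t) n * opTheta α μ t (M t) (n - 1) / t) t := by
  have ht' : (t : ℂ) ≠ 0 := by exact_mod_cast ht.ne'
  have hid := Complex.ofRealCLM.hasDerivAt (x := t)
  have hMt := hM.self_of_nhds
  have hθ := hMt.hasDerivAt_opTheta ht.ne' hP.self_of_nhds n hn
  have hκ := hMt.hasDerivAt_opKappa (α := α) ht.ne' n hn
  obtain ⟨q1, q2⟩ := MomentFlowAt.quadratic_relations ht.ne' hM hP n hn
  refine ⟨(hθ.div hid ht').congr_deriv ?_, (hκ.div hid ht').congr_deriv ?_,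
    (hMt.hasDerivAt_opOff n hn).congr_deriv ?_, ?_, ?_⟩
  · simp; field_simp; ring
  · simp; field_simp; ring
  -- For `n = 0` the index `n - 1` is truncated, but there `a_0² = 0`.
  · rcases Nat.eq_zero_or_pos n with rfl | h
    · simp [opOff]
    · have hc : ((n - 1 : ℕ) : ℂ) = n - 1 := by push_cast [Nat.cast_sub h]; ring
      simp only [opTheta, hc]; field_simp; ring
  · field_simp; linear_combination 4 * q1
  · field_simp; linear_combination 4 * q2

lemma eq_zero_of_eventually_right {F : ℝ → ℂ} (hF : ContinuousAt F 0) (h : ∀ᶠ t in 𝓝[>] 0, F t = 0) :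
    F 0 = 0 :=
  tendsto_nhds_unique (hF.tendsto.mono_left (nhdsWithin_le_nhds (s := Ioi 0)))
    (tendsto_const_nhds.congr' (h.mono fun _ h => h.symm))

/-- The initial Taylor coefficients of an analytic solution of the reduced system. -/
lemma ReducedSystemAt.taylor {α μ : ℝ} {n : ℕ} (hs : 0 < α + μ) (hs1 : α + μ ≠ 1)
    {u v D r U V E R : ℝ → ℂ} (hU : AnalyticAt ℝ U 0) (hV : AnalyticAt ℝ V 0)
    (hE : AnalyticAt ℝ E 0) (hR : AnalyticAt ℝ R 0)
    (eu : ∀ t, u t = u 0 + t * U t) (ev : ∀ t, v t = v 0 + t * V t)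
    (eD : ∀ t, D t = D 0 + t * E t) (er : ∀ t, r t = r 0 + t * R t)
    (hD0 : D 0 = n * (n + α + μ))
    (h : ∀ᶠ t in 𝓝[>] 0, ReducedSystemAt α μ n u v D r t) :
    u 0 = -μ / (α + μ) ∧ v 0 = μ * (2 * n + α + μ) / (2 * (α + μ)) ∧
    U 0 = α * μ * (2 * n + 1 + α + μ) / (((α + μ) ^ 2 - 1) * (α + μ) ^ 2) ∧
    V 0 = -(2 * n * α * μ * (n + α + μ)) / (((α + μ) ^ 2 - 1) * (α + μ) ^ 2) := by
  have hsC : (α : ℂ) + μ ≠ 0 := by exact_mod_cast hs.ne'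
  have hpos : ∀ᶠ t : ℝ in 𝓝[>] 0, (t : ℂ) ≠ 0 := by
    filter_upwards [self_mem_nhdsWithin] with t (ht : 0 < t)
    exact_mod_cast ht.ne'
  have hder : ∀ {f F : ℝ → ℂ}, AnalyticAt ℝ F 0 → (∀ t, f t = f 0 + t * F t) →
      AnalyticAt ℝ f 0 ∧ deriv f 0 = F 0 := fun {f F} hF e => by
    have e' : f = fun t : ℝ => f 0 + t * F t := funext e
    constructor
    · rw [e']; exact analyticAt_const.add ((Complex.ofRealCLM.analyticAt 0).mul hF)
    · have := ((Complex.ofRealCLM.hasDerivAt (x := 0)).mul hF.differentiableAt.hasDerivAt).const_add (f 0)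
      rw [e']
      refine (HasDerivAt.deriv this).trans ?_
      simp
  obtain ⟨au, du⟩ := hder hU eu
  obtain ⟨av, dv⟩ := hder hV ev
  obtain ⟨aD, dD⟩ := hder hE eD
  obtain ⟨ar, -⟩ := hder hR er
  have cu := au.continuousAt
  have cv := av.continuousAt
  have cD := aD.continuousAt
  have cr := ar.continuousAt
  have cU := hU.continuousAt
  have cV := hV.continuousAt
  have cE := hE.continuousAt
  have cR := hR.continuousAt
  have cdu := au.deriv.continuousAt
  have cdv := av.deriv.continuousAt
  have cdD := aD.deriv.continuousAt
  have ct : ContinuousAt (fun t : ℝ => (t : ℂ)) 0 := Complex.continuous_ofReal.continuousAt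
  -- zeroth order
  have z1 := eq_zero_of_eventually_right
    (F := fun t : ℝ => t * (deriv u t - u t * (u t + 1)) - ((2 * n + α + μ) * u t + 2 * v t)) (by fun_prop) (by
      filter_upwards [h, hpos] with t h ht
      rw [h.hasDerivAt_u.deriv]; field_simp; ring)
  have z2 := eq_zero_of_eventually_right (F := fun t : ℝ => t * deriv v t - (r t - D t * u t))
    (by fun_prop) (by
      filter_upwards [h, hpos] with t h ht
      rw [h.hasDerivAt_v.deriv]; field_simp; ring)
  -- The system gives `D' = t v'`, so `D` has no linear term.
  have z3 := eq_zero_of_eventually_right (F := fun t : ℝ => deriv D t - t * deriv v t)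
    (by fun_prop) (by
      filter_upwards [h, hpos] with t h ht
      rw [h.hasDerivAt_v.deriv, h.hasDerivAt_D.deriv]; field_simp; ring)
  have z4 := eq_zero_of_eventually_right (F := fun t : ℝ => v t ^ 2 - μ ^ 2 / 4 - u t * r t)
    (by fun_prop) (by filter_upwards [h] with t h; rw [h.quad, sub_self])
  have z5 := eq_zero_of_eventually_right (F := fun t : ℝ => (n + α + μ / 2 - v t) * (n + μ / 2 - v t)
    - (u t + 1) * (r t + D t)) (by fun_prop) (by filter_upwards [h] with t h; rw [h.quad', sub_self])
  simp only [Complex.ofReal_zero, zero_mul, zero_sub, sub_zero, neg_eq_zero] at z1 z2 z3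
  rw [dD] at z3
  have y0 : v 0 = -(2 * n + α + μ) * u 0 / 2 := by linear_combination z1 / 2
  have r0 : r 0 = n * (n + α + μ) * u 0 := by rw [← hD0]; linear_combination z2
  -- The difference of the two quadratic relations is linear in `u 0`, because `(2n+s)² - 4n(n+s) =
  -- s²` for `s = α + μ`.
  have x0 : u 0 = -μ / (α + μ) := by
    rw [r0, y0] at z4 z5
    rw [hD0] at z5
    rw [eq_div_iff hsC]
    refine mul_left_cancel₀ hsC ?_
    linear_combination 2 * (z5 - z4)
  -- first order
  have w1 := eq_zero_of_eventually_right
    (F := fun t : ℝ => (deriv u t - u t * (u t + 1)) - ((2 * n + α + μ) * U t + 2 * V t)) (by fun_prop) (by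
      filter_upwards [h, hpos] with t h ht
      rw [h.hasDerivAt_u.deriv]
      refine mul_left_cancel₀ ht ?_
      field_simp
      rw [eu t, ev t]
      linear_combination z1)
  have w2 := eq_zero_of_eventually_right
    (F := fun t : ℝ => deriv v t - (R t - D 0 * U t - E t * u t)) (by fun_prop) (by
      filter_upwards [h, hpos] with t h ht
      rw [h.hasDerivAt_v.deriv]
      refine mul_left_cancel₀ ht ?_
      field_simp
      rw [eu t, er t, eD t]
      linear_combination z2)
  have w4 := eq_zero_of_eventually_right
    (F := fun t : ℝ => 2 * v 0 * V t + t * V t ^ 2 - u 0 * R t - U t * r t) (by fun_prop) (by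
      filter_upwards [h, hpos] with t h ht
      have := h.quad
      refine mul_left_cancel₀ ht ?_
      rw [ev t, eu t, er t] at this
      rw [er t]
      linear_combination this - z4)
  have w5 := eq_zero_of_eventually_right
    (F := fun t : ℝ => -(2 * n + α + μ) * V t + 2 * v 0 * V t + t * V t ^ 2 - (u 0 + 1) * (R t + E t)
      - U t * (r t + D t)) (by fun_prop) (by
      filter_upwards [h, hpos] with t h ht
      have := h.quad'
      refine mul_left_cancel₀ ht ?_
      rw [ev t, eu t, er t, eD t] at this
      rw [er t, eD t]
      linear_combination this - z5)
  simp only [Complex.ofReal_zero, zero_mul, add_zero, du, dv, z3, sub_zero] at w1 w2 w4 w5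
  rw [hD0] at w2 w5
  have hm : (1 + 2 * n + α + μ : ℂ) ≠ 0 := by
    have : (1 + 2 * n + α + μ : ℝ) ≠ 0 := by
      have : (0 : ℝ) ≤ n := Nat.cast_nonneg n
      linarith
    exact_mod_cast this
  have hs2 : ((α : ℂ) + μ) ^ 2 - 1 ≠ 0 := by
    have : (α + μ) ^ 2 - 1 ≠ 0 := by
      intro h0
      have : (α + μ - 1) * (α + μ + 1) = 0 := by linear_combination h0
      rcases mul_eq_zero.1 this with h | h
      · exact hs1 (by linarith)
      · linarith
    exact_mod_cast this
  -- In this combination `R 0` and the terms with `v 0` and `u 0` cancel, leaving a linear relation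
  -- between `U 0` and `V 0`. Together with `w1` it has determinant proportional to `(α + μ)² - 1`,
  -- which explains the denominators.
  have hlin : (1 + 2 * n + α + μ) * V 0 + 2 * (n * (n + α + μ)) * U 0 = 0 := by
    linear_combination w4 - w5 + w2
  have hU0 : (((α : ℂ) + μ) ^ 2 - 1) * U 0 = -(1 + 2 * n + α + μ) * (u 0 * (u 0 + 1)) := by
    linear_combination -(1 + 2 * n + α + μ : ℂ) * w1 - 2 * hlin
  have hx : u 0 * (u 0 + 1) = -(α * μ) / (α + μ) ^ 2 := by
    rw [x0]; field_simp; ring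
  rw [hx] at hU0
  have hU1 : U 0 = α * μ * (2 * n + 1 + α + μ) / (((α + μ) ^ 2 - 1) * (α + μ) ^ 2) := by
    refine mul_left_cancel₀ hs2 ?_
    rw [hU0]; field_simp; ring
  refine ⟨x0, ?_, hU1, ?_⟩
  · rw [y0, x0]; field_simp
  · refine mul_left_cancel₀ hm ?_
    rw [hU1] at hlin
    rw [← sub_eq_zero, ← hlin]
    field_simp
    ring


section

variable {α μ : ℝ} {N M : ℝ → ℕ → ℂ} (hs : 0 < α + μ)
  (hN : ∀ k : ℕ, N 0 (k + 1) = (1 + α + μ + k) * N 0 k) (hN0 : N 0 0 ≠ 0)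
  (hNA : ∀ k, AnalyticAt ℝ (fun t => N t k) 0)
include hs hN hN0 hNA

lemma analyticAt_theta_kappa_opOff (n : ℕ) :
    AnalyticAt ℝ (fun t => opTheta α μ t (N t) n) 0 ∧ AnalyticAt ℝ (fun t => opKappa μ t (N t) n) 0 ∧
      AnalyticAt ℝ (fun t => opOff (N t) n) 0 ∧ opOff (N 0) n = n * (n + α + μ) ∧
      opTheta α μ (0 : ℝ) (N 0) n = 0 ∧ opKappa μ (0 : ℝ) (N 0) n = 0 := by
  have hN' : ∀ k : ℕ, N 0 (k + 1) = (1 + (α + μ : ℝ) + k) * N 0 k := by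
    push_cast; simpa [add_assoc] using hN
  obtain ⟨h1, h2, h3, -⟩ := isFunctionRing_analyticAt.recurrence_mem (M := N) hNA n
    (fun j _ h => h.inv (laguerre_recurrence_at_zero hs hN' hN0 j).1)
  obtain ⟨-, -, h4, h5⟩ := laguerre_recurrence_at_zero hs hN' hN0 n
  have hid : AnalyticAt ℝ (fun t : ℝ => (t : ℂ)) 0 := Complex.ofRealCLM.analyticAt 0
  refine ⟨((((h1.sub analyticAt_const).sub analyticAt_const).sub analyticAt_const).sub
    analyticAt_const).sub hid, ((analyticAt_const.mul hid).add h2).sub h3, h2, ?_, ?_, ?_⟩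
  · rw [h4]; push_cast; ring
  · simpa using opTheta_at_zero hs hN hN0 n
  · rw [opKappa, h4, h5]; simp

/-- The analytic parts of `θ_n` and `κ_n` up to second order. -/
lemma taylor_theta_kappa (hs1 : α + μ ≠ 1) (hfN : ∀ t : ℝ, 0 < t → MomentFlowAt (1 + α + μ) N t)
    (hPN : ∀ᶠ t : ℝ in 𝓝[>] 0, PearsonRelation α μ t (N t)) (n : ℕ) :
    (fun t : ℝ => opTheta α μ t (N t) n - (-μ / (α + μ) * t
      + α * μ * (2 * n + 1 + α + μ) / (((α + μ) ^ 2 - 1) * (α + μ) ^ 2) * t ^ 2))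
        =O[𝓝 0] (fun t : ℝ => t ^ 3) ∧
    (fun t : ℝ => opKappa μ t (N t) n - (μ * (2 * n + α + μ) / (2 * (α + μ)) * t
      + -(2 * n * α * μ * (n + α + μ)) / (((α + μ) ^ 2 - 1) * (α + μ) ^ 2) * t ^ 2))
        =O[𝓝 0] (fun t : ℝ => t ^ 3) := by
  obtain ⟨aθ, aκ, aD, eD0, eθ0, eκ0⟩ := analyticAt_theta_kappa_opOff hs hN hN0 hNA n
  obtain ⟨aθ', -, -, -, eθ0', -⟩ := analyticAt_theta_kappa_opOff hs hN hN0 hNA (n - 1)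
  -- As `θ` and `κ` vanish at `0`, one division by `t` gives `u` and `v`; a second division exposes
  -- the coefficients of `t²`.
  obtain ⟨u, au, eu⟩ := aθ.exists_eq_add_mul
  obtain ⟨v, av, ev⟩ := aκ.exists_eq_add_mul
  obtain ⟨r, ar, er⟩ := (aD.mul aθ').exists_eq_add_mul
  obtain ⟨E, aE, eE⟩ := aD.exists_eq_add_mul
  obtain ⟨U, aU, eU⟩ := au.exists_eq_add_mul
  obtain ⟨V, aV, eV⟩ := av.exists_eq_add_mul
  obtain ⟨R, aR, eR⟩ := ar.exists_eq_add_mul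
  simp only [eθ0, eκ0, zero_add] at eu ev
  simp only [Pi.mul_apply, eθ0', mul_zero, zero_add] at er
  have hnear : ∀ {p : ℝ → Prop}, (∀ᶠ t : ℝ in 𝓝[>] 0, p t) → ∀ᶠ t in 𝓝[>] 0, ∀ᶠ x in 𝓝 t, p x := by
    intro p hp
    obtain ⟨ε, hε, hb⟩ := mem_nhdsGT_iff_exists_Ioo_subset.1 hp
    filter_upwards [Ioo_mem_nhdsGT (show (0 : ℝ) < ε from hε)] with t ht
    filter_upwards [isOpen_Ioo.mem_nhds ht] with x hx using hb hx
  have hN' : ∀ k : ℕ, N 0 (k + 1) = (1 + (α + μ : ℝ) + k) * N 0 k := by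
    push_cast; simpa [add_assoc] using hN
  have hne := eventually_opNorm_ne_zero (M := N) (B := fun _ => 0) hs hN' hN0
    (fun k => .of_analyticAt (hNA k)) n
  have hsys : ∀ᶠ t in 𝓝[>] 0, ReducedSystemAt α μ n u v (fun t => opOff (N t) n) r t := by
    filter_upwards [hne, hnear hPN, self_mem_nhdsWithin] with t h hp (ht : 0 < t)
    have hM : ∀ᶠ x in 𝓝 t, MomentFlowAt (1 + α + μ) N x := by
      filter_upwards [lt_mem_nhds ht] with x hx using hfN x hx
    have := ReducedSystemAt.of_moments ht hM hp fun j hj => (h j hj).1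
    have hq : ∀ {f g : ℝ → ℂ}, (∀ x : ℝ, f x = x * g x) → (fun x : ℝ => f x / x) =ᶠ[𝓝 t] g := by
      intro f g h
      filter_upwards [lt_mem_nhds ht] with x hx
      have : (x : ℂ) ≠ 0 := by exact_mod_cast hx.ne'
      rw [h, mul_div_cancel_left₀ _ this]
    have h1 := hq eu
    have h2 := hq ev
    have h3 := (hq er).self_of_nhds
    have k1 := h1.self_of_nhds
    have k2 := h2.self_of_nhds
    obtain ⟨t1, t2, t3, t4, t5⟩ := this
    simp only at k1 k2 h3 t1 t2 t3 t4 t5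
    rw [k1, k2] at t1
    rw [h3, k1] at t2 t3
    rw [k2, k1, h3] at t4 t5
    exact ⟨t1.congr_of_eventuallyEq h1.symm, t2.congr_of_eventuallyEq h2.symm, t3, t4, t5⟩
  obtain ⟨x0, y0, x1, y1⟩ := ReducedSystemAt.taylor hs hs1 aU aV aE aR eU eV eE eR eD0 hsys
  have hO : ∀ {f g G : ℝ → ℂ}, (∀ t : ℝ, f t = t * g t) → (∀ t : ℝ, g t = g 0 + t * G t) →
      AnalyticAt ℝ G 0 → (fun t : ℝ => f t - (g 0 * t + G 0 * t ^ 2)) =O[𝓝 0] (fun t : ℝ => t ^ 3) := by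
    intro f g G hf hg hG
    have h1 : (fun t => G t - G 0) =O[𝓝 0] fun t : ℝ => t := by
      simpa using hG.differentiableAt.isBigO_sub
    have h2 : (fun t : ℝ => (t : ℂ) ^ 2) =O[𝓝 0] fun t : ℝ => t ^ 2 :=
      IsBigO.of_bound 1 (Eventually.of_forall fun t => by simp)
    refine (h2.mul h1).congr (fun t => ?_) (fun t => by ring)
    rw [hf, hg t]; ring
  have o1 := hO eu eU aU
  have o2 := hO ev eV aV
  rw [x0, x1] at o1
  rw [y0, y1] at o2
  exact ⟨o1, o2⟩

end

/-- The expansions of `θ_n` and `κ_n` as functions of the moments. -/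
lemma smallTimeExpansions_moments {ζ α μ : ℝ} (hζ : ζ < 1) (hα : -1 < α) (hμ : -1 < μ) (ω : ℂ)
    (n : ℕ) (hs : 0 < α + μ) (hsZ : ∀ k : ℤ, α + μ ≠ k) :
    SmallTimeExpansions ζ α μ ω n (fun t => opTheta α μ t (laguerreMoment ζ α μ ω t) n)
      (fun t => opKappa μ t (laguerreMoment ζ α μ ω t) n) ∧
    (∀ᶠ t in 𝓝[>] 0, ∀ j ≤ n, opNorm (laguerreMoment ζ α μ ω t) j ≠ 0) ∧
    VanishesToOrder (fun t => opOff (laguerreMoment ζ α μ ω t) n - n * (n + α + μ)) 1 := by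
  obtain ⟨N, hNA, hN, hfN, hPN, hN00, hNM⟩ := exists_analytic_moments ζ ω hα hμ hs hsZ
  have hζ' : (1 - ζ : ℂ) ≠ 0 := by
    have : (1 - ζ : ℝ) ≠ 0 := by linarith
    exact_mod_cast this
  have hΓ : (Real.Gamma (α + μ + 1) : ℂ) ≠ 0 := by
    exact_mod_cast (Real.Gamma_pos_of_pos (by linarith)).ne'
  have hN0 : N 0 0 ≠ 0 := by rw [hN00]; exact mul_ne_zero hζ' hΓ
  have hs1 : α + μ ≠ 1 := fun h => hsZ 1 (by simpa using h)
  have hfM : ∀ t : ℝ, 0 < t → MomentFlowAt (1 + α + μ) (laguerreMoment ζ α μ ω) t := fun t ht =>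
    momentFlowAt_laguerreMoment hα hμ ht
  have hPM : ∀ᶠ t : ℝ in 𝓝[>] 0, PearsonRelation α μ t (laguerreMoment ζ α μ ω t) := by
    filter_upwards [self_mem_nhdsWithin] with t ht
    exact pearsonRelation_laguerreMoment hα hμ ht
  obtain ⟨t1, t2⟩ := taylor_theta_kappa hs hN hN0 hNA hs1 hfN hPN n
  obtain ⟨aθ, aκ, aD, eD, -, -⟩ := analyticAt_theta_kappa_opOff hs hN hN0 hNA n
  have hb := opDiag_hasNonanalyticTerm hs hN hN0 hNM hfN hfM hPN hPM (by simp) n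
  have hκ := (nonanalytic_relations hs hN hN0 hNM hfN hfM hPN hPM n hb).1
  have hθ := opTheta_hasNonanalyticTerm hb
  -- Division by `N 0 0` turns `ω - (1-ζ) S`, with `S` the quotient of sines, into `ω/(1-ζ) - S`,
  -- and `Γ(s+2) = (s+1) Γ(s+1)` cancels the factor `1 + s`.
  have hL : (-(if (0 : ℕ) = 0 then (ω - (1 - ζ) * (Real.sin (Real.pi * μ) / Real.sin (Real.pi * (α + μ)) : ℝ))
      * (Real.Gamma (α + 1) * Real.Gamma (μ + 1) / Real.Gamma (α + μ + 2) : ℝ) else 0) / N 0 0 *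
      (Real.Gamma (α + μ + n + 1) * (1 + α + μ) / (n.factorial * Real.Gamma (α + μ + 1)) : ℝ) : ℂ)
      = -nonanalyticCoeff ζ α μ ω n := by
    have hg : Real.Gamma (α + μ + 2) = (α + μ + 1) * Real.Gamma (α + μ + 1) := by
      rw [← Real.Gamma_add_one (by linarith)]; ring_nf
    have hs' : (α + μ + 1 : ℂ) ≠ 0 := by
      have : (α + μ + 1 : ℝ) ≠ 0 := by linarith
      exact_mod_cast this
    have hf : (n.factorial : ℂ) ≠ 0 := by exact_mod_cast n.factorial_ne_zero
    rw [if_pos rfl, hN00, hg, nonanalyticCoeff]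
    generalize (Real.sin (Real.pi * μ) / Real.sin (Real.pi * (α + μ)) : ℝ) = S
    push_cast
    field_simp
    ring
  have hN' : ∀ k : ℕ, N 0 (k + 1) = (1 + (α + μ : ℝ) + k) * N 0 k := by
    push_cast; simpa [add_assoc] using hN
  rw [hL] at hκ hθ
  refine ⟨⟨⟨_, aθ, t1, hθ.2⟩, ⟨_, aκ, t2, ?_⟩⟩, ?_, ?_⟩
  · have := hκ.2
    rw [neg_mul_neg] at this
    exact this
  · exact (eventually_opNorm_ne_zero hs hN' hN0 hNM n).mono fun t h j hj => (h j hj).1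
  · obtain ⟨-, ⟨d, hd⟩, -⟩ := recurrence_hasNonanalyticTerm hs hN' hN0 hNM n
    have := (hd.diff_order.mono (by linarith : (1 : ℝ) ≤ 1 + (α + μ))).add aD.sub_zero_vanishesToOrder
    rw [eD] at this
    exact this.congr' (Eventually.of_forall fun t => by ring)


/-! ### The linear system for the difference of two solutions. -/

/-- If `f → 0` at `0⁺` and `‖f'‖ ≤ K t ^ p` then `‖f‖ ≤ K t ^ (p+1)`. -/
lemma norm_le_rpow_of_hasDerivAt {f f' : ℝ → ℂ} {K p τ : ℝ} (hp : 0 ≤ p) (hK : 0 ≤ K)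
    (hd : ∀ t ∈ Ioo 0 τ, HasDerivAt f (f' t) t) (hb : ∀ t ∈ Ioo 0 τ, ‖f' t‖ ≤ K * t ^ p)
    (h0 : Tendsto f (𝓝[>] 0) (𝓝 0)) : ∀ t ∈ Ioo 0 τ, ‖f t‖ ≤ K * t ^ (p + 1) := by
  intro t ht
  have h1 : ∀ᶠ x in 𝓝[>] 0, ‖f t - f x‖ ≤ K * t ^ (p + 1) := by
    filter_upwards [Ioo_mem_nhdsGT ht.1] with x hx
    have := (convex_Icc x t).norm_image_sub_le_of_norm_hasDerivWithin_le (f := f) (f' := f')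
      (C := K * t ^ p)
      (fun y hy => (hd y ⟨hx.1.trans_le hy.1, hy.2.trans_lt ht.2⟩).hasDerivWithinAt)
      (fun y hy => (hb y ⟨hx.1.trans_le hy.1, hy.2.trans_lt ht.2⟩).trans (by
        have := hx.1.trans_le hy.1
        gcongr
        exact hy.2)) (left_mem_Icc.2 hx.2.le) (right_mem_Icc.2 hx.2.le)
    refine this.trans ?_
    rw [Real.norm_of_nonneg (by linarith [hx.2]), Real.rpow_add_one ht.1.ne', ← mul_assoc]
    have h2 : 0 ≤ K * t ^ p := mul_nonneg hK (Real.rpow_nonneg ht.1.le _)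
    gcongr
    linarith [hx.1]
  have h2 : Tendsto (fun x => ‖f t - f x‖) (𝓝[>] 0) (𝓝 ‖f t - 0‖) := (tendsto_const_nhds.sub h0).norm
  rw [sub_zero] at h2
  exact le_of_tendsto h2 h1

/-- An analytic function that vanishes to order `k` at `0⁺` is divisible by `t ^ k`. -/
lemma AnalyticAt.exists_eq_pow_mul {g : ℝ → ℂ} (hg : AnalyticAt ℝ g 0) (k : ℕ)
    (h : VanishesToOrder g k) : ∃ u : ℝ → ℂ, AnalyticAt ℝ u 0 ∧ ∀ t : ℝ, g t = t ^ k * u t := by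
  induction k with
  | zero => exact ⟨g, hg, fun t => by simp⟩
  | succ k ih =>
    obtain ⟨u, hu, e⟩ := ih (h.mono (by push_cast; linarith))
    obtain ⟨v, hv, e'⟩ := hu.exists_eq_add_mul
    have h1 : Tendsto (fun t => g t * ((t ^ (-(k : ℝ)) : ℝ) : ℂ)) (𝓝[>] 0) (𝓝 0) := by
      refine tendsto_mul_rpow_neg (a := k + 1) (by linarith) ?_
      simpa using h
    have h2 : Tendsto u (𝓝[>] 0) (𝓝 0) := by
      refine h1.congr' ?_
      filter_upwards [self_mem_nhdsWithin] with t (ht : 0 < t)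
      have : (t : ℂ) ≠ 0 := by exact_mod_cast ht.ne'
      rw [e, Real.rpow_neg ht.le, Real.rpow_natCast]
      push_cast
      field_simp
    have h3 : u 0 = 0 := tendsto_nhds_unique hu.tendsto_right h2
    exact ⟨v, hv, fun t => by rw [e, e', h3]; ring⟩

/-- Integration of `t ξ' = σ ξ + R`. -/
lemma norm_le_of_euler {ξ R : ℝ → ℂ} {σ C k τ : ℝ} (hC : 0 ≤ C) (hk : 0 ≤ k - σ)
    (hd : ∀ t ∈ Ioo 0 τ, HasDerivAt ξ ((σ * ξ t + R t) / t) t)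
    (hR : ∀ t ∈ Ioo 0 τ, ‖R t‖ ≤ C * t ^ (k + 1))
    (h0 : Tendsto (fun t => ξ t * ((t ^ (-σ) : ℝ) : ℂ)) (𝓝[>] 0) (𝓝 0)) :
    ∀ t ∈ Ioo 0 τ, ‖ξ t‖ ≤ C * t ^ (k + 1) := by
  -- The integrating factor is `t^(-σ)`; `h0` excludes the homogeneous solution.
  have hd' : ∀ t ∈ Ioo 0 τ, HasDerivAt (fun t => ξ t * ((t ^ (-σ) : ℝ) : ℂ))
      (R t * ((t ^ (-σ - 1) : ℝ) : ℂ)) t := fun t ht => by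
    have h1 := (Real.hasDerivAt_rpow_const (x := t) (p := -σ) (Or.inl ht.1.ne')).ofReal_comp
    refine ((hd t ht).mul h1).congr_deriv ?_
    have ht' : (t : ℂ) ≠ 0 := by exact_mod_cast ht.1.ne'
    have e : t ^ (-σ) = t ^ (-σ - 1) * t := by rw [← Real.rpow_add_one ht.1.ne']; ring_nf
    rw [e]
    push_cast
    field_simp
    ring
  intro t ht
  have := norm_le_rpow_of_hasDerivAt hk hC hd' (fun t ht => by
    rw [norm_mul, Complex.norm_real, Real.norm_of_nonneg (Real.rpow_nonneg ht.1.le _)]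
    calc ‖R t‖ * t ^ (-σ - 1) ≤ C * t ^ (k + 1) * t ^ (-σ - 1) := by
          have := ht.1
          gcongr; exact hR t ht
      _ = C * t ^ (k - σ) := by rw [mul_assoc, ← Real.rpow_add ht.1]; ring_nf) h0 t ht
  rw [norm_mul, Complex.norm_real, Real.norm_of_nonneg (Real.rpow_nonneg ht.1.le _)] at this
  have hp : 0 < t ^ (-σ) := Real.rpow_pos_of_pos ht.1 _
  refine le_of_mul_le_mul_right (this.trans_eq ?_) hp
  rw [mul_assoc, ← Real.rpow_add ht.1]; ring_nf

/-- The linear system for the difference of two solutions of the reduced system; `w = z - t y`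
where `z` is the difference of the `D`'s. -/
structure DifferenceSystem (m s K ε : ℝ) (x y w a b e : ℝ → ℂ) : Prop where
  hasDerivAt_x : ∀ t ∈ Ioo 0 ε, HasDerivAt x ((m * x t + 2 * y t) / t + a t * x t) t
  hasDerivAt_y : ∀ t ∈ Ioo 0 ε, HasDerivAt y
    ((-m * y t - (m ^ 2 - s ^ 2) / 2 * x t - b t * (w t + t * y t)) / t - e t * x t) t
  hasDerivAt_w : ∀ t ∈ Ioo 0 ε, HasDerivAt w (-y t) t
  bound_a : ∀ t ∈ Ioo 0 ε, ‖a t‖ ≤ K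
  bound_b : ∀ t ∈ Ioo 0 ε, ‖b t‖ ≤ K
  bound_e : ∀ t ∈ Ioo 0 ε, ‖e t‖ ≤ K
  tendsto_w : Tendsto w (𝓝[>] 0) (𝓝 0)

namespace DifferenceSystem

variable {m s K ε : ℝ} {x y w a b e : ℝ → ℂ}

/-- The remainder in the equation `t ξ' = σ ξ + …` for `ξ = (m + σ) x + 2 y`, `σ = ± s`. -/
lemma hasDerivAt_xi (h : DifferenceSystem m s K ε x y w a b e) {σ : ℝ} (hσ : σ ^ 2 = s ^ 2) :
    ∃ R : ℝ → ℂ, (∀ t ∈ Ioo 0 ε, HasDerivAt (fun t => (m + σ) * x t + 2 * y t)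
        ((σ * ((m + σ) * x t + 2 * y t) + R t) / t) t) ∧
      ∀ τ ∈ Ioc 0 ε, ε ≤ 1 → ∀ M k : ℝ, 0 ≤ M → 0 ≤ k →
        (∀ t ∈ Ioo 0 τ, ‖x t‖ ≤ M * t ^ k ∧ ‖y t‖ ≤ M * t ^ k) →
        ∀ t ∈ Ioo 0 τ, ‖R t‖ ≤ (|m + σ| + 6) * K * M * t ^ (k + 1) := by
  -- The row `(m + σ, 2)` is a left eigenvector, with eigenvalue `σ`, of the leading matrix with
  -- rows `(m, 2)` and `(-(m² - s²)/2, -m)`, because `σ² = s²`.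
  refine ⟨fun t => t * ((m + σ) * a t * x t - 2 * e t * x t) - 2 * b t * (w t + t * y t),
    fun t ht => ?_, fun τ hτ hε M k hM hk hb t ht => ?_⟩
  · refine (((h.hasDerivAt_x t ht).const_mul (m + σ : ℂ)).add
      ((h.hasDerivAt_y t ht).const_mul 2)).congr_deriv ?_
    have ht' : (t : ℂ) ≠ 0 := by exact_mod_cast ht.1.ne'
    have hσ' : (σ : ℂ) ^ 2 = s ^ 2 := by exact_mod_cast hσ
    field_simp
    linear_combination x t * (-hσ')
  · have htε : t ∈ Ioo 0 ε := ⟨ht.1, ht.2.trans_le hτ.2⟩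
    have ht1 : t ≤ 1 := htε.2.le.trans hε
    have ht0 := ht.1
    -- Since `w' = -y` and `w → 0`, integration gains a power of `t`. This is why `t y` is
    -- subtracted in `w`: the term is then of lower importance than `x` and `y`.
    have hw := norm_le_rpow_of_hasDerivAt (f := w) (f' := fun t => -y t) (τ := τ) hk hM
      (fun t ht => h.hasDerivAt_w t ⟨ht.1, ht.2.trans_le hτ.2⟩)
      (fun t ht => by rw [norm_neg]; exact (hb t ht).2) h.tendsto_w t ht
    obtain ⟨hx, hy⟩ := hb t ht
    have ha := h.bound_a t htε
    have hbb := h.bound_b t htε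
    have he := h.bound_e t htε
    have hK : 0 ≤ K := (norm_nonneg _).trans ha
    have hX : 0 ≤ M * t ^ k := mul_nonneg hM (Real.rpow_nonneg ht0.le _)
    have e1 : t ^ (k + 1) = t * t ^ k := by rw [Real.rpow_add_one ht0.ne']; ring
    have n1 : ‖(t : ℂ) * ((m + σ) * a t * x t - 2 * e t * x t)‖
        ≤ t * (|m + σ| * K * (M * t ^ k) + 2 * K * (M * t ^ k)) := by
      rw [norm_mul, Complex.norm_real, Real.norm_of_nonneg ht0.le]
      gcongr
      refine (norm_sub_le _ _).trans ?_
      rw [norm_mul, norm_mul, norm_mul, norm_mul, Complex.norm_two, ← Complex.ofReal_add,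
        Complex.norm_real, Real.norm_eq_abs]
      gcongr
    have n2 : ‖2 * b t * (w t + t * y t)‖ ≤ 2 * K * (M * t ^ (k + 1) + t * (M * t ^ k)) := by
      rw [norm_mul, norm_mul, Complex.norm_two]
      gcongr
      refine (norm_add_le _ _).trans ?_
      rw [norm_mul, Complex.norm_real, Real.norm_of_nonneg ht0.le]
      gcongr
    refine (norm_sub_le _ _).trans ((add_le_add n1 n2).trans_eq ?_)
    rw [e1]; ring

end DifferenceSystem

lemma exists_bound_of_vanishesToOrder {k ε : ℝ} {x y : ℝ → ℂ} (hε : 0 < ε)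
    (hx : VanishesToOrder x k) (hy : VanishesToOrder y k) : ∃ τ ∈ Ioc 0 ε, ∃ M : ℝ, 0 ≤ M ∧
      ∀ t ∈ Ioo 0 τ, ‖x t‖ ≤ M * t ^ k ∧ ‖y t‖ ≤ M * t ^ k := by
  obtain ⟨M₁, h₁⟩ := hx.bound
  obtain ⟨M₂, h₂⟩ := hy.bound
  obtain ⟨τ, hτ, hb⟩ := mem_nhdsGT_iff_exists_Ioo_subset.1 (inter_mem h₁ h₂)
  have hτ0 : (0 : ℝ) < τ := hτ
  refine ⟨min τ ε, ⟨lt_min hτ0 hε, min_le_right _ _⟩, max (max M₁ M₂) 0, le_max_right _ _,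
    fun t ht => ?_⟩
  have hp : 0 ≤ t ^ k := Real.rpow_nonneg ht.1.le _
  obtain ⟨b1, b2⟩ := hb ⟨ht.1, ht.2.trans_le (min_le_left _ _)⟩
  simp only [mem_ofPred_eq, Real.norm_of_nonneg hp] at b1 b2
  exact ⟨b1.trans (by gcongr; exact (le_max_left _ _).trans (le_max_left _ _)),
    b2.trans (by gcongr; exact (le_max_right _ _).trans (le_max_left _ _))⟩

lemma vanishesToOrder_of_bound {k τ M : ℝ} {x : ℝ → ℂ} (hτ : 0 < τ)
    (h : ∀ t ∈ Ioo 0 τ, ‖x t‖ ≤ M * t ^ k) : VanishesToOrder x k := by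
  refine IsBigO.of_bound M ?_
  filter_upwards [Ioo_mem_nhdsGT hτ] with t ht
  rw [Real.norm_of_nonneg (Real.rpow_nonneg ht.1.le _)]
  exact h t ht

namespace DifferenceSystem

variable {m s K ε : ℝ} {x y w a b e : ℝ → ℂ}

/-- One step of the bootstrap below the resonant order `s`. -/
lemma order_succ (h : DifferenceSystem m s K ε x y w a b e) (hs : 0 < s) (hε : 0 < ε) (hε1 : ε ≤ 1)
    (hK : 0 ≤ K) {gx gy : ℝ → ℂ} (agx : AnalyticAt ℝ gx 0) (agy : AnalyticAt ℝ gy 0)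
    (hgx : VanishesToOrder (fun t => x t - gx t) (1 + s))
    (hgy : VanishesToOrder (fun t => y t - gy t) (1 + s)) {k : ℕ} (hk : (k : ℝ) < 1 + s)
    (hks : s ≠ k) (hx : VanishesToOrder x k) (hy : VanishesToOrder y k) :
    VanishesToOrder x (min (k + 1 : ℕ) (1 + s)) ∧ VanishesToOrder y (min (k + 1 : ℕ) (1 + s)) := by
  have hk0 : (0 : ℝ) ≤ k := Nat.cast_nonneg k
  obtain ⟨τ, hτ, M, hM, hb⟩ := exists_bound_of_vanishesToOrder hε hx hy
  have hτε : Ioo 0 τ ⊆ Ioo 0 ε := Ioo_subset_Ioo_right hτ.2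
  obtain ⟨R₁, hd₁, hR₁⟩ := h.hasDerivAt_xi (σ := s) rfl
  obtain ⟨R₂, hd₂, hR₂⟩ := h.hasDerivAt_xi (σ := -s) (by ring)
  have hR₁' := vanishesToOrder_of_bound hτ.1 (hR₁ τ hτ hε1 M k hM hk0 hb)
  -- The component with exponent `-s` has no resonance at nonnegative orders and gains a full power
  -- at once.
  have hξ₂ : VanishesToOrder (fun t => (m + (-s : ℝ)) * x t + 2 * y t) (k + 1) := by
    refine vanishesToOrder_of_bound hτ.1 (norm_le_of_euler (by positivity) (by linarith)
      (fun t ht => hd₂ t (hτε ht)) (hR₂ τ hτ hε1 M k hM hk0 hb) ?_)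
    exact (((hx.const_mul _).add (hy.const_mul 2)).mul (vanishesToOrder_rpow _)).tendsto_zero
      (by linarith)
  set g : ℝ → ℂ := fun t => (m + s) * gx t + 2 * gy t with hg
  have ag : AnalyticAt ℝ g 0 := (analyticAt_const.mul agx).add (analyticAt_const.mul agy)
  have hξg : VanishesToOrder (fun t => ((m + s) * x t + 2 * y t) - g t) (1 + s) :=
    ((hgx.const_mul (m + s)).add (hgy.const_mul 2)).congr' (Eventually.of_forall fun t => by
      simp only [hg]; ring)
  have hgk : VanishesToOrder g k := (((hx.const_mul (m + s : ℂ)).add (hy.const_mul 2)).sub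
    (hξg.mono hk.le)).congr' (Eventually.of_forall fun t => by ring)
  obtain ⟨u, au, eu⟩ := ag.exists_eq_pow_mul k hgk
  have hlow : (k : ℝ) < min ((k : ℝ) + 1) (1 + s) := lt_min (by linarith) hk
  have hgu : VanishesToOrder (fun t : ℝ => g t - t ^ k * u 0) (k + 1) :=
    ((vanishesToOrder_pow k).mul au.sub_zero_vanishesToOrder).congr' (Eventually.of_forall fun t => by
      rw [eu]; ring)
  have hξu : VanishesToOrder (fun t => ((m + s) * x t + 2 * y t) - u 0 * ((t ^ (k : ℝ) : ℝ) : ℂ))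
      (min ((k : ℝ) + 1) (1 + s)) :=
    ((hξg.mono (min_le_right _ _)).add (hgu.mono (min_le_left _ _))).congr'
      (Eventually.of_forall fun t => by rw [Real.rpow_natCast]; push_cast; ring)
  have hξ'u : VanishesToOrder (fun t => (s * ((m + s) * x t + 2 * y t) + R₁ t)
      - (s * u 0) * ((t ^ (k : ℝ) : ℝ) : ℂ)) (min ((k : ℝ) + 1) (1 + s)) :=
    ((hξu.const_mul s).add (hR₁'.mono (min_le_left _ _))).congr'
      (Eventually.of_forall fun t => by ring)
  -- A leading term `u 0 * t^k` in the component with exponent `s` would satisfy `k u 0 = s u 0`; it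
  -- vanishes because `s ≠ k`.
  have hu0 : u 0 = 0 := by
    have := leading_coeff_of_hasDerivAt (tendsto_mul_rpow_neg hlow hξu)
      (tendsto_mul_rpow_neg hlow hξ'u) (by
        filter_upwards [Ioo_mem_nhdsGT hε] with t ht using hd₁ t ht)
    have h2 : ((s : ℂ) - k) * u 0 = 0 := by push_cast at this; linear_combination this
    refine (mul_eq_zero.1 h2).resolve_left (sub_ne_zero.2 ?_)
    exact_mod_cast hks
  simp only [hu0, zero_mul, sub_zero] at hξu
  have hx' : VanishesToOrder x (min ((k : ℝ) + 1) (1 + s)) := by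
    refine ((hξu.sub (hξ₂.mono (min_le_left _ _))).const_mul (2 * s : ℂ)⁻¹).congr'
      (Eventually.of_forall fun t => ?_)
    have : (s : ℂ) ≠ 0 := by exact_mod_cast hs.ne'
    push_cast; field_simp; ring
  have hy' : VanishesToOrder y (min ((k : ℝ) + 1) (1 + s)) :=
    ((hξu.sub (hx'.const_mul (m + s))).const_mul (2 : ℂ)⁻¹).congr'
      (Eventually.of_forall fun t => by ring)
  push_cast
  exact ⟨hx', hy'⟩

/-- Iterate `order_succ`: as `s` is not a natural number, no step meets the resonance. The cap `1 +
s` is the accuracy to which the difference is known to be analytic. -/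
lemma order_one_add (h : DifferenceSystem m s K ε x y w a b e) (hs : 0 < s) (hε : 0 < ε) (hε1 : ε ≤ 1)
    (hK : 0 ≤ K) (hsZ : ∀ k : ℕ, s ≠ k) {gx gy : ℝ → ℂ} (agx : AnalyticAt ℝ gx 0)
    (agy : AnalyticAt ℝ gy 0) (hgx : VanishesToOrder (fun t => x t - gx t) (1 + s))
    (hgy : VanishesToOrder (fun t => y t - gy t) (1 + s))
    (hx : VanishesToOrder x 0) (hy : VanishesToOrder y 0) :
    VanishesToOrder x (1 + s) ∧ VanishesToOrder y (1 + s) := by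
  have key : ∀ k : ℕ, VanishesToOrder x (min (k : ℝ) (1 + s)) ∧
      VanishesToOrder y (min (k : ℝ) (1 + s)) := by
    intro k
    induction k with
    | zero => exact ⟨hx.mono (by simp), hy.mono (by simp)⟩
    | succ k ih =>
      rcases lt_or_ge (k : ℝ) (1 + s) with hk | hk
      · rw [min_eq_left hk.le] at ih
        exact h.order_succ hs hε hε1 hK agx agy hgx hgy hk (hsZ k) ih.1 ih.2
      · rw [min_eq_right hk] at ih
        rwa [min_eq_right (hk.trans (by push_cast; linarith))]
  obtain ⟨k, hk⟩ := exists_nat_ge (1 + s)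
  have := key k
  rwa [min_eq_right hk] at this

/-- A solution that vanishes to an order above the resonance is zero. -/
lemma eventually_eq_zero (h : DifferenceSystem m s K ε x y w a b e) (hs : 0 < s) (hε : 0 < ε)
    (hε1 : ε ≤ 1) (hK : 0 ≤ K) (hx : VanishesToOrder x (1 + s)) (hy : VanishesToOrder y (1 + s)) :
    ∃ τ ∈ Ioc 0 ε, ∀ t ∈ Ioo 0 τ, x t = 0 ∧ y t = 0 := by
  obtain ⟨τ₀, hτ₀, M₀, hM₀, hb₀⟩ := exists_bound_of_vanishesToOrder hε hx hy
  obtain ⟨R₁, hd₁, hR₁⟩ := h.hasDerivAt_xi (σ := s) rfl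
  obtain ⟨R₂, hd₂, hR₂⟩ := h.hasDerivAt_xi (σ := -s) (by ring)
  set c : ℝ := (|m + s| + |m + -s| + 6) * K with hc
  have hc0 : 0 ≤ c := by positivity
  -- The first summand bounds `x`, the others `y`, when both are recovered from the two components;
  -- `τ` is then chosen with `C τ ≤ 1/2`.
  set C : ℝ := c / s + c + |m + s| * (c / s) with hC
  have hC0 : 0 ≤ C := by positivity
  set τ := min τ₀ (1 / (2 * (C + 1))) with hτdef
  have hτ0 : 0 < τ := lt_min hτ₀.1 (by positivity)
  have hτε : τ ∈ Ioc 0 ε := ⟨hτ0, (min_le_left _ _).trans hτ₀.2⟩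
  have hsub : Ioo 0 τ ⊆ Ioo 0 ε := Ioo_subset_Ioo_right hτε.2
  have hCτ : C * τ ≤ 1 / 2 := by
    have : τ * (2 * (C + 1)) ≤ 1 := by
      rw [← le_div_iff₀ (by positivity)]; exact min_le_right _ _
    nlinarith
  have step : ∀ M : ℝ, 0 ≤ M → (∀ t ∈ Ioo 0 τ, ‖x t‖ ≤ M * t ^ (1 + s) ∧ ‖y t‖ ≤ M * t ^ (1 + s)) →
      ∀ t ∈ Ioo 0 τ, ‖x t‖ ≤ M / 2 * t ^ (1 + s) ∧ ‖y t‖ ≤ M / 2 * t ^ (1 + s) := by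
    intro M hM hb t ht
    have hξ : ∀ {σ : ℝ}, σ ≤ s → VanishesToOrder (fun t => ((m + σ) * x t + 2 * y t)
        * ((t ^ (-σ) : ℝ) : ℂ)) (1 + s + -σ) := fun {σ} _ =>
      ((hx.const_mul (m + σ : ℂ)).add (hy.const_mul 2)).mul (vanishesToOrder_rpow (-σ))
    have hle : ∀ R : ℝ → ℂ, ∀ d ≤ |m + s| + |m + -s| + 6,
        (∀ t ∈ Ioo 0 τ, ‖R t‖ ≤ d * K * M * t ^ (1 + s + 1)) →
        ∀ t ∈ Ioo 0 τ, ‖R t‖ ≤ c * M * t ^ (1 + s + 1) := fun R d hd hR t ht =>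
      (hR t ht).trans (by
        have := Real.rpow_nonneg ht.1.le (1 + s + 1)
        rw [hc]; gcongr)
    have b1 := norm_le_of_euler (k := 1 + s) (mul_nonneg hc0 hM) (by linarith)
      (fun t ht => hd₁ t (hsub ht)) (hle _ _ (by linarith [abs_nonneg (m + -s)])
        (hR₁ τ hτε hε1 M (1 + s) hM (by linarith) hb))
      ((hξ le_rfl).tendsto_zero (by linarith)) t ht
    have b2 := norm_le_of_euler (k := 1 + s) (mul_nonneg hc0 hM) (by linarith)
      (fun t ht => hd₂ t (hsub ht)) (hle _ _ (by linarith [abs_nonneg (m + s)])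
        (hR₂ τ hτε hε1 M (1 + s) hM (by linarith) hb))
      ((hξ (by linarith)).tendsto_zero (by linarith)) t ht
    have ht0 := ht.1
    set X := M * t ^ (1 + s + 1) with hX
    have hX0 : 0 ≤ X := mul_nonneg hM (Real.rpow_nonneg ht0.le _)
    have hXle : C * X ≤ M / 2 * t ^ (1 + s) := by
      have h1 : t ^ (1 + s + 1) = t ^ (1 + s) * t := Real.rpow_add_one ht0.ne' _
      have h2 : 0 ≤ M * t ^ (1 + s) := mul_nonneg hM (Real.rpow_nonneg ht0.le _)
      have h3 : C * t ≤ 1 / 2 := (mul_le_mul_of_nonneg_left ht.2.le hC0).trans hCτ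
      calc C * X = (C * t) * (M * t ^ (1 + s)) := by rw [hX, h1]; ring
        _ ≤ 1 / 2 * (M * t ^ (1 + s)) := by gcongr
        _ = _ := by ring
    have hs' : (s : ℂ) ≠ 0 := by exact_mod_cast hs.ne'
    have nx : ‖x t‖ ≤ c / s * X := by
      have e : x t = (((m + s) * x t + 2 * y t) - ((m + (-s : ℝ)) * x t + 2 * y t)) / ((2 * s : ℝ) : ℂ) := by
        push_cast; field_simp; ring
      rw [e, norm_div, Complex.norm_real, Real.norm_of_nonneg (by positivity), div_le_iff₀ (by positivity)]
      refine (norm_sub_le _ _).trans ((add_le_add b1 b2).trans_eq ?_)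
      rw [hX]; field_simp; ring
    have ny : ‖y t‖ ≤ (c + |m + s| * (c / s)) * X := by
      have e : 2 * y t = ((m + s) * x t + 2 * y t) - ((m + s : ℝ) : ℂ) * x t := by push_cast; ring
      have h1 : ‖2 * y t‖ ≤ c * X + |m + s| * (c / s * X) := by
        rw [e]
        refine (norm_sub_le _ _).trans (add_le_add (b1.trans_eq (by rw [hX]; ring)) ?_)
        rw [norm_mul, Complex.norm_real, Real.norm_eq_abs]
        gcongr
      rw [norm_mul, Complex.norm_two] at h1
      have := norm_nonneg (y t)
      linarith
    have p1 : 0 ≤ c / s * X := by positivity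
    have p2 : 0 ≤ (c + |m + s| * (c / s)) * X := by positivity
    have p3 : C * X = c / s * X + (c + |m + s| * (c / s)) * X := by rw [hC]; ring
    exact ⟨by linarith, by linarith⟩
  have iter : ∀ j : ℕ, ∀ t ∈ Ioo 0 τ, ‖x t‖ ≤ M₀ / 2 ^ j * t ^ (1 + s) ∧
      ‖y t‖ ≤ M₀ / 2 ^ j * t ^ (1 + s) := by
    intro j
    induction j with
    | zero =>
      intro t ht
      simpa using hb₀ t ⟨ht.1, ht.2.trans_le (min_le_left _ _)⟩
    | succ j ih =>
      have := step _ (by positivity) ih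
      simpa [pow_succ, div_div] using this
  refine ⟨τ, hτε, fun t ht => ?_⟩
  have hlim : Tendsto (fun j : ℕ => M₀ / 2 ^ j * t ^ (1 + s)) atTop (𝓝 0) := by
    have h1 : Tendsto (fun j : ℕ => ((1 / 2 : ℝ) ^ j)) atTop (𝓝 0) :=
      tendsto_pow_atTop_nhds_zero_of_lt_one (by norm_num) (by norm_num)
    have := (h1.const_mul M₀).mul_const (t ^ (1 + s))
    simpa [div_eq_mul_inv] using this
  exact ⟨norm_le_zero_iff.1 (ge_of_tendsto' hlim fun j => (iter j t ht).1),
    norm_le_zero_iff.1 (ge_of_tendsto' hlim fun j => (iter j t ht).2)⟩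

end DifferenceSystem


/-! ### Uniqueness near `0`. -/

/-- A solution of the Hamilton equations gives a solution of the reduced system. -/
lemma ReducedSystemAt.of_hamilton {α μ : ℝ} {n : ℕ} {q p : ℝ → ℂ} {t : ℝ} (ht : t ≠ 0)
    (hq : HasDerivAt q (qField α (2 * n + α + μ) t (q t) (p t)) t)
    (hp : HasDerivAt p (pField α (2 * n + α + μ) ((n + α) * (n + α + μ)) t (q t) (p t)) t)
    (hq1 : q t ≠ 1) :
    ReducedSystemAt α μ n (fun t => 1 / (q t - 1)) (fun t => n + α + μ / 2 - p t * q t)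
      (fun t => p t * (p t * q t - α) * (q t - 1)
        - ((n + α + μ / 2 - p t * q t) ^ 2 - μ ^ 2 / 4) * (q t - 1))
      (fun t => ((n + α + μ / 2 - p t * q t) ^ 2 - μ ^ 2 / 4) * (q t - 1)) t := by
  -- The functions playing the roles of `D` and `r` are found by solving the two quadratic
  -- relations; the factor `q` cancels, so zeros of `q` need not be excluded.
  have ht' : (t : ℂ) ≠ 0 := by exact_mod_cast ht
  have hq1' : q t - 1 ≠ 0 := sub_ne_zero.2 hq1
  have hpq := hp.mul hq
  have hv := hpq.const_sub (n + α + μ / 2 : ℂ)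
  have hq2 := hq.sub_const 1
  refine ⟨((hq2.inv hq1').congr_of_eventuallyEq (Eventually.of_forall fun t => by simp)).congr_deriv ?_,
    hv.congr_deriv ?_,
    (((hp.mul (hpq.sub_const (α : ℂ))).mul hq2).sub
      (((hv.pow 2).sub_const ((μ : ℂ) ^ 2 / 4)).mul hq2)).congr_deriv ?_, ?_, ?_⟩
  · simp only [qField]; field_simp; ring
  · simp only [qField, pField]; field_simp; ring
  · simp only [Pi.mul_apply, Pi.pow_apply, qField, pField]; push_cast; field_simp; ring
  · field_simp
  · field_simp; ring

/-- Eliminates `r` by the two quadratic relations, as does the next identity, so that `u`, `v`, `D`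
form a closed system. -/
lemma ReducedSystemAt.deriv_v_eq {α μ : ℝ} {n : ℕ} {u v D r : ℝ → ℂ} {t : ℝ}
    (h : ReducedSystemAt α μ n u v D r t) :
    r t - D t * u t = (n + α + μ / 2) * (n + μ / 2) + μ ^ 2 / 4 - (2 * n + α + μ) * v t
      - (2 * u t + 1) * D t := by
  linear_combination h.quad - h.quad'

lemma ReducedSystemAt.quad_eq {α μ : ℝ} {n : ℕ} {u v D r : ℝ → ℂ} {t : ℝ}
    (h : ReducedSystemAt α μ n u v D r t) :
    v t ^ 2 - μ ^ 2 / 4 = u t * ((n + α + μ / 2) * (n + μ / 2) + μ ^ 2 / 4 - (2 * n + α + μ) * v t)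
      - u t * (u t + 1) * D t := by
  linear_combination (1 + u t) * h.quad - u t * h.quad'

/-- A function with bounded derivative on `(0, ε)` has a limit at `0⁺`. -/
lemma exists_tendsto_of_hasDerivAt {f f' : ℝ → ℂ} {K ε : ℝ} (hε : 0 < ε)
    (hd : ∀ t ∈ Ioo 0 ε, HasDerivAt f (f' t) t) (hb : ∀ t ∈ Ioo 0 ε, ‖f' t‖ ≤ K) :
    ∃ c, Tendsto f (𝓝[>] 0) (𝓝 c) := by
  refine cauchy_map_iff_exists_tendsto.1 (Metric.cauchy_iff.2 ⟨inferInstance, fun η hη => ?_⟩)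
  have hK : 0 ≤ K := (norm_nonneg _).trans (hb (ε / 2) ⟨by positivity, by linarith⟩)
  set δ := min ε (η / (K + 1)) with hδ
  have hδ0 : 0 < δ := lt_min hε (by positivity)
  refine ⟨f '' Ioo 0 δ, image_mem_map (Ioo_mem_nhdsGT hδ0), ?_⟩
  rintro _ ⟨a, ha, rfl⟩ _ ⟨b, hb', rfl⟩
  have hsub : Ioo 0 δ ⊆ Ioo 0 ε := Ioo_subset_Ioo_right (min_le_left _ _)
  have := (convex_Ioo 0 δ).norm_image_sub_le_of_norm_hasDerivWithin_le (C := K)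
    (fun x hx => (hd x (hsub hx)).hasDerivWithinAt) (fun x hx => hb x (hsub hx)) hb' ha
  rw [dist_eq_norm]
  refine this.trans_lt ?_
  have h1 : ‖a - b‖ ≤ δ := by
    rw [Real.norm_eq_abs, abs_le]; constructor <;> linarith [ha.1, ha.2, hb'.1, hb'.2]
  have h2 : δ * (K + 1) ≤ η := by
    rw [← le_div_iff₀ (by positivity)]; exact min_le_right _ _
  nlinarith [mul_le_mul_of_nonneg_left h1 hK]

/-- Consequences of a small time expansion of `f = t u`. -/
lemma HasSmallTimeExpansion.tendsto_div {u : ℝ → ℂ} {s : ℝ} {c₁ c₂ c : ℂ} (hs : 0 < s)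
    (h : HasSmallTimeExpansion (fun t => t * u t) s c₁ c₂ c) : Tendsto u (𝓝[>] 0) (𝓝 c₁) := by
  obtain ⟨A, hA, h1, h2⟩ := h
  have o1 : VanishesToOrder (fun t => A t - (c₁ * t + c₂ * t ^ 2)) 3 := by
    have := h1.mono (nhdsWithin_le_nhds (s := Ioi (0 : ℝ)))
    refine this.trans_eventuallyEq (Eventually.of_forall fun t => ?_)
    norm_cast
  have o2 : VanishesToOrder (fun t : ℝ => c₂ * (t : ℂ) ^ 2) 2 := (vanishesToOrder_pow 2).const_mul c₂
  have o3 := (vanishesToOrder_rpow (1 + s)).const_mul c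
  have hm1 : min 2 (1 + s) ≤ 2 := min_le_left _ _
  have hm2 : min 2 (1 + s) ≤ 1 + s := min_le_right _ _
  have h2' : VanishesToOrder (fun t : ℝ => t * u t - A t - c * ((t ^ (1 + s) : ℝ) : ℂ)) (2 + s) := h2
  have o4 : VanishesToOrder (fun t : ℝ => t * u t - c₁ * ((t ^ (1 : ℝ) : ℝ) : ℂ)) (min 2 (1 + s)) :=
    ((((o1.mono (by linarith)).add (o2.mono hm1)).add (o3.mono hm2)).add (h2'.mono (by linarith))).congr'
      (Eventually.of_forall fun t => by rw [Real.rpow_one]; ring)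
  refine (tendsto_mul_rpow_neg (lt_min one_lt_two (by linarith)) o4).congr' ?_
  filter_upwards [self_mem_nhdsWithin] with t (ht : 0 < t)
  have : (t : ℂ) ≠ 0 := by exact_mod_cast ht.ne'
  rw [Real.rpow_neg_one]; push_cast; field_simp

/-- The prescribed term in `t^(1+s)` cancels and the analytic parts agree up to `O(t³)`. After
division by `t` this removes exactly the resonant power `t^s`. -/
lemma HasSmallTimeExpansion.sub_div {u₁ u₂ : ℝ → ℂ} {s : ℝ} {c₁ c₂ c : ℂ} (hs : 0 < s)
    (h₁ : HasSmallTimeExpansion (fun t => t * u₁ t) s c₁ c₂ c)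
    (h₂ : HasSmallTimeExpansion (fun t => t * u₂ t) s c₁ c₂ c) :
    ∃ g : ℝ → ℂ, AnalyticAt ℝ g 0 ∧ VanishesToOrder (fun t => (u₁ t - u₂ t) - g t) (1 + s) ∧
      VanishesToOrder (fun t => u₁ t - u₂ t) 1 := by
  obtain ⟨A, hA, a1, a2⟩ := h₁
  obtain ⟨B, hB, b1, b2⟩ := h₂
  have hAB : VanishesToOrder (fun t => A t - B t) 3 := by
    have := (a1.sub b1).mono (nhdsWithin_le_nhds (s := Ioi (0 : ℝ)))
    refine (this.congr_left fun t => ?_).trans_eventuallyEq (Eventually.of_forall fun t => ?_)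
    · ring
    · norm_cast
  obtain ⟨g, hg, e⟩ := (hA.sub hB).exists_eq_pow_mul 2 (hAB.mono (by norm_num))
  have hid : AnalyticAt ℝ (fun t : ℝ => (t : ℂ)) 0 := Complex.ofRealCLM.analyticAt 0
  have a2' : VanishesToOrder (fun t : ℝ => t * u₁ t - A t - c * ((t ^ (1 + s) : ℝ) : ℂ)) (2 + s) := a2
  have b2' : VanishesToOrder (fun t : ℝ => t * u₂ t - B t - c * ((t ^ (1 + s) : ℝ) : ℂ)) (2 + s) := b2
  have o1 : VanishesToOrder (fun t => (u₁ t - u₂ t) - t * g t) (1 + s) := by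
    have := (a2'.sub b2').mul (vanishesToOrder_rpow (-1))
    rw [show 2 + s + -1 = 1 + s by ring] at this
    refine this.congr' ?_
    filter_upwards [self_mem_nhdsWithin] with t (ht : 0 < t)
    have ht' : (t : ℂ) ≠ 0 := by exact_mod_cast ht.ne'
    have e' := e t
    simp only [Pi.sub_apply] at e'
    rw [Real.rpow_neg_one, Complex.ofReal_inv, mul_inv_eq_iff_eq_mul₀ ht']
    linear_combination -e'
  refine ⟨fun t => t * g t, hid.mul hg, o1, ?_⟩
  have o2 := vanishesToOrder_id.mul hg.vanishesToOrder
  rw [add_zero] at o2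
  exact ((o1.mono (by linarith)).add o2).congr' (Eventually.of_forall fun t => by ring)

/-- Two solutions of the reduced system with the same small time expansions agree near `0`. -/
lemma ReducedSystemAt.eq_near_zero {α μ : ℝ} {n : ℕ} (hs : 0 < α + μ) (hsZ : ∀ k : ℤ, α + μ ≠ k)
    {u₁ v₁ D₁ r₁ u₂ v₂ D₂ r₂ : ℝ → ℂ}
    (h₁ : ∀ᶠ t in 𝓝[>] 0, ReducedSystemAt α μ n u₁ v₁ D₁ r₁ t)
    (h₂ : ∀ᶠ t in 𝓝[>] 0, ReducedSystemAt α μ n u₂ v₂ D₂ r₂ t)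
    {c₁ c₂ c d₁ d₂ d : ℂ}
    (hu₁ : HasSmallTimeExpansion (fun t => t * u₁ t) (α + μ) c₁ c₂ c)
    (hu₂ : HasSmallTimeExpansion (fun t => t * u₂ t) (α + μ) c₁ c₂ c)
    (hv₁ : HasSmallTimeExpansion (fun t => t * v₁ t) (α + μ) d₁ d₂ d)
    (hv₂ : HasSmallTimeExpansion (fun t => t * v₂ t) (α + μ) d₁ d₂ d)
    (hD₂ : VanishesToOrder (fun t => D₂ t - n * (n + α + μ)) 1) :
    ∀ᶠ t in 𝓝[>] 0, u₁ t = u₂ t ∧ v₁ t = v₂ t := by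
  obtain ⟨gx, agx, hgx, hx⟩ := hu₁.sub_div hs hu₂
  obtain ⟨gy, agy, hgy, hy⟩ := hv₁.sub_div hs hv₂
  have lu₁ := hu₁.tendsto_div hs
  have lu₂ := hu₂.tendsto_div hs
  have lv₁ := hv₁.tendsto_div hs
  have lv₂ := hv₂.tendsto_div hs
  have lD₂ : Tendsto D₂ (𝓝[>] 0) (𝓝 (n * (n + α + μ))) := by
    simpa using (hD₂.tendsto_zero one_pos).add_const (n * (n + α + μ) : ℂ)
  set e : ℝ → ℂ := fun t => 2 * (D₂ t - n * (n + α + μ)) / t with he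
  have oe : VanishesToOrder e 0 := by
    have := (hD₂.const_mul 2).mul (vanishesToOrder_rpow (-1))
    rw [add_neg_cancel] at this
    refine this.congr' (Eventually.of_forall fun t => ?_)
    rw [Real.rpow_neg_one, Complex.ofReal_inv, he]; ring
  obtain ⟨ε₁, hε₁, K₁, hK₁, hb₁⟩ := exists_bound_of_vanishesToOrder one_pos
    (vanishesToOrder_of_tendsto ((lu₁.add lu₂).add_const 1))
    (vanishesToOrder_of_tendsto ((lu₁.const_mul 2).add_const 1))
  obtain ⟨ε₂, hε₂, K₂, hK₂, hb₂⟩ := exists_bound_of_vanishesToOrder hε₁.1 oe (hy.mono zero_le_one)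
  obtain ⟨ε₃, hε₃, hsys⟩ := mem_nhdsGT_iff_exists_Ioo_subset.1 (inter_mem h₁ h₂)
  have hε₃0 : (0 : ℝ) < ε₃ := hε₃
  set ε := min ε₂ ε₃ with hεdef
  have hε : 0 < ε := lt_min hε₂.1 hε₃0
  have hε1 : ε ≤ 1 := ((min_le_left _ _).trans hε₂.2).trans hε₁.2
  simp only [Real.rpow_zero, mul_one] at hb₁ hb₂
  have s1 : Ioo 0 ε ⊆ Ioo 0 ε₁ := Ioo_subset_Ioo_right ((min_le_left _ _).trans hε₂.2)
  have s2 : Ioo 0 ε ⊆ Ioo 0 ε₂ := Ioo_subset_Ioo_right (min_le_left _ _)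
  have s3 : Ioo 0 ε ⊆ Ioo 0 ε₃ := Ioo_subset_Ioo_right (min_le_right _ _)
  have hS₁ : ∀ t ∈ Ioo 0 ε, ReducedSystemAt α μ n u₁ v₁ D₁ r₁ t := fun t ht => (hsys (s3 ht)).1
  have hS₂ : ∀ t ∈ Ioo 0 ε, ReducedSystemAt α μ n u₂ v₂ D₂ r₂ t := fun t ht => (hsys (s3 ht)).2
  -- Nothing is prescribed about `D₁`, but since `D' = t v'` for both solutions, this combination
  -- has the bounded derivative `-(v₁ - v₂)` and therefore a limit.
  set w : ℝ → ℂ := fun t => (D₁ t - D₂ t) - t * (v₁ t - v₂ t) with hw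
  have hdw : ∀ t ∈ Ioo 0 ε, HasDerivAt w (-(v₁ t - v₂ t)) t := fun t ht => by
    have ht' : (t : ℂ) ≠ 0 := by exact_mod_cast ht.1.ne'
    refine (((hS₁ t ht).hasDerivAt_D.sub (hS₂ t ht).hasDerivAt_D).sub
      ((Complex.ofRealCLM.hasDerivAt (x := t)).mul
        ((hS₁ t ht).hasDerivAt_v.sub (hS₂ t ht).hasDerivAt_v))).congr_deriv ?_
    simp
    field_simp
    ring
  obtain ⟨z₀, hz₀⟩ := exists_tendsto_of_hasDerivAt hε hdw (fun t ht => by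
    rw [norm_neg]; exact (hb₂ t (s2 ht)).2)
  have lt : Tendsto (fun t : ℝ => (t : ℂ)) (𝓝[>] 0) (𝓝 0) := vanishesToOrder_id.tendsto_zero one_pos
  have lD₁ : Tendsto D₁ (𝓝[>] 0) (𝓝 (n * (n + α + μ) + z₀)) := by
    have := (hz₀.add (lt.mul (lv₁.sub lv₂))).add lD₂
    rw [zero_mul, add_zero, add_comm z₀] at this
    refine this.congr fun t => ?_
    simp only [hw]; ring
  have near : ∀ᶠ t in 𝓝[>] 0, t ∈ Ioo 0 ε := Ioo_mem_nhdsGT hε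
  have q : ∀ {u v D r : ℝ → ℂ} {D₀ : ℂ}, (∀ t ∈ Ioo 0 ε, ReducedSystemAt α μ n u v D r t) →
      Tendsto u (𝓝[>] 0) (𝓝 c₁) → Tendsto v (𝓝[>] 0) (𝓝 d₁) → Tendsto D (𝓝[>] 0) (𝓝 D₀) →
      d₁ ^ 2 - μ ^ 2 / 4 = c₁ * ((n + α + μ / 2) * (n + μ / 2) + μ ^ 2 / 4 - (2 * n + α + μ) * d₁)
        - c₁ * (c₁ + 1) * D₀ ∧
      (n + α + μ / 2) * (n + μ / 2) + μ ^ 2 / 4 - (2 * n + α + μ) * d₁ - (2 * c₁ + 1) * D₀ = 0 := by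
    intro u v D r D₀ hS hu hv hD
    constructor
    · refine tendsto_nhds_unique ((hv.pow 2).sub_const _) (((hu.mul ((hv.const_mul _).const_sub _)).sub
        ((hu.mul (hu.add_const 1)).mul hD)).congr' ?_)
      filter_upwards [near] with t ht using (hS t ht).quad_eq.symm
    · refine limit_mul_deriv_eq_zero hv (((hv.const_mul _).const_sub _).sub
        (((hu.const_mul 2).add_const 1).mul hD)) ?_
      filter_upwards [near] with t ht
      have := (hS t ht).hasDerivAt_v
      rwa [(hS t ht).deriv_v_eq] at this
  obtain ⟨p1, p2⟩ := q hS₁ lu₁ lv₁ lD₁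
  obtain ⟨p3, p4⟩ := q hS₂ lu₂ lv₂ lD₂
  -- The limits of `D₁` and `D₂` satisfy the same two linear equations, with coefficients `2c₁ + 1`
  -- and `c₁(c₁ + 1)`; these have no common zero because `(2c₁+1)² - 4c₁(c₁+1) = 1`.
  have hz : z₀ = 0 := by linear_combination -(2 * c₁ + 1) * (p2 - p4) - 4 * (p1 - p3)
  rw [hz] at hz₀
  -- With `m = 2n + s`, the entry `(m² - s²)/2 = 2n(n+s)` is twice the limit of `D₂`; the deviation
  -- from it is `t e / 2`, with `e` bounded by `hD₂`.
  have hdiff : DifferenceSystem (2 * n + α + μ) (α + μ) (max K₁ K₂) ε (fun t => u₁ t - u₂ t)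
      (fun t => v₁ t - v₂ t) w (fun t => u₁ t + u₂ t + 1) (fun t => 2 * u₁ t + 1) e := by
    refine ⟨fun t ht => ?_, fun t ht => ?_, hdw, fun t ht => (hb₁ t (s1 ht)).1.trans (le_max_left _ _),
      fun t ht => (hb₁ t (s1 ht)).2.trans (le_max_left _ _),
      fun t ht => (hb₂ t (s2 ht)).1.trans (le_max_right _ _), hz₀⟩
    · refine ((hS₁ t ht).hasDerivAt_u.sub (hS₂ t ht).hasDerivAt_u).congr_deriv ?_
      push_cast; ring
    · have ht' : (t : ℂ) ≠ 0 := by exact_mod_cast ht.1.ne'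
      refine ((hS₁ t ht).hasDerivAt_v.sub (hS₂ t ht).hasDerivAt_v).congr_deriv ?_
      rw [(hS₁ t ht).deriv_v_eq, (hS₂ t ht).deriv_v_eq, he, hw]
      push_cast
      field_simp
      ring
  have hK : 0 ≤ max K₁ K₂ := hK₁.trans (le_max_left _ _)
  obtain ⟨o1, o2⟩ := hdiff.order_one_add hs hε hε1 hK (fun k => by simpa using hsZ k) agx agy hgx hgy
    (hx.mono zero_le_one) (hy.mono zero_le_one)
  obtain ⟨τ, hτ, h0⟩ := hdiff.eventually_eq_zero hs hε hε1 hK o1 o2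
  filter_upwards [Ioo_mem_nhdsGT hτ.1] with t ht
  exact ⟨sub_eq_zero.1 (h0 t ht).1, sub_eq_zero.1 (h0 t ht).2⟩


/-! ### Continuation of the equality to `(0, T)`. -/

lemma HasSmallTimeExpansion.congr {f g : ℝ → ℂ} {s : ℝ} {c₁ c₂ c : ℂ}
    (h : HasSmallTimeExpansion f s c₁ c₂ c) (hfg : ∀ᶠ t in 𝓝[>] 0, f t = g t) :
    HasSmallTimeExpansion g s c₁ c₂ c := by
  obtain ⟨A, hA, h1, h2⟩ := h
  exact ⟨A, hA, h1, h2.congr' (hfg.mono fun t ht => by simp only [ht]) EventuallyEq.rfl⟩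

/-- Solutions of the Hamilton equations that agree near `0` agree on `(0, T)`. -/
lemma hamilton_unique {α m c : ℂ} {T : ℝ} (hT : 0 < T) {q₁ p₁ q₂ p₂ : ℝ → ℂ}
    (hq₁ : ∀ t ∈ Ioo 0 T, HasDerivAt q₁ (qField α m t (q₁ t) (p₁ t)) t)
    (hp₁ : ∀ t ∈ Ioo 0 T, HasDerivAt p₁ (pField α m c t (q₁ t) (p₁ t)) t)
    (hq₂ : ∀ t ∈ Ioo 0 T, HasDerivAt q₂ (qField α m t (q₂ t) (p₂ t)) t)
    (hp₂ : ∀ t ∈ Ioo 0 T, HasDerivAt p₂ (pField α m c t (q₂ t) (p₂ t)) t)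
    (h : ∀ᶠ t in 𝓝[>] 0, q₁ t = q₂ t ∧ p₁ t = p₂ t) :
    ∀ t ∈ Ioo 0 T, q₁ t = q₂ t ∧ p₁ t = p₂ t := by
  -- Time becomes a coordinate, so the field is autonomous and, away from `t = 0`, continuously
  -- differentiable, hence locally Lipschitz.
  set V : ℝ × ℂ × ℂ → ℝ × ℂ × ℂ := fun x =>
    (1, qField α m x.1 x.2.1 x.2.2, pField α m c x.1 x.2.1 x.2.2) with hV
  set F : ℝ → ℝ × ℂ × ℂ := fun t => (t, q₁ t, p₁ t) with hF
  set G : ℝ → ℝ × ℂ × ℂ := fun t => (t, q₂ t, p₂ t) with hG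
  have dF : ∀ t ∈ Ioo 0 T, HasDerivAt F (V (F t)) t := fun t ht =>
    (hasDerivAt_id t).prodMk ((hq₁ t ht).prodMk (hp₁ t ht))
  have dG : ∀ t ∈ Ioo 0 T, HasDerivAt G (V (G t)) t := fun t ht =>
    (hasDerivAt_id t).prodMk ((hq₂ t ht).prodMk (hp₂ t ht))
  have hVd : ∀ x : ℝ × ℂ × ℂ, x.1 ≠ 0 → ContDiffAt ℝ 1 V x := by
    intro x hx
    have hx' : (x.1 : ℂ) ≠ 0 := by exact_mod_cast hx
    have h1 : ContDiff ℝ 1 (fun x : ℝ × ℂ × ℂ => (x.1 : ℂ)) :=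
      Complex.ofRealCLM.contDiff.comp contDiff_fst
    have h2 : ContDiff ℝ 1 (fun x : ℝ × ℂ × ℂ => x.2.1) := contDiff_fst.comp contDiff_snd
    have h3 : ContDiff ℝ 1 (fun x : ℝ × ℂ × ℂ => x.2.2) := contDiff_snd.comp contDiff_snd
    refine contDiffAt_const.prodMk (ContDiffAt.prodMk ?_ ?_)
    all_goals
      simp only [qField, pField, div_eq_mul_inv]
      exact (ContDiff.contDiffAt (by fun_prop)).mul (h1.contDiffAt.inv hx')
  -- The set of times near which the solutions agree is open, nonempty and relatively closed in a
  -- connected interval; closedness is the local uniqueness theorem.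
  have key : Ioo 0 T ⊆ {t | t ∈ Ioo 0 T ∧ F =ᶠ[𝓝 t] G} := by
    refine isPreconnected_Ioo.subset_of_closure_inter_subset ?_ ?_ ?_
    · refine isOpen_iff_mem_nhds.2 fun t ht => ?_
      filter_upwards [isOpen_Ioo.mem_nhds ht.1, ht.2.eventually_nhds] with x h1 h2 using ⟨h1, h2⟩
    · obtain ⟨ε, hε, hb⟩ := mem_nhdsGT_iff_exists_Ioo_subset.1 h
      have hε0 : (0 : ℝ) < ε := hε
      have hm : 0 < min ε T := lt_min hε0 hT
      have ht : min ε T / 2 ∈ Ioo 0 T := ⟨by positivity, by linarith [min_le_right ε T]⟩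
      refine ⟨_, ht, ht, ?_⟩
      filter_upwards [isOpen_Ioo.mem_nhds (show min ε T / 2 ∈ Ioo 0 ε from
        ⟨by positivity, by linarith [min_le_left ε T]⟩)] with x hx
      have := hb hx
      simp only [hF, hG, this.1, this.2]
    · rintro t ⟨ht, htT⟩
      refine ⟨htT, ?_⟩
      have e : F t = G t := by
        by_contra hne
        have h1 := ((dF t htT).continuousAt.tendsto.prodMk_nhds (dG t htT).continuousAt.tendsto)
          |>.eventually (isClosed_diagonal.isOpen_compl.mem_nhds (show (F t, G t) ∉ diagonal _ from hne))
        obtain ⟨x, hx, hx2⟩ := (mem_closure_iff_frequently.1 ht).and_eventually h1 |>.exists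
        exact hx2 hx.2.self_of_nhds
      obtain ⟨K, S, hS, hK⟩ := (hVd (F t) htT.1.ne').exists_lipschitzOnWith
      refine ODE_solution_unique_of_eventually (v := fun _ => V) (s := fun _ => S) (K := K)
        (Eventually.of_forall fun _ => hK) ?_ ?_ e
      · filter_upwards [isOpen_Ioo.mem_nhds htT, (dF t htT).continuousAt.preimage_mem_nhds hS]
          with x h1 h2 using ⟨dF x h1, h2⟩
      · rw [e] at hS
        filter_upwards [isOpen_Ioo.mem_nhds htT, (dG t htT).continuousAt.preimage_mem_nhds hS]
          with x h1 h2 using ⟨dG x h1, h2⟩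
  intro t ht
  have := (key ht).2.self_of_nhds
  simp only [hF, hG, Prod.mk.injEq] at this
  exact this.2

/-- A solution for which `t / (q - 1) = O(t)` does not take the value `1` near `0`. -/
lemma hamilton_ne_one {α m : ℂ} {T : ℝ} (hT : 0 < T) {q p : ℝ → ℂ} {c : ℂ}
    (hq : ∀ t ∈ Ioo 0 T, HasDerivAt q (qField α m t (q t) (p t)) t)
    (hu : Tendsto (fun t => 1 / (q t - 1)) (𝓝[>] 0) (𝓝 c)) : ∀ᶠ t in 𝓝[>] 0, q t ≠ 1 := by
  have hC := hu.norm.eventually (gt_mem_nhds (show ‖c‖ < ‖c‖ + 1 by linarith))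
  obtain ⟨ε, hε, hb⟩ := mem_nhdsGT_iff_exists_Ioo_subset.1 hC
  have hε0 : (0 : ℝ) < ε := hε
  filter_upwards [Ioo_mem_nhdsGT (lt_min hT hε0)] with t ht hqt
  have htT : t ∈ Ioo 0 T := ⟨ht.1, ht.2.trans_le (min_le_left _ _)⟩
  have htε : t ∈ Ioo 0 ε := ⟨ht.1, ht.2.trans_le (min_le_right _ _)⟩
  have hd := hq t htT
  have ht' : (t : ℂ) ≠ 0 := by exact_mod_cast ht.1.ne'
  -- Where `q = 1` the equation forces `q' = -1`, so `q - 1` is small and nonzero at nearby times,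
  -- contradicting the bound on `1 / (q - 1)`. At the time itself the convention `1 / 0 = 0` would
  -- hide the pole.
  have hv : qField α m t (q t) (p t) = -1 := by rw [hqt, qField]; field_simp; ring
  have h1 := hd.eventually_ne (c := 1) (by rw [hv]; norm_num)
  have h2 : ∀ᶠ x in 𝓝 t, ‖q x - 1‖ < 1 / (‖c‖ + 1) := by
    have := (hd.continuousAt.tendsto.sub_const 1).norm
    rw [hqt, sub_self, norm_zero] at this
    exact this.eventually (gt_mem_nhds (by positivity))
  obtain ⟨x, h3, h4, h5⟩ := (h1.and ((h2.filter_mono nhdsWithin_le_nhds).and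
    ((isOpen_Ioo.eventually_mem htε).filter_mono nhdsWithin_le_nhds))).exists
  have h6 : ‖1 / (q x - 1)‖ < ‖c‖ + 1 := hb h5
  have h7 : 0 < ‖q x - 1‖ := norm_pos_iff.2 (sub_ne_zero.2 h3)
  rw [norm_div, norm_one, div_lt_iff₀ h7] at h6
  rw [lt_div_iff₀ (by positivity)] at h4
  linarith


/-! ### Application to the deformed Laguerre weight. -/

section

variable {ζ α μ : ℝ} {ω : ℂ} {n : ℕ} {P : ℕ → ℂ[X]} {t : ℝ}

lemma opNorm_ne_zero_of_weight (hα : -1 < α) (hμ : -1 < μ) (ht : 0 < t) {a b : ℕ → ℂ}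
    (h : IsOrthonormalWithRecurrence (deformedLaguerreWeight ζ α μ ω t) (n + 1) P a b) :
    (∀ j ≤ n, opNorm (laguerreMoment ζ α μ ω t) j ≠ 0) ∧
      (∀ m ≤ n, b m = opDiag (laguerreMoment ζ α μ ω t) m) ∧
      a n ^ 2 = opOff (laguerreMoment ζ α μ ω t) n := by
  have hort : ∀ i ≤ n + 1, ∀ j ≤ n + 1,
      momentFunctional (laguerreMoment ζ α μ ω t) (P i * P j) = if i = j then 1 else 0 := by
    intro i hi j hj
    rw [← (deformedLaguerre_functional hα hμ ht (P i * P j)).2, ← h.orthonormal i hi j hj]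
    simp only [eval_mul]
  exact ⟨fun j hj => opNorm_ne_zero_of_orthonormal h.degree_eq hort j (by omega),
    fun m hm => recurrence_diag_eq h.degree_eq hort h.a_zero h.recurrence m (by omega),
    recurrence_off_sq_eq h.degree_eq hort h.a_zero h.recurrence n (by omega)⟩

end

section

variable {ζ α μ : ℝ} {ω : ℂ} {n : ℕ} {U : Set ℝ} {P : ℝ → ℕ → ℂ[X]} {a b : ℝ → ℕ → ℂ}
  (hα : -1 < α) (hμ : -1 < μ) (hU : IsOpen U) (hUpos : U ⊆ Ioi 0)
  (hP : ∀ t ∈ U, IsOrthonormalWithRecurrence (deformedLaguerreWeight ζ α μ ω t) (n + 1)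
    (P t) (a t) (b t))
include hα hμ hUpos hP

/-- The polynomials are chosen separately for each `t`, with arbitrary signs. Only `a_n²` and the
`b_i` occur in `θ_n` and `κ_n`, so these depend on the moments alone and inherit their smoothness.
-/
lemma thetaCoeff_kappaCoeff_eq {t : ℝ} (ht : t ∈ U) :
    thetaCoeff α μ n b t = opTheta α μ t (laguerreMoment ζ α μ ω t) n ∧
      kappaCoeff μ n a b t = opKappa μ t (laguerreMoment ζ α μ ω t) n := by
  obtain ⟨-, h2, h3⟩ := opNorm_ne_zero_of_weight hα hμ (hUpos ht) (hP t ht)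
  constructor
  · rw [thetaCoeff, opTheta, h2 n le_rfl]
  · rw [kappaCoeff, opKappa, h3, opSum]
    congr 1
    exact Finset.sum_congr rfl fun i hi => h2 i (Finset.mem_range.1 hi).le

include hU

/-- `q` and `p` satisfy the Hamilton equations, written out. -/
lemma hasDerivAt_qCoord_pCoord {t : ℝ} (ht : t ∈ U) (h0 : thetaCoeff α μ n b t ≠ 0)
    (h1 : thetaCoeff α μ n b t + t ≠ 0) :
    HasDerivAt (qCoord α μ n b)
      (qField α (2 * n + α + μ) t (qCoord α μ n b t) (pCoord α μ n a b t)) t ∧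
    HasDerivAt (pCoord α μ n a b) (pField α (2 * n + α + μ) ((n + α) * (n + α + μ)) t
      (qCoord α μ n b t) (pCoord α μ n a b t)) t ∧ ContinuousAt (thetaCoeff α μ n b) t := by
  set M := laguerreMoment ζ α μ ω with hM
  have hpos : 0 < t := hUpos ht
  have near := hU.mem_nhds ht
  have hF : ∀ᶠ x in 𝓝 t, MomentFlowAt (1 + α + μ) M x := by
    filter_upwards [near] with x hx using momentFlowAt_laguerreMoment hα hμ (hUpos hx)
  have hR : ∀ᶠ x in 𝓝 t, PearsonRelation α μ (x : ℝ) (M x) := by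
    filter_upwards [near] with x hx using pearsonRelation_laguerreMoment hα hμ (hUpos hx)
  have hn := (opNorm_ne_zero_of_weight hα hμ hpos (hP t ht)).1
  have eθ : (fun t => opTheta α μ t (M t) n) =ᶠ[𝓝 t] thetaCoeff α μ n b := by
    filter_upwards [near] with x hx using (thetaCoeff_kappaCoeff_eq hα hμ hUpos hP hx).1.symm
  have eκ : (fun t => opKappa μ t (M t) n) =ᶠ[𝓝 t] kappaCoeff μ n a b := by
    filter_upwards [near] with x hx using (thetaCoeff_kappaCoeff_eq hα hμ hUpos hP hx).2.symm
  have dθ := (hF.self_of_nhds.hasDerivAt_opTheta hpos.ne' hR.self_of_nhds n hn).congr_of_eventuallyEq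
    eθ.symm
  have dκ := (hF.self_of_nhds.hasDerivAt_opKappa (α := α) hpos.ne' n hn).congr_of_eventuallyEq eκ.symm
  obtain ⟨q1, q2⟩ := MomentFlowAt.quadratic_relations hpos.ne' hF hR n hn
  have eθt := eθ.self_of_nhds
  have eκt := eκ.self_of_nhds
  simp only at eθt eκt
  rw [eθt] at dθ dκ q1 q2
  rw [eκt] at dθ dκ q1 q2
  exact ⟨hasDerivAt_q_of_theta hpos.ne' h0 h1 dθ,
    hasDerivAt_p_of_theta_kappa hpos.ne' h0 h1 dθ dκ q1 q2, dθ.continuousAt⟩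

end

end

theorem proposition1p1 (ζ α μ : ℝ) (hζ : ζ < 1) (hα : -1 < α) (hμ : -1 < μ) (ω : ℂ) (n : ℕ)
    (U : Set ℝ) (hU : IsOpen U) (hUpos : U ⊆ Set.Ioi 0)
    (P : ℝ → ℕ → Polynomial ℂ) (a b : ℝ → ℕ → ℂ)
    (hP : ∀ t ∈ U, IsOrthonormalWithRecurrence (deformedLaguerreWeight ζ α μ ω t) (n + 1)
      (P t) (a t) (b t))
    (v₁ v₂ v₃ v₄ : ℂ) (hv : v₁ + v₂ + v₃ + v₄ = 0)
    (h34 : v₃ - v₄ = -μ) (h31 : v₃ - v₁ = n + α) (h32 : v₃ - v₂ = n) :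
    -- parameters of the fifth Painlevé equation
    ((v₃ - v₄) ^ 2 / 2 = (μ : ℂ) ^ 2 / 2 ∧ -(v₂ - v₁) ^ 2 / 2 = -(α : ℂ) ^ 2 / 2 ∧
      2 * v₁ + 2 * v₂ - 1 = -(2 * n + α + 1 + μ)) ∧
    -- Hamilton equations, the inverse formulas, and the fifth Painlevé equation
    (∀ t ∈ U, thetaCoeff α μ n b t ≠ 0 → thetaCoeff α μ n b t + t ≠ 0 →
      HamiltonEquationsAt (okamotoHamiltonian v₁ v₂ v₃ v₄) (qCoord α μ n b) (pCoord α μ n a b) t ∧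
      qCoord α μ n b t ≠ 0 ∧ qCoord α μ n b t ≠ 1 ∧
      thetaCoeff α μ n b t = t / (qCoord α μ n b t - 1) ∧
      kappaCoeff μ n a b t = t * (n + α + μ / 2 - pCoord α μ n a b t * qCoord α μ n b t) ∧
      PainleveVAt ((μ : ℂ) ^ 2 / 2) (-(α : ℂ) ^ 2 / 2) (-(2 * n + α + 1 + μ)) (-1 / 2)
        (qCoord α μ n b) t) ∧
    -- small `t` expansions, and uniqueness of the solution that they specify
    (0 < α + μ → (∀ k : ℤ, α + μ ≠ k) → U ∈ nhdsWithin 0 (Set.Ioi 0) →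
      SmallTimeExpansions ζ α μ ω n (thetaCoeff α μ n b) (kappaCoeff μ n a b) ∧
      ∀ T : ℝ, 0 < T → Set.Ioo 0 T ⊆ U →
        (∀ t ∈ Set.Ioo 0 T, thetaCoeff α μ n b t ≠ 0 ∧ thetaCoeff α μ n b t + t ≠ 0) →
        ∀ q p : ℝ → ℂ,
          (∀ t ∈ Set.Ioo 0 T,
            HamiltonEquationsAt (okamotoHamiltonian v₁ v₂ v₃ v₄) q p t) →
          SmallTimeExpansions ζ α μ ω n (fun t => t / (q t - 1))
            (fun t => t * (n + α + μ / 2 - p t * q t)) →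
          ∀ t ∈ Set.Ioo 0 T, q t = qCoord α μ n b t ∧ p t = pCoord α μ n a b t) := by
  have hH : ∀ (q p : ℝ → ℂ) (t : ℝ), _ := fun q p t =>
    hamiltonEquationsAt_iff (α := (α : ℂ)) (μ := μ) (n := n) hv h34 h31 h32 q p t
  have hne : ∀ t ∈ U, (t : ℂ) ≠ 0 := fun t ht => by
    have h : (0 : ℝ) < t := hUpos ht
    exact_mod_cast h.ne'
  refine ⟨⟨?_, ?_, ?_⟩, fun t ht h0 h1 => ?_, fun hs hsZ hU0 => ?_⟩
  · rw [h34, neg_sq]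
  · rw [show v₂ - v₁ = α by linear_combination h31 - h32]
  · linear_combination hv - h31 - h32 + h34
  · have ht0 := hne t ht
    obtain ⟨hq, hp, hc⟩ := hasDerivAt_qCoord_pCoord hα hμ hU hUpos hP ht h0 h1
    have hq0 : qCoord α μ n b t ≠ 0 := div_ne_zero h1 h0
    have hq1 : qCoord α μ n b t - 1 = t / thetaCoeff α μ n b t := by
      rw [qCoord]; field_simp; ring
    have hq1' : qCoord α μ n b t ≠ 1 := fun h => by
      rw [h, sub_self, eq_comm, div_eq_zero_iff] at hq1
      tauto
    refine ⟨(hH _ _ _).2 ⟨hq, hp⟩, hq0, hq1', ?_, ?_,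
      painleveVAt_of_hamilton (p := pCoord α μ n a b) (hUpos ht).ne' ?_ hq0 hq1'⟩
    · rw [hq1]; field_simp
    · rw [pCoord, qCoord]; field_simp; ring
    -- The second derivative needs the Hamilton equations near `t`; the two nonvanishing conditions
    -- persist by continuity of `θ_n`.
    · have hct : ContinuousAt (fun x : ℝ => (x : ℂ)) t := Complex.continuous_ofReal.continuousAt
      filter_upwards [hU.mem_nhds ht, hc.eventually_ne h0, (hc.add hct).eventually_ne h1]
        with x hx hx0 hx1
      have := hasDerivAt_qCoord_pCoord hα hμ hU hUpos hP hx hx0 hx1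
      exact ⟨this.1, this.2.1⟩
  · obtain ⟨⟨eθ, eκ⟩, -, hD⟩ := smallTimeExpansions_moments hζ hα hμ ω n hs hsZ
    set M := laguerreMoment ζ α μ ω with hM
    refine ⟨⟨eθ.congr ?_, eκ.congr ?_⟩, fun T hT hTU hnz q p hqp hexp => ?_⟩
    · filter_upwards [hU0] with t ht using (thetaCoeff_kappaCoeff_eq hα hμ hUpos hP ht).1.symm
    · filter_upwards [hU0] with t ht using (thetaCoeff_kappaCoeff_eq hα hμ hUpos hP ht).2.symm
    have hd := fun t (ht : t ∈ Ioo 0 T) => (hH q p t).1 (hqp t ht)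
    have hd' := fun t (ht : t ∈ Ioo 0 T) =>
      hasDerivAt_qCoord_pCoord hα hμ hU hUpos hP (hTU ht) (hnz t ht).1 (hnz t ht).2
    have hTn : ∀ᶠ t in 𝓝[>] 0, t ∈ Ioo 0 T := Ioo_mem_nhdsGT hT
    obtain ⟨xθ, xκ⟩ := hexp
    have xθ' := xθ.congr (g := fun t : ℝ => t * (1 / (q t - 1)))
      (Eventually.of_forall fun t => by ring)
    have hq1 := hamilton_ne_one hT (fun t ht => (hd t ht).1) (xθ'.tendsto_div hs)
    have h₁ := (hTn.and hq1).mono fun t h =>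
      ReducedSystemAt.of_hamilton h.1.1.ne' (hd t h.1).1 (hd t h.1).2 h.2
    have h₂ := hTn.mono fun t ht => ReducedSystemAt.of_moments (M := M) ht.1
      ((lt_mem_nhds ht.1).mono fun x hx => momentFlowAt_laguerreMoment hα hμ hx)
      ((lt_mem_nhds ht.1).mono fun x hx => pearsonRelation_laguerreMoment hα hμ hx)
      (opNorm_ne_zero_of_weight hα hμ ht.1 (hP t (hTU ht))).1
    have hcancel : ∀ f : ℝ → ℂ, ∀ᶠ t : ℝ in 𝓝[>] 0, f t = t * (f t / t) := fun f => by
      filter_upwards [hTn] with t ht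
      have := hne t (hTU ht)
      field_simp
    have hagree := ReducedSystemAt.eq_near_zero hs hsZ h₁ h₂ xθ' (eθ.congr (hcancel _)) xκ
      (eκ.congr (hcancel _)) hD
    refine hamilton_unique hT (fun t ht => (hd t ht).1) (fun t ht => (hd t ht).2)
      (fun t ht => (hd' t ht).1) (fun t ht => (hd' t ht).2.1) ?_
    filter_upwards [hTn, hagree, hq1] with t ht hag hqt
    have ht0 := hne t (hTU ht)
    obtain ⟨z0, z1⟩ := hnz t ht
    rw [← (thetaCoeff_kappaCoeff_eq hα hμ hUpos hP (hTU ht)).1,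
      ← (thetaCoeff_kappaCoeff_eq hα hμ hUpos hP (hTU ht)).2] at hag
    have hqt' : q t - 1 ≠ 0 := sub_ne_zero.2 hqt
    -- Equality of `θ/t` gives `q`, equality of `κ/t` gives the product `p q`, and `q ≠ 0` then
    -- gives `p`.
    have eq1 : q t = qCoord α μ n b t := by
      have h := hag.1
      rw [div_eq_div_iff hqt' ht0] at h
      rw [qCoord, eq_div_iff z0]
      linear_combination -h
    have hq0 : qCoord α μ n b t ≠ 0 := div_ne_zero z1 z0
    refine ⟨eq1, mul_right_cancel₀ hq0 ?_⟩
    have h := hag.2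
    rw [eq1] at h
    have : pCoord α μ n a b t * qCoord α μ n b t = n + α + μ / 2 - kappaCoeff μ n a b t / t := by
      rw [pCoord, qCoord]; field_simp
    rw [this]
    linear_combination -h
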